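/- \textbf{Setting.} All random variables are complex valued and have finite second moments on a probability space; $B$ is the backward shift, $^*$ is the conjugate transpose, and a bar over a matrix or vector denotes entrywise conjugation. Let $T\ge 1$, $\overline d,\overline s,\overline\mu\in\{1,2,\dots\}^r$. Put $$\prod_{i=1}^r(1-B^{\mu_is_i})^{d_i}=\sum_{k=0}^{n(\gamma)}e_\gamma(k)B^k,\qquad n(\gamma)=\sum_i\mu_is_id_i,$$ $$\chi_{\overline\mu}(e^{-i\lambda})=\prod_{j}(1-e^{-i\lambda\mu_js_j})^{d_j},\qquad \beta(i\lambda)=\prod_j\prod_{k=-[s_j/2]}^{[s_j/2]}(i\lambda-2\pi ik/s_j)^{d_j}.$$ For a sequence $x$ write $\chi_{\overline\mu,\overline s}(x(m))=\prod_i(1-B^{\mu_is_i})^{d_i}x(m)$; here $\overline\mu$ may also have all components negative. Let $\xi(m)$, $m\in\mathbb Z$, have periodically stationary generalized multiple (GM) increments with a period $T$: the means $\mathsf E\chi_{\overline\mu_1,T\overline s}(\xi(m))$ and the correlations $\mathsf E\,\chi_{\overline\mu_1,T\overline s}(\xi(m))\overline{\chi_{\overline\mu_2,T\overline s}(\xi(k))}$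 do not change when $T$ is added to the times, for all admissible steps $\overline\mu_1,\overline\mu_2$ (all components positive or all negative). Let $\eta(m)$ be periodically stationary with the period $T$ and uncorrelated with $\xi$. Assume that the increments of $\xi$ and the noise $\eta$ have mean zero, and put $\zeta=\xi+\eta$. For $p=1,\dots,T$ let $$\xi_p(m)=\xi(mT-p+1),\qquad \eta_p(m)=\eta(mT-p+1),\qquad \zeta_p=\xi_p+\eta_p,$$ so that the blocks $\vec\zeta(m)=(\zeta_p(m))_{p=1}^T$, $m\le 0$, consist exactly of the observations $\zeta(0),\zeta(-1),\zeta(-2),\dots$. Let $\vec\xi$ and $\vec\eta$ have spectral densities $f$, $g$ (integrable $T\times T$ matrix functions on $[-\pi,\pi)$), i.e. $$\mathsf E\,\chi_{\overline\mu_1,\overline s}(\xi_p(m))\overline{\chi_{\overline\mu_2,\overline s}(\xi_q(k))}=\frac1{2\pi}\int_{-\pi}^{\pi}e^{i\lambda(m-k)}\frac{\chi_{\overline\mu_1}(e^{-i\lambda})\overline{\chi_{\overline\mu_2}(e^{-i\lambda})}}{|\beta(i\lambda)|^2}f_{pq}(\lambda)\,d\lambda,\qquad \mathsf E\,\eta_p(m)\overline{\eta_q(k)}=\frac1{2\pi}\int_{-\pi}^{\pi}e^{i\lambda(m-k)}g_{pq}(\lambda)\,d\lambda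 .$$ Let $P=f+|\beta(i\lambda)|^2g$ be invertible almost everywhere and suppose that, almost everywhere, $$\frac{|\chi_{\overline\mu}|^2}{|\beta|^2}P=\Theta\Theta^*,\qquad \Psi\Theta=E_q,\qquad \frac{|\beta|^2}{|\chi_{\overline\mu}|^2}P^{-1}=\Psi^*\Psi,\qquad g=\Phi\Phi^*,$$ where $\Theta(e^{-i\lambda})=\sum_{k\ge0}\theta(k)e^{-i\lambda k}$, $\Psi(e^{-i\lambda})=\sum_{k\ge0}\psi(k)e^{-i\lambda k}$, $\Phi(e^{-i\lambda})=\sum_{k\ge0}\phi(k)e^{-i\lambda k}$ converge in mean square on $[-\pi,\pi)$ ($\theta(k)$ is $T\times q$, $\psi(k)$ is $q\times T$, $\phi(k)$ is $T\times q'$). Let $g(k)=\frac1{2\pi}\int_{-\pi}^{\pi}e^{-i\lambda k}g(\lambda)\,d\lambda$ and assume $\sum_{k\in\mathbb Z}\|g(k)\|^2<\infty$. Let $A\xi=\sum_{k\ge0}a(k)\xi(-k)$ converge in mean square, and let $\vec a(m)=(a_p(m))_{p=1}^T$, $a_p(m)=a(mT+p-1)$, satisfy $\sum_k\|\vec a(k)\|<\infty$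 and $\sum_k(k+1)\|\vec a(k)\|^2<\infty$. Put $$\vec a_{-\overline\mu}(m)=\sum_{l=\max\{m,0\}}^{m+n(\gamma)}e_\gamma(l-m)\vec a(l)\quad(m\ge-n(\gamma)),$$ $\vec b_{-\overline\mu}(k)=\vec a_{-\overline\mu}(-k)$ for $1\le k\le n(\gamma)$ and $\vec b_{-\overline\mu}(k)=0$ for $k=0$ and $k>n(\gamma)$; further, for $m\ge0$, $$c^-(m)=\sum_{k\ge0}\overline{g(m-k)}\,\vec a_{-\overline\mu}(k),\quad c^+(m)=\sum_{k\ge0}\overline{g(m+k)}\,\vec b_{-\overline\mu}(k),\quad (\overline\psi\,\mathbf C^{\pm})_m=\sum_{k\ge0}\overline{\psi(k)}\,c^{\pm}(k+m),$$ $$(\widetilde\Phi x)_m=\sum_{k=0}^m\phi(m-k)^\top x(k),\qquad(\widetilde\Phi^+x)_m=\sum_{k\ge0}\phi(m+k)^\top x(k).$$ Let $H$ be the mean-square closed linear span of the increments $\chi_{\overline\mu,T\overline s}(\zeta(m))$, $m\le 0$. A linear estimate of $A\xi$ is a random variable $A\zeta-Y$ with $Y\in H$, where $A\zeta=\sum_k\vec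 a(k)^\top\vec\zeta(-k)$; it is optimal if it minimizes the mean square error among all linear estimates. Let $L_2^0(P)$ be the closed linear span in $L_2(P)$ of $e^{i\lambda k}\chi_{\overline\mu}(e^{-i\lambda})\beta(i\lambda)^{-1}\vec\delta_l$, $k\le0$, $1\le l\le T$. The spectral process of $\chi_{\overline\mu,\overline s}(\vec\zeta)$ is a $\mathbb C^T$-valued process $Z$ on $[-\pi,\pi]$ with uncorrelated increments and with spectral density $P$ (with respect to $d\lambda/2\pi$) such that $\chi_{\overline\mu,\overline s}(\vec\zeta(m))=\int_{-\pi}^{\pi}e^{i\lambda m}\chi_{\overline\mu}(e^{-i\lambda})\beta(i\lambda)^{-1}dZ(\lambda)$ for all $m\in\mathbb Z$. \textbf{Theorem.} Under these assumptions a spectral process $Z$ exists, $A\xi=A\vec\xi=\sum_{m\ge0}\vec a(m)^\top\vec\xi(-m)$, the series $A\zeta$ converges in mean square, all series above converge, and $$c^-(m)=\sum_{l\ge0}\overline{\phi(l)}\,(\widetilde\Phi\,\vec a_{-\overline\mu})_{l+m},\qquad c^+(m)=\sum_{l\ge0}\overline{\phi(l)}\,(\widetilde\Phi^+\vec b_{-\overline\mu})_{l+m}.$$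 For every spectral process $Z$ there is exactly one optimal linear estimate, and it is $$\widehat A\xi=\sum_{k\ge0}\vec a(k)^\top(\vec\xi(-k)+\vec\eta(-k))-\int_{-\pi}^{\pi}\vec h_{\overline\mu}(\lambda)^\top dZ(\lambda),$$ with the (almost everywhere unique) spectral characteristic $$\vec h_{\overline\mu}(\lambda)=\frac{\chi_{\overline\mu}(e^{-i\lambda})}{\beta(i\lambda)}\Big(\sum_{k\ge0}\psi(k)^\top e^{-i\lambda k}\Big)\sum_{m\ge0}\big(\overline\psi\,\mathbf C^-+\overline\psi\,\mathbf C^+\big)_m e^{-i\lambda m}\in L_2^0(P),$$ and its mean square error is $$\mathsf E|A\xi-\widehat A\xi|^2=\sum_{m\ge0}\|(\widetilde\Phi\,\vec a)_m\|^2-\sum_{m\ge0}\big\|\big(\overline\psi\,\mathbf C^-+\overline\psi\,\mathbf C^+\big)_m\big\|^2 .$$ -/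

import Mathlib

open MeasureTheory Filter Topology
open scoped ComplexOrder

namespace GMFilter

noncomputable section

/-! ### Generalized multiple increments -/

/-- An admissible step vector: all components positive or all components negative. -/
def AdmissibleStep {r : ℕ} (μ : Fin r → ℤ) : Prop := (∀ i, 0 < μ i) ∨ (∀ i, μ i < 0)

/-- The generalized multiple increment `∏ᵢ (1 - B ^ (μᵢ sᵢ)) ^ dᵢ` applied to the sequence `x`
and evaluated at `m`, where `B` is the backward shift. -/
def gmIncrement {r : ℕ} {E : Type*} [AddCommGroup E] (d s : Fin r → ℕ) (μ : Fin r → ℤ)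
    (x : ℤ → E) (m : ℤ) : E :=
  ∑ l ∈ Fintype.piFinset (fun i => Finset.range (d i + 1)),
    (∏ i, (-1 : ℤ) ^ (l i) * ((d i).choose (l i) : ℤ)) • x (m - ∑ i, μ i * (s i : ℤ) * (l i : ℤ))

/-- `χ(e^{-it}) = ∏ⱼ (1 - e^{-i t μⱼ sⱼ}) ^ dⱼ`. -/
def chi {r : ℕ} (d s : Fin r → ℕ) (μ : Fin r → ℤ) (t : ℝ) : ℂ :=
  ∏ j, (1 - Complex.exp (-(Complex.I * (t : ℂ) * (μ j : ℂ) * (s j : ℂ)))) ^ (d j)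

/-- `β(it) = ∏ⱼ ∏_{|k| ≤ [sⱼ / 2]} (i t - 2 π i k / sⱼ) ^ dⱼ`. -/
def beta {r : ℕ} (d s : Fin r → ℕ) (t : ℝ) : ℂ :=
  ∏ j, ∏ k ∈ Finset.Icc (-((s j / 2 : ℕ) : ℤ)) ((s j / 2 : ℕ) : ℤ),
    (Complex.I * (t : ℂ) - 2 * (Real.pi : ℂ) * Complex.I * (k : ℂ) / (s j : ℂ)) ^ (d j)

/-- `n(γ) = ∑ᵢ μᵢ sᵢ dᵢ`. -/
def nGamma {r : ℕ} (d s μ : Fin r → ℕ) : ℕ := ∑ i, μ i * s i * d i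

/-- The coefficient `e_γ(k)` of `B ^ k` in `∏ᵢ (1 - B ^ (μᵢ sᵢ)) ^ dᵢ` (positive steps). -/
def eGamma {r : ℕ} (d s μ : Fin r → ℕ) (k : ℕ) : ℤ :=
  (∏ i, (1 - (Polynomial.X : Polynomial ℤ) ^ (μ i * s i)) ^ (d i)).coeff k

/-! ### Periodically stationary sequences of second order

Random variables are elements of `L²(Ω, P; ℂ)`; `inner ℂ Y X = E (X * conj Y)`. -/

section Stochastic

variable {Ω : Type*} [MeasurableSpace Ω]

/-- The sequence has periodically stationary increments of the order `d` with the seasonal vector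
`T s`: means and correlations of its increments with arbitrary admissible steps are invariant
under the shift of time by `T`.  Minimality of the period is not demanded. -/
structure HasPeriodicGMIncrements (P : Measure Ω) {r : ℕ} (T : ℕ) (d s : Fin r → ℕ)
    (ξ : ℤ → Lp ℂ 2 P) : Prop where
  mean : ∀ μ : Fin r → ℤ, AdmissibleStep μ → ∀ m : ℤ,
    ∫ ω, (gmIncrement d (fun i => T * s i) μ ξ (m + T) : Lp ℂ 2 P) ω ∂P
      = ∫ ω, (gmIncrement d (fun i => T * s i) μ ξ m : Lp ℂ 2 P) ω ∂P
  corr : ∀ μ₁ μ₂ : Fin r → ℤ, AdmissibleStep μ₁ → AdmissibleStep μ₂ → ∀ m k : ℤ,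
    inner ℂ (gmIncrement d (fun i => T * s i) μ₂ ξ (k + T))
        (gmIncrement d (fun i => T * s i) μ₁ ξ (m + T))
      = inner ℂ (gmIncrement d (fun i => T * s i) μ₂ ξ k)
        (gmIncrement d (fun i => T * s i) μ₁ ξ m)

/-- Periodically stationary (cyclostationary) sequence with a period `T`. -/
structure IsPeriodicallyStationary (P : Measure Ω) (T : ℕ) (η : ℤ → Lp ℂ 2 P) : Prop where
  mean : ∀ m : ℤ, ∫ ω, (η (m + T)) ω ∂P = ∫ ω, (η m) ω ∂P
  corr : ∀ m k : ℤ, inner ℂ (η (k + T)) (η (m + T)) = inner ℂ (η k) (η m)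

/-- `T`-block vectorization.  The index `p : Fin T` stands for the component number `p + 1`, so
that the blocks with numbers `m ≤ 0` contain exactly the terms with nonpositive numbers. -/
def blockVec {E : Type*} (T : ℕ) (x : ℤ → E) (m : ℤ) (p : Fin T) : E :=
  x (m * (T : ℤ) - (p : ℤ))

/-- `T`-block vectorization of the coefficients of the functional. -/
def blockCoeff (T : ℕ) (a : ℕ → ℂ) (m : ℕ) (p : Fin T) : ℂ := a (m * T + p)

/-! ### Spectral densities, with respect to `dλ / 2π` on `[-π, π)` -/

/-- Lebesgue measure on `[-π, π)`. -/
abbrev circ : Measure ℝ := volume.restrict (Set.Ico (-Real.pi) Real.pi)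

/-- `f` is the matrix spectral density of the vector sequence `x` with stationary increments. -/
structure HasGMSpectralDensity (P : Measure Ω) {r T : ℕ} (d s : Fin r → ℕ)
    (x : ℤ → Fin T → Lp ℂ 2 P) (f : ℝ → Matrix (Fin T) (Fin T) ℂ) : Prop where
  integrable : ∀ i j, Integrable (fun t => f t i j) circ
  posSemidef : ∀ᵐ t ∂circ, (f t).PosSemidef
  corr : ∀ μ₁ μ₂ : Fin r → ℤ, AdmissibleStep μ₁ → AdmissibleStep μ₂ →
    ∀ (m k : ℤ) (i j : Fin T),
    inner ℂ (gmIncrement d s μ₂ (fun n => x n j) k) (gmIncrement d s μ₁ (fun n => x n i) m)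
      = (1 / (2 * Real.pi) : ℂ) * ∫ t, Complex.exp (Complex.I * (t : ℂ) * ((m - k : ℤ) : ℂ))
          * chi d s μ₁ t * star (chi d s μ₂ t) / ((‖beta d s t‖ ^ 2 : ℝ) : ℂ) * f t i j ∂circ

/-- `g` is the matrix spectral density of the stationary vector sequence `x`. -/
structure HasSpectralDensity (P : Measure Ω) {T : ℕ}
    (x : ℤ → Fin T → Lp ℂ 2 P) (g : ℝ → Matrix (Fin T) (Fin T) ℂ) : Prop where
  integrable : ∀ i j, Integrable (fun t => g t i j) circ
  posSemidef : ∀ᵐ t ∂circ, (g t).PosSemidef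
  corr : ∀ (m k : ℤ) (i j : Fin T),
    inner ℂ (x k j) (x m i)
      = (1 / (2 * Real.pi) : ℂ) * ∫ t, Complex.exp (Complex.I * (t : ℂ) * ((m - k : ℤ) : ℂ))
          * g t i j ∂circ

/-- `p = f + |β|² g`. -/
def obsDensity {r T : ℕ} (d s : Fin r → ℕ) (f g : ℝ → Matrix (Fin T) (Fin T) ℂ) (t : ℝ) :
    Matrix (Fin T) (Fin T) ℂ :=
  f t + ((‖beta d s t‖ ^ 2 : ℝ) : ℂ) • g t

/-- `g(k)`, where `g(λ) = ∑ₖ g(k) e^{iλk}`. -/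
def fourierMat {T : ℕ} (g : ℝ → Matrix (Fin T) (Fin T) ℂ) (k : ℤ) : Matrix (Fin T) (Fin T) ℂ :=
  fun i j => (1 / (2 * Real.pi) : ℂ) *
    ∫ t, Complex.exp (-(Complex.I * (t : ℂ) * (k : ℂ))) * g t i j ∂circ

/-! ### Canonical factorizations -/

/-- `F(λ) = ∑_{k ≥ 0} c(k) e^{-iλk}` with mean square convergence on `[-π, π)`. -/
def IsCausalSeries (c : ℕ → ℂ) (F : ℝ → ℂ) : Prop :=
  AEMeasurable F circ ∧
  Tendsto (fun N : ℕ => ∫⁻ t, ‖F t - ∑ k ∈ Finset.range N,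
      c k * Complex.exp (-(Complex.I * (t : ℂ) * (k : ℂ)))‖ₑ ^ 2 ∂circ) atTop (𝓝 0)

/-- The factorization `g = Φ Φ*`, `Φ(e^{-iλ}) = ∑_{k ≥ 0} φ(k) e^{-iλk}`. -/
structure NoiseFactorization {T q : ℕ} (g : ℝ → Matrix (Fin T) (Fin T) ℂ)
    (φ : ℕ → Matrix (Fin T) (Fin q) ℂ) (Φ : ℝ → Matrix (Fin T) (Fin q) ℂ) : Prop where
  series : ∀ i j, IsCausalSeries (fun k => φ k i j) (fun t => Φ t i j)
  factor : ∀ᵐ t ∂circ, g t = Φ t * (Φ t).conjTranspose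

/-- The factorizations `|χ|² |β|⁻² p = Θ Θ*` and `|β|² |χ|⁻² p⁻¹ = Ψ* Ψ` with `Ψ Θ = E_q`,
where `Θ(e^{-iλ}) = ∑_{k ≥ 0} θ(k) e^{-iλk}`, `Ψ(e^{-iλ}) = ∑_{k ≥ 0} ψ(k) e^{-iλk}`. -/
structure ObsFactorization {r T q : ℕ} (d s : Fin r → ℕ) (μ : Fin r → ℤ)
    (p : ℝ → Matrix (Fin T) (Fin T) ℂ)
    (θ : ℕ → Matrix (Fin T) (Fin q) ℂ) (Θ : ℝ → Matrix (Fin T) (Fin q) ℂ)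
    (ψ : ℕ → Matrix (Fin q) (Fin T) ℂ) (Ψ : ℝ → Matrix (Fin q) (Fin T) ℂ) : Prop where
  seriesΘ : ∀ i j, IsCausalSeries (fun k => θ k i j) (fun t => Θ t i j)
  seriesΨ : ∀ i j, IsCausalSeries (fun k => ψ k i j) (fun t => Ψ t i j)
  factorΘ : ∀ᵐ t ∂circ, ((‖chi d s μ t‖ ^ 2 / ‖beta d s t‖ ^ 2 : ℝ) : ℂ) • p t
    = Θ t * (Θ t).conjTranspose
  inverse : ∀ᵐ t ∂circ, Ψ t * Θ t = 1
  invertible : ∀ᵐ t ∂circ, IsUnit (p t).det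
  factorΨ : ∀ᵐ t ∂circ, ((‖beta d s t‖ ^ 2 / ‖chi d s μ t‖ ^ 2 : ℝ) : ℂ) • (p t)⁻¹
    = (Ψ t).conjTranspose * Ψ t

/-! ### Stochastic integrals and spectral characteristics -/

/-- `∫ h(λ)ᵀ p(λ) conj h(λ) dλ` over `[-π, π)`: the squared norm of `L₂(p)` up to `2π`. -/
def sqNormL2 {T : ℕ} (p : ℝ → Matrix (Fin T) (Fin T) ℂ) (h : ℝ → Fin T → ℂ) : ENNReal :=
  ∫⁻ t, ENNReal.ofReal (dotProduct (h t) ((p t).mulVec (star (h t)))).re ∂circ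

/-- `Y = ∫ hᵀ dZ`: for every `ε > 0` some step function is `ε`-close to `h` in `L₂(p)` while its
(elementary) integral is `ε`-close to `Y` in mean square. -/
def IsStochInt {P : Measure Ω} {T : ℕ} (p : ℝ → Matrix (Fin T) (Fin T) ℂ)
    (Z : ℝ → Fin T → Lp ℂ 2 P) (h : ℝ → Fin T → ℂ) (Y : Lp ℂ 2 P) : Prop :=
  AEMeasurable h circ ∧
  ∀ ε : ℝ, 0 < ε → ∃ (n : ℕ) (u v : Fin n → ℝ) (c : Fin n → Fin T → ℂ),
    (∀ i, -Real.pi ≤ u i ∧ u i ≤ v i ∧ v i ≤ Real.pi) ∧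
    sqNormL2 p (fun t => h t - ∑ i, (Set.Ico (u i) (v i)).indicator (fun _ => c i) t)
      < ENNReal.ofReal ε ∧
    ‖Y - ∑ i, ∑ l, c i l • (Z (v i) l - Z (u i) l)‖ < ε

/-- `Z` is the process with uncorrelated increments, with the spectral density `p`, in the spectral
representation `X(m) = ∫ e^{imλ} χ(e^{-iλ}) β(iλ)⁻¹ dZ(λ)` of an increment sequence `X`. -/
structure IsSpectralProcess {P : Measure Ω} {r T : ℕ} (d s : Fin r → ℕ) (μ : Fin r → ℤ)
    (p : ℝ → Matrix (Fin T) (Fin T) ℂ) (X : ℤ → Fin T → Lp ℂ 2 P)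
    (Z : ℝ → Fin T → Lp ℂ 2 P) : Prop where
  increments : ∀ u v u' v' : ℝ, -Real.pi ≤ u → u ≤ v → v ≤ Real.pi →
    -Real.pi ≤ u' → u' ≤ v' → v' ≤ Real.pi → ∀ i j : Fin T,
    inner ℂ (Z v' j - Z u' j) (Z v i - Z u i)
      = (1 / (2 * Real.pi) : ℂ) * ∫ t in Set.Ico u v ∩ Set.Ico u' v', p t i j
  repr : ∀ (m : ℤ) (l : Fin T), IsStochInt p Z
    (fun t => (Complex.exp (Complex.I * (t : ℂ) * (m : ℂ)) * (chi d s μ t / beta d s t)) •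
      (Pi.single l 1 : Fin T → ℂ)) (X m l)

/-- The subspace `L₂⁰(p)`: the closed linear span in `L₂(p)` of the functions
`e^{iλk} χ(e^{-iλ}) β(iλ)⁻¹ δ_l`, `k ≤ 0`. -/
def InL20 {r T : ℕ} (d s : Fin r → ℕ) (μ : Fin r → ℤ)
    (p : ℝ → Matrix (Fin T) (Fin T) ℂ) (h : ℝ → Fin T → ℂ) : Prop :=
  AEMeasurable h circ ∧
  ∀ ε : ℝ, 0 < ε → ∃ (N : ℕ) (c : ℕ → Fin T → ℂ),
    sqNormL2 p (fun t => h t - ∑ k ∈ Finset.range N,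
      (Complex.exp (-(Complex.I * (t : ℂ) * (k : ℂ))) * (chi d s μ t / beta d s t)) • c k)
      < ENNReal.ofReal ε

/-- The closed linear span in `L²` of the increments, with the seasonal vector `T s`, of the
observed sequence `ζ` at the points `m = 0, -1, -2, …`. -/
def obsSpace {P : Measure Ω} {r : ℕ} (T : ℕ) (d s : Fin r → ℕ) (μ : Fin r → ℤ)
    (ζ : ℤ → Lp ℂ 2 P) : Submodule ℂ (Lp ℂ 2 P) :=
  (Submodule.span ℂ
    {x | ∃ m : ℤ, m ≤ 0 ∧ x = gmIncrement d (fun i => T * s i) μ ζ m}).topologicalClosure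

/-- `A'` is a mean square optimal estimate of `Aξ` among the linear estimates `Aζ - Y`, `Y ∈ H`. -/
def IsOptimalEstimate {P : Measure Ω} (H : Submodule ℂ (Lp ℂ 2 P)) (Aξ Aζ A' : Lp ℂ 2 P) : Prop :=
  Aζ - A' ∈ H ∧ ∀ B : Lp ℂ 2 P, Aζ - B ∈ H → ‖Aξ - A'‖ ≤ ‖Aξ - B‖

end Stochastic

/-! ### The sequences entering the answer -/

section Formulas

variable {r T q : ℕ}

/-- Entrywise complex conjugation of a matrix. -/
def conjMat {m n : ℕ} (M : Matrix (Fin m) (Fin n) ℂ) : Matrix (Fin m) (Fin n) ℂ := M.map star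

/-- `a_{-μ}(m) = ∑_{l = max(m,0)}^{m + n(γ)} e_γ(l - m) a(l)`. -/
def aMinus (d s μ : Fin r → ℕ) (a : ℕ → Fin T → ℂ) (m : ℤ) : Fin T → ℂ :=
  ∑ l ∈ Finset.Icc (max m 0) (m + (nGamma d s μ : ℤ)),
    (eGamma d s μ (l - m).toNat : ℂ) • a l.toNat

/-- `b_{-μ}(0) = 0`, `b_{-μ}(k) = a_{-μ}(-k)` for `1 ≤ k ≤ n(γ)`, `b_{-μ}(k) = 0` beyond. -/
def bMinus (d s μ : Fin r → ℕ) (a : ℕ → Fin T → ℂ) (k : ℕ) : Fin T → ℂ :=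
  if 1 ≤ k ∧ k ≤ nGamma d s μ then aMinus d s μ a (-(k : ℤ)) else 0

/-- `c⁻(m) = (G⁻ a_{-μ})_m = ∑_{k ≥ 0} conj g(m - k) a_{-μ}(k)`. -/
def cMinus (d s μ : Fin r → ℕ) (g : ℝ → Matrix (Fin T) (Fin T) ℂ) (a : ℕ → Fin T → ℂ) (m : ℕ) :
    Fin T → ℂ :=
  ∑' k : ℕ, (conjMat (fourierMat g ((m : ℤ) - k))).mulVec (aMinus d s μ a k)

/-- `c⁺(m) = (G⁺ b_{-μ})_m = ∑_{k ≥ 0} conj g(m + k) b_{-μ}(k)`. -/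
def cPlus (d s μ : Fin r → ℕ) (g : ℝ → Matrix (Fin T) (Fin T) ℂ) (a : ℕ → Fin T → ℂ) (m : ℕ) :
    Fin T → ℂ :=
  ∑' k : ℕ, (conjMat (fourierMat g ((m : ℤ) + k))).mulVec (bMinus d s μ a k)

/-- `(conj ψ C)_m = ∑_{k ≥ 0} conj ψ(k) c(k + m)`. -/
def psiC (ψ : ℕ → Matrix (Fin q) (Fin T) ℂ) (c : ℕ → Fin T → ℂ) (m : ℕ) : Fin q → ℂ :=
  ∑' k : ℕ, (conjMat (ψ k)).mulVec (c (k + m))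

/-- `(Φ̃ x)_m = ∑_{k = 0}^{m} φ(m - k)ᵀ x(k)`. -/
def phiTilde (φ : ℕ → Matrix (Fin T) (Fin q) ℂ) (x : ℕ → Fin T → ℂ) (m : ℕ) : Fin q → ℂ :=
  ∑ k ∈ Finset.range (m + 1), (φ (m - k)).transpose.mulVec (x k)

/-- `(Φ̃⁺ x)_m = ∑_{k ≥ 0} φ(m + k)ᵀ x(k)`. -/
def phiTildePlus (φ : ℕ → Matrix (Fin T) (Fin q) ℂ) (x : ℕ → Fin T → ℂ) (m : ℕ) : Fin q → ℂ :=
  ∑' k : ℕ, (φ (m + k)).transpose.mulVec (x k)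

/-- Squared Euclidean norm of a vector. -/
def sqNorm (v : Fin q → ℂ) : ℝ := ∑ i, ‖v i‖ ^ 2

/-- The spectral characteristic
`χ(e^{-iλ}) β(iλ)⁻¹ (∑ₖ ψ(k)ᵀ e^{-iλk}) W(λ)`. -/
def specChar (d s : Fin r → ℕ) (μ : Fin r → ℤ) (Ψ : ℝ → Matrix (Fin q) (Fin T) ℂ)
    (W : ℝ → Fin q → ℂ) (t : ℝ) : Fin T → ℂ :=
  (chi d s μ t / beta d s t) • (Ψ t).transpose.mulVec (W t)

end Formulas

end

end GMFilter

open GMFilter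

/-! The signal enters the error trivially. Since `Aζ = Aξ + Aη`, a linear estimate `Aζ - Y` has the
error `Y - Aη`, so the task is to project the noise functional `Aη` onto the space `H` of observed
increments (`isOptimalEstimate_iff`). Everything else computes this projection in the frequency
domain.

The factorization of the observed density says that the increments have the same Gram matrix as the
functions `e^{imt} Θ_l` in `L²([-π, π); ℂ^q)` (`inner_increment`). Hence there is an isometry `V`
from this function space with `V (e^{imt} Θ_l)` equal to the increments, and `H = V(N)`, where `N`
is the closed span of `e^{-ikt} Θ_l`, `k ≥ 0`. With `G = V* Aη` and `w` the projection of `G` on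
`N`, the wanted variable is `V w`.

Two facts make `w` explicit. By `comps_adjoint_eq`, testing `G` against `e^{-int} Θ_l` and using `Ψ
Θ = 1` gives `G = conj Ψ · conj g · conj χ · A`; multiplication by `conj χ` turns the coefficients
`a` into `a_{-μ}`, whose terms of negative index form `b_{-μ}`. By `co_projection`, `N` is the whole
Hardy space of series in `e^{-ikt}`, `k ≥ 0`, so `w` keeps exactly the coefficients of `G` with
nonnegative index, and these are `(conj ψ C⁻ + conj ψ C⁺)_m`.

That `N` is the whole Hardy space (`unitF_mem_closure`) is the deepest point. It requires that the
product of a square integrable causal function and an integrable strictly causal function, if the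
sum of such products is square integrable, has mean zero. The products themselves need not be
integrable, so a Smirnov type theorem is needed (`integral_eq_zero_of_smirnov`); it is proved by
regularizing with extremal functions of Szegő's problem (`exists_szego`).

The map `h ↦ γ Θᵀ h` with `γ = β / χ` identifies `L₂(p)` isometrically with functions in `L²`, and
stochastic integrals become values of `V` (`isStochInt_iff`). Inverting it at `w` by means of `Ψ`
gives the spectral characteristic. The error is `‖Aη‖² - ‖w‖²`, and Parseval's identity turns both
terms into the stated series. -/

namespace GMFilter

noncomputable section

/-! ### Fourier coefficients of integrable functions on `[-π, π)`. -/

/-- Normalized Lebesgue measure `dλ / 2π` on `[-π, π)`. -/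
def nu : Measure ℝ := ENNReal.ofReal (1 / (2 * Real.pi)) • circ

lemma two_pi_inv_pos : 0 < 1 / (2 * Real.pi) := by positivity

instance : IsProbabilityMeasure nu := ⟨by
  simp only [nu, circ, Measure.smul_apply, Measure.restrict_apply_univ, Real.volume_Ico,
    smul_eq_mul]
  rw [← ENNReal.ofReal_mul two_pi_inv_pos.le, ← ENNReal.ofReal_one]
  congr 1
  field_simp
  ring⟩

lemma ae_nu : ae nu = ae circ :=
  Measure.ae_ennreal_smul_measure_eq (by simp [Real.pi_pos]) _

lemma ae_nu_iff {p : ℝ → Prop} : (∀ᵐ t ∂nu, p t) ↔ ∀ᵐ t ∂circ, p t := by rw [ae_nu]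

lemma integral_nu {E : Type*} [NormedAddCommGroup E] [NormedSpace ℝ E] (F : ℝ → E) :
    ∫ t, F t ∂nu = (1 / (2 * Real.pi)) • ∫ t, F t ∂circ := by
  rw [nu, integral_smul_measure, ENNReal.toReal_ofReal two_pi_inv_pos.le]

lemma integral_nu_complex (F : ℝ → ℂ) :
    ∫ t, F t ∂nu = (1 / (2 * Real.pi) : ℂ) * ∫ t, F t ∂circ := by
  rw [integral_nu, Complex.real_smul]; push_cast; rfl

lemma lintegral_nu (F : ℝ → ENNReal) :
    ∫⁻ t, F t ∂nu = ENNReal.ofReal (1 / (2 * Real.pi)) * ∫⁻ t, F t ∂circ := by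
  rw [nu, lintegral_smul_measure, smul_eq_mul]

lemma integrable_nu_iff {E : Type*} [NormedAddCommGroup E] {F : ℝ → E} :
    Integrable F nu ↔ Integrable F circ :=
  integrable_smul_measure (by simp [Real.pi_pos]) (by simp)

lemma aestronglyMeasurable_nu_iff {E : Type*} [TopologicalSpace E] {F : ℝ → E} :
    AEStronglyMeasurable F nu ↔ AEStronglyMeasurable F circ := by
  constructor <;> intro h
  · exact h.mono_ac (Measure.absolutelyContinuous_of_le_smul
      (c := ENNReal.ofReal (2 * Real.pi)) (by
      rw [nu, smul_smul, ← ENNReal.ofReal_mul (by positivity)]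
      have : 2 * Real.pi * (1 / (2 * Real.pi)) = 1 := by field_simp
      rw [this]; simp))
  · exact h.smul_measure _

/-- The exponential `e^{int}`. -/
def ex (n : ℤ) (t : ℝ) : ℂ := Complex.exp (Complex.I * (t : ℂ) * (n : ℂ))

@[simp] lemma ex_zero (t : ℝ) : ex 0 t = 1 := by simp [ex]

lemma ex_add (m n : ℤ) (t : ℝ) : ex (m + n) t = ex m t * ex n t := by
  simp only [ex, ← Complex.exp_add]; push_cast; ring_nf

lemma ex_neg_eq (n : ℤ) (t : ℝ) :
    ex (-n) t = Complex.exp (-(Complex.I * (t : ℂ) * (n : ℂ))) := by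
  simp [ex]

lemma star_ex (n : ℤ) (t : ℝ) : star (ex n t) = ex (-n) t := by
  simp [ex, ← Complex.exp_conj]

lemma conj_ex (n : ℤ) (t : ℝ) : (starRingEnd ℂ) (ex n t) = ex (-n) t := star_ex n t

@[simp] lemma norm_ex (n : ℤ) (t : ℝ) : ‖ex n t‖ = 1 := by
  have : Complex.I * (t : ℂ) * (n : ℂ) = ((t * n : ℝ) : ℂ) * Complex.I := by push_cast; ring
  rw [ex, this, Complex.norm_exp_ofReal_mul_I]

@[fun_prop] lemma continuous_ex (n : ℤ) : Continuous (ex n) := by unfold ex; fun_prop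

@[fun_prop] lemma measurable_ex (n : ℤ) : Measurable (ex n) := (continuous_ex n).measurable

lemma integral_ex (n : ℤ) : ∫ t, ex n t ∂nu = if n = 0 then 1 else 0 := by
  split_ifs with h
  · simp [h]
  · rw [integral_nu_complex, circ, integral_Ico_eq_integral_Ioc,
      ← intervalIntegral.integral_of_le (by linarith [Real.pi_pos])]
    have hc : Complex.I * (n : ℂ) ≠ 0 := by simp [h]
    have : ∀ t : ℝ, ex n t = Complex.exp (Complex.I * (n : ℂ) * t) := fun t => by
      simp only [ex]; ring_nf
    simp_rw [this]
    rw [integral_exp_mul_complex hc]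
    have e : Complex.exp (Complex.I * n * (Real.pi : ℝ))
        = Complex.exp (Complex.I * n * ((-Real.pi : ℝ) : ℂ)) := by
      rw [Complex.exp_eq_exp_iff_exists_int]
      exact ⟨n, by push_cast; ring⟩
    rw [e]; simp

/-- The coefficient of `e^{-int}` in the Fourier expansion of `u`. -/
def co (u : ℝ → ℂ) (n : ℤ) : ℂ := ∫ t, ex n t * u t ∂nu

lemma integrable_ex_mul {u : ℝ → ℂ} (hu : Integrable u nu) (n : ℤ) :
    Integrable (fun t => ex n t * u t) nu :=
  hu.bdd_mul (c := 1) (continuous_ex n).aestronglyMeasurable (by simp)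

lemma memLp_ex_mul {u : ℝ → ℂ} (hu : MemLp u 2 nu) (n : ℤ) :
    MemLp (fun t => ex n t * u t) 2 nu :=
  hu.of_le ((continuous_ex n).aestronglyMeasurable.mul hu.1) (by simp)

lemma memLp_ex (n : ℤ) (p : ENNReal) : MemLp (ex n) p nu :=
  MemLp.of_bound (continuous_ex n).aestronglyMeasurable 1 (by simp)

/-- An integrable function with vanishing Fourier coefficients is zero. -/
lemma ae_eq_zero_of_co {u : ℝ → ℂ} (hu : Integrable u nu) (h : ∀ n, co u n = 0) :
    ∀ᵐ t ∂nu, u t = 0 := by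
  have : Fact (0 < 2 * Real.pi) := ⟨by positivity⟩
  have hpi := Real.pi_pos
  have huc : Integrable u circ := integrable_nu_iff.1 hu
  have bnd : ∀ φ : C(AddCircle (2 * Real.pi), ℂ),
      Integrable (fun t : ℝ => φ (t : AddCircle (2 * Real.pi)) * u t) circ := fun φ =>
    huc.bdd_mul (c := ‖φ‖) (by
      have : Continuous fun t : ℝ => φ (t : AddCircle (2 * Real.pi)) :=
        φ.continuous.comp (AddCircle.continuous_mk' _)
      exact this.aestronglyMeasurable) (ae_of_all _ fun t => φ.norm_coe_le_norm _)
  let L : C(AddCircle (2 * Real.pi), ℂ) →ₗ[ℂ] ℂ :=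
    { toFun := fun φ => ∫ t, φ (t : AddCircle (2 * Real.pi)) * u t ∂circ
      map_add' := fun φ₁ φ₂ => by
        rw [← integral_add (bnd φ₁) (bnd φ₂)]
        simp [add_mul]
      map_smul' := fun c φ => by
        simp only [ContinuousMap.smul_apply, smul_eq_mul, RingHom.id_apply, mul_assoc]
        rw [integral_const_mul] }
  let L' : C(AddCircle (2 * Real.pi), ℂ) →L[ℂ] ℂ :=
    L.mkContinuous (∫ t, ‖u t‖ ∂circ) fun φ => by
      rw [mul_comm (∫ t, ‖u t‖ ∂circ), ← integral_const_mul]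
      refine (norm_integral_le_integral_norm _).trans ?_
      refine integral_mono (bnd φ).norm (huc.norm.const_mul _) fun t => ?_
      rw [norm_mul]
      exact mul_le_mul_of_nonneg_right (φ.norm_coe_le_norm _) (norm_nonneg _)
  -- Integration against `u` kills all exponentials, and these span a dense subspace of the
  -- continuous functions on the circle.
  have hL : L' = 0 := by
    apply ContinuousLinearMap.ext_on (s := Set.range (@fourier (2 * Real.pi)))
    · rw [← Submodule.dense_iff_topologicalClosure_eq_top.symm.trans Iff.rfl]
      exact span_fourier_closure_eq_top
    · rintro _ ⟨n, rfl⟩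
      have h1 := h n
      rw [co, integral_nu_complex] at h1
      have h2 : (1 / (2 * Real.pi) : ℂ) ≠ 0 := by
        simp [Real.pi_ne_zero]
      have h3 := (mul_eq_zero.1 h1).resolve_left h2
      have : ∀ t : ℝ, fourier n (t : AddCircle (2 * Real.pi)) = ex n t := fun t => by
        rw [fourier_coe_apply, ex]
        congr 1
        have : (Real.pi : ℂ) ≠ 0 := by simp [Real.pi_ne_zero]
        push_cast
        field_simp
      change ∫ t, fourier n (t : AddCircle (2 * Real.pi)) * u t ∂circ = _
      simp_rw [this, h3]; simp
  have key := (isOpen_Ioo (a := -Real.pi) (b := Real.pi)).ae_eq_zero_of_integral_contDiff_smul_eq_zero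
    (f := u) (μ := volume) ?_ ?_
  · rw [ae_nu, circ, ← restrict_Ioo_eq_restrict_Ico]
    exact (ae_restrict_iff' measurableSet_Ioo).2 key
  · have : IntegrableOn u (Set.Ioo (-Real.pi) Real.pi) volume :=
      IntegrableOn.mono_set (t := Set.Ico (-Real.pi) Real.pi) huc Set.Ioo_subset_Ico_self
    exact this.locallyIntegrableOn
  · intro g hg _ hs
    have hz : ∀ t, t ∉ Set.Ioo (-Real.pi) Real.pi → g t = 0 := fun t ht =>
      image_eq_zero_of_notMem_tsupport fun h' => ht (hs h')
    -- A test function supported inside the open interval vanishes at both endpoints, so it descends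
    -- to a continuous function on the circle.
    let φ : C(AddCircle (2 * Real.pi), ℂ) :=
      ⟨AddCircle.liftIco (2 * Real.pi) (-Real.pi) (fun t => (g t : ℂ)),
        AddCircle.liftIco_continuous (by rw [hz _ (by simp), hz _ fun h' => by linarith [h'.2]])
          (by have := hg.continuous; fun_prop)⟩
    have h0 : ∫ t, φ (t : AddCircle (2 * Real.pi)) * u t ∂circ = 0 :=
      congrArg (fun M : C(AddCircle (2 * Real.pi), ℂ) →L[ℂ] ℂ => M φ) hL
    rw [← h0, circ, ← setIntegral_eq_integral_of_forall_compl_eq_zero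
      (s := Set.Ico (-Real.pi) Real.pi) (f := fun t => g t • u t)]
    · refine setIntegral_congr_fun measurableSet_Ico fun t ht => ?_
      have : φ (t : AddCircle (2 * Real.pi)) = (g t : ℂ) :=
        AddCircle.liftIco_coe_apply (f := fun t => (g t : ℂ)) (by
          rwa [show -Real.pi + 2 * Real.pi = Real.pi by ring])
      simp only [this, Complex.real_smul]
    · intro t ht
      rw [hz t fun h' => ht (Set.Ioo_subset_Ico_self h'), zero_smul]

/-- An integrable function with vanishing integrals over all subintervals is zero. -/
lemma ae_eq_zero_of_setIntegral_Ico {u : ℝ → ℂ} (hu : Integrable u nu)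
    (h : ∀ a b : ℝ, -Real.pi ≤ a → a ≤ b → b ≤ Real.pi →
      ∫ t, (Set.Ico a b).indicator (fun _ => (1 : ℂ)) t * u t ∂nu = 0) :
    ∀ᵐ t ∂nu, u t = 0 := by
  have hpi := Real.pi_pos
  have e1 : ∀ s : Set ℝ, MeasurableSet s →
      ∫ t, s.indicator (fun _ => (1 : ℂ)) t * u t ∂nu = ∫ t in s, u t ∂nu := fun s hs => by
    rw [← integral_indicator hs]
    congr 1; ext t
    by_cases ht : t ∈ s <;> simp [ht]
  -- The measure lives on `[-π, π)`, so an arbitrary interval may be clipped to it; the half-open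
  -- intervals then form a generating π-system.
  have hI : ∀ a b : ℝ, ∫ t in Set.Ico a b, u t ∂nu = 0 := by
    intro a b
    have hae : (Set.Ico a b : Set ℝ) =ᵐ[nu]
        (Set.Ico (max a (-Real.pi)) (min b Real.pi) : Set ℝ) := by
      rw [ae_nu]
      filter_upwards [ae_restrict_mem measurableSet_Ico] with t ht
      apply propext
      change t ∈ Set.Ico _ _ ↔ t ∈ Set.Ico _ _
      simp only [Set.mem_Ico, sup_le_iff, lt_inf_iff] at *
      tauto
    rw [setIntegral_congr_set hae]
    rcases le_total (max a (-Real.pi)) (min b Real.pi) with hab | hab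
    · rw [← e1 _ measurableSet_Ico]
      exact h _ _ (le_max_right _ _) hab (min_le_right _ _)
    · rw [Set.Ico_eq_empty (not_lt.2 hab)]; simp
  have hall : ∫ t, u t ∂nu = 0 := by
    have := hI (-Real.pi) Real.pi
    rwa [setIntegral_congr_set (t := Set.univ), setIntegral_univ] at this
    rw [ae_nu]
    filter_upwards [ae_restrict_mem measurableSet_Ico] with t ht
    apply propext
    exact ⟨fun _ => trivial, fun _ => ht⟩
  have hS : ∀ s, MeasurableSet s → ∫ t in s, u t ∂nu = 0 := by
    intro s hs
    induction s, hs using MeasurableSpace.induction_on_inter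
      (BorelSpace.measurable_eq.trans (borel_eq_generateFrom_Ico ℝ)) (isPiSystem_Ico id id) with
    | empty => simp
    | basic s hs => obtain ⟨a, b, _, rfl⟩ := hs; exact hI a b
    | compl s hs ih =>
      have := integral_add_compl hs hu
      rw [ih, hall, zero_add] at this
      exact this
    | iUnion f hd hm ih =>
      rw [integral_iUnion hm hd hu.integrableOn]
      simp [ih]
  exact Integrable.ae_eq_zero_of_forall_setIntegral_eq_zero hu (fun s hs _ => hS s hs)

/-! ### Square integrable functions: trigonometric basis, Parseval, Riesz–Fischer. -/

lemma enorm_toLp_sq {E : Type*} [NormedAddCommGroup E] {F : ℝ → E} (hF : MemLp F 2 nu) :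
    ‖hF.toLp F‖ₑ ^ 2 = ∫⁻ t, ‖F t‖ₑ ^ 2 ∂nu := by
  rw [Lp.enorm_toLp]
  have := eLpNorm_nnreal_pow_eq_lintegral (f := F) (μ := nu) (p := 2) (by norm_num)
  simpa only [NNReal.coe_ofNat, ENNReal.coe_ofNat, ENNReal.rpow_ofNat] using this

lemma memLp_two_of_lintegral {E : Type*} [NormedAddCommGroup E] {F : ℝ → E}
    (hF : AEStronglyMeasurable F nu) (h : ∫⁻ t, ‖F t‖ₑ ^ 2 ∂nu < ⊤) : MemLp F 2 nu := by
  refine ⟨hF, ?_⟩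
  have := eLpNorm_nnreal_pow_eq_lintegral (f := F) (μ := nu) (p := 2) (by norm_num)
  have h2 : eLpNorm F 2 nu ^ 2 < ⊤ := by
    have e : eLpNorm F 2 nu ^ 2 = ∫⁻ t, ‖F t‖ₑ ^ 2 ∂nu := by
      simpa only [NNReal.coe_ofNat, ENNReal.coe_ofNat, ENNReal.rpow_ofNat] using this
    rwa [e]
  exact (ENNReal.pow_lt_top_iff.1 h2).resolve_right (by norm_num)

lemma inner_toLp {u v : ℝ → ℂ} (hu : MemLp u 2 nu) (hv : MemLp v 2 nu) :
    inner ℂ (hu.toLp u) (hv.toLp v) = ∫ t, star (u t) * v t ∂nu := by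
  rw [L2.inner_def]
  refine integral_congr_ae ?_
  filter_upwards [hu.coeFn_toLp, hv.coeFn_toLp] with t h1 h2
  rw [h1, h2, RCLike.inner_apply, mul_comm]; rfl

lemma memLp_star {u : ℝ → ℂ} {p : ENNReal} (hu : MemLp u p nu) :
    MemLp (fun t => star (u t)) p nu := hu.star

lemma integrable_star_mul {u v : ℝ → ℂ} (hu : MemLp u 2 nu) (hv : MemLp v 2 nu) :
    Integrable (fun t => star (u t) * v t) nu := (memLp_star hu).integrable_mul hv

/-- The trigonometric functions `e^{-int}` as elements of `L²`. -/
def trig (n : ℤ) : Lp ℂ 2 nu := (memLp_ex (-n) 2).toLp (ex (-n))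

lemma inner_trig {u : ℝ → ℂ} (hu : MemLp u 2 nu) (n : ℤ) :
    inner ℂ (trig n) (hu.toLp u) = co u n := by
  rw [trig, inner_toLp, co]
  simp [conj_ex]

lemma orthonormal_trig : Orthonormal ℂ trig := by
  rw [orthonormal_iff_ite]
  intro i j
  rw [trig, trig, inner_toLp]
  simp_rw [star_ex, ← ex_add, integral_ex]
  simp only [neg_neg, add_neg_eq_zero]

lemma span_trig_orthogonal : (Submodule.span ℂ (Set.range trig))ᗮ = ⊥ := by
  rw [Submodule.eq_bot_iff]
  intro x hx
  have hm := Lp.memLp x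
  have hx' : hm.toLp x = x := Lp.toLp_coeFn x hm
  have hx2 : ∀ n, inner ℂ (trig n) x = 0 := fun n =>
    Submodule.inner_right_of_mem_orthogonal (K := Submodule.span ℂ (Set.range trig))
      (Submodule.subset_span (Set.mem_range_self n)) hx
  have h0 : ∀ᵐ t ∂nu, x t = 0 := ae_eq_zero_of_co (hm.integrable (by norm_num)) fun n => by
    rw [← inner_trig hm, hx', hx2]
  exact (Lp.eq_zero_iff_ae_eq_zero).2 h0

/-- The trigonometric Hilbert basis of `L²([-π, π), dλ / 2π)`. -/
def trigBasis : HilbertBasis ℤ ℂ (Lp ℂ 2 nu) :=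
  HilbertBasis.mkOfOrthogonalEqBot orthonormal_trig span_trig_orthogonal

lemma trigBasis_apply (n : ℤ) : trigBasis n = trig n := by
  simp [trigBasis]

lemma trigBasis_repr {u : ℝ → ℂ} (hu : MemLp u 2 nu) (n : ℤ) :
    trigBasis.repr (hu.toLp u) n = co u n := by
  rw [HilbertBasis.repr_apply_apply, trigBasis_apply, inner_trig]

/-- Parseval's identity. -/
lemma hasSum_parseval {u v : ℝ → ℂ} (hu : MemLp u 2 nu) (hv : MemLp v 2 nu) :
    HasSum (fun n : ℤ => star (co u n) * co v n) (∫ t, star (u t) * v t ∂nu) := by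
  rw [← inner_toLp hu hv]
  convert! trigBasis.hasSum_inner_mul_inner (hu.toLp u) (hv.toLp v) using 2 with n
  rw [trigBasis_apply, inner_trig, ← inner_conj_symm, inner_trig]; rfl

lemma hasSum_parseval_sq {u : ℝ → ℂ} (hu : MemLp u 2 nu) :
    HasSum (fun n : ℤ => ‖co u n‖ ^ 2) (∫ t, ‖u t‖ ^ 2 ∂nu) := by
  have := hasSum_parseval hu hu
  have e : ∀ z : ℂ, star z * z = ((‖z‖ ^ 2 : ℝ) : ℂ) := fun z => by
    push_cast; exact Complex.conj_mul' z
  simp_rw [e] at this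
  rw [integral_complex_ofReal] at this
  exact_mod_cast this

lemma co_add {u v : ℝ → ℂ} (hu : Integrable u nu) (hv : Integrable v nu) (n : ℤ) :
    co (fun t => u t + v t) n = co u n + co v n := by
  simp only [co, mul_add]
  exact integral_add (integrable_ex_mul hu n) (integrable_ex_mul hv n)

lemma co_sub {u v : ℝ → ℂ} (hu : Integrable u nu) (hv : Integrable v nu) (n : ℤ) :
    co (fun t => u t - v t) n = co u n - co v n := by
  simp only [co, mul_sub]
  exact integral_sub (integrable_ex_mul hu n) (integrable_ex_mul hv n)

lemma co_sum {ι : Type*} (s : Finset ι) {u : ι → ℝ → ℂ} (hu : ∀ i ∈ s, Integrable (u i) nu)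
    (n : ℤ) : co (fun t => ∑ i ∈ s, u i t) n = ∑ i ∈ s, co (u i) n := by
  simp only [co, Finset.mul_sum]
  exact integral_finsetSum _ fun i hi => integrable_ex_mul (hu i hi) n

lemma co_congr {u v : ℝ → ℂ} (h : ∀ᵐ t ∂nu, u t = v t) (n : ℤ) : co u n = co v n :=
  integral_congr_ae (by filter_upwards [h] with t ht; rw [ht])

lemma co_ex_mul (u : ℝ → ℂ) (m n : ℤ) : co (fun t => ex m t * u t) n = co u (n + m) := by
  simp only [co, ex_add, mul_assoc]

lemma co_star (u : ℝ → ℂ) (n : ℤ) : co (fun t => star (u t)) n = star (co u (-n)) := by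
  simp only [co]
  simp only [RCLike.star_def, ← integral_conj, map_mul, conj_ex, neg_neg]

lemma ae_eq_of_co {u v : ℝ → ℂ} (hu : Integrable u nu) (hv : Integrable v nu)
    (h : ∀ n, co u n = co v n) : ∀ᵐ t ∂nu, u t = v t := by
  filter_upwards [ae_eq_zero_of_co (u := fun t => u t - v t) (hu.sub hv)
    fun n => by rw [co_sub hu hv, h, sub_self]] with t ht
  exact sub_eq_zero.1 ht

/-- Riesz–Fischer: an integrable function with square summable coefficients is in `L²`. -/
lemma memLp_two_of_summable_co {u : ℝ → ℂ} (hu : Integrable u nu)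
    (h : Summable fun n : ℤ => ‖co u n‖ ^ 2) : MemLp u 2 nu := by
  let s : lp (fun _ : ℤ => ℂ) 2 := ⟨fun n => co u n, memℓp_gen (by simpa using h)⟩
  have hv := Lp.memLp (trigBasis.repr.symm s)
  have hae := ae_eq_of_co hu (hv.integrable (by norm_num)) fun n => by
    rw [← trigBasis_repr hv, Lp.toLp_coeFn, LinearIsometryEquiv.apply_symm_apply]
  exact hv.ae_eq (by filter_upwards [hae] with t ht using ht.symm)

/-! ### One-sided Fourier series. -/

lemma sum_causal_memLp (c : ℕ → ℂ) (N : ℕ) :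
    MemLp (fun t => ∑ k ∈ Finset.range N, c k * ex (-(k : ℤ)) t) 2 nu :=
  memLp_finsetSum _ fun k _ => (memLp_ex _ 2).const_mul (c k)

/-- The two measures differ by a finite nonzero factor, and a finite distance to one trigonometric
polynomial already forces `F` into `L²`. -/
lemma isCausalSeries_iff' (c : ℕ → ℂ) (F : ℝ → ℂ) :
    IsCausalSeries c F ↔ ∃ hF : MemLp F 2 nu, Tendsto (fun N : ℕ =>
      (sum_causal_memLp c N).toLp _) atTop (𝓝 (hF.toLp F)) := by
  have hr : ∀ N, ∀ t : ℝ, ∑ k ∈ Finset.range N,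
      c k * Complex.exp (-(Complex.I * (t : ℂ) * (k : ℂ)))
      = ∑ k ∈ Finset.range N, c k * ex (-(k : ℤ)) t := fun N t => by
    refine Finset.sum_congr rfl fun k _ => ?_
    rw [ex_neg_eq]; push_cast; rfl
  simp only [IsCausalSeries, hr]
  have hm : AEMeasurable F circ ↔ AEStronglyMeasurable F nu := by
    rw [aestronglyMeasurable_nu_iff, aestronglyMeasurable_iff_aemeasurable]
  have hT : Tendsto (fun N : ℕ => ∫⁻ t, ‖F t - ∑ k ∈ Finset.range N,
      c k * ex (-(k : ℤ)) t‖ₑ ^ 2 ∂circ) atTop (𝓝 0) ↔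
      Tendsto (fun N : ℕ => ∫⁻ t, ‖F t - ∑ k ∈ Finset.range N,
      c k * ex (-(k : ℤ)) t‖ₑ ^ 2 ∂nu) atTop (𝓝 0) := by
    have h0 : ENNReal.ofReal (1 / (2 * Real.pi)) ≠ 0 := by simp [Real.pi_pos]
    simp only [lintegral_nu]
    have hK := ENNReal.ofReal_ne_top (r := 1 / (2 * Real.pi))
    generalize ENNReal.ofReal (1 / (2 * Real.pi)) = K at h0 hK
    constructor <;> intro h
    · simpa using ENNReal.Tendsto.const_mul (a := K) h (Or.inr hK)
    · have := ENNReal.Tendsto.const_mul (a := K⁻¹) h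
        (Or.inr (by simpa using h0))
      simpa [← mul_assoc, ENNReal.inv_mul_cancel h0 hK] using this
  have key : ∀ hF : MemLp F 2 nu, Tendsto (fun N : ℕ => ∫⁻ t, ‖F t - ∑ k ∈ Finset.range N,
      c k * ex (-(k : ℤ)) t‖ₑ ^ 2 ∂nu) atTop (𝓝 0) ↔ Tendsto (fun N : ℕ =>
      (sum_causal_memLp c N).toLp _) atTop (𝓝 (hF.toLp F)) := by
    intro hF
    have e : ∀ N, ∫⁻ t, ‖F t - ∑ k ∈ Finset.range N, c k * ex (-(k : ℤ)) t‖ₑ ^ 2 ∂nu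
        = ‖hF.toLp F - (sum_causal_memLp c N).toLp _‖ₑ ^ 2 := fun N => by
      rw [← MemLp.toLp_sub, enorm_toLp_sq]; rfl
    simp_rw [e]
    rw [tendsto_iff_norm_sub_tendsto_zero]
    have h1 : ∀ N, ‖hF.toLp F - (sum_causal_memLp c N).toLp _‖ₑ ^ 2
        = ENNReal.ofReal (‖(sum_causal_memLp c N).toLp _ - hF.toLp F‖ ^ 2) := fun N => by
      rw [ENNReal.ofReal_pow (norm_nonneg _), norm_sub_rev, ofReal_norm]
    simp_rw [h1]
    constructor <;> intro h
    · have h2 := (ENNReal.tendsto_toReal ENNReal.zero_ne_top).comp h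
      have h3 := (Real.continuous_sqrt.tendsto _).comp h2
      simpa [Function.comp_def, Real.sqrt_sq] using h3
    · simpa using ENNReal.tendsto_ofReal (h.pow 2)
  rw [hm, hT]
  constructor
  · rintro ⟨h1, h2⟩
    have : MemLp F 2 nu := by
      obtain ⟨N, hN⟩ := (h2.eventually (gt_mem_nhds ENNReal.zero_lt_top)).exists
      have h3 := memLp_two_of_lintegral (h1.sub (sum_causal_memLp c N).1) hN
      have := h3.add (sum_causal_memLp c N)
      simpa using this
    exact ⟨this, (key this).1 h2⟩
  · rintro ⟨hF, h⟩
    exact ⟨hF.1, (key hF).2 h⟩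

/-- Mean square causal series are the functions in `L²` whose coefficients vanish on the negative
half-line. -/
lemma isCausalSeries_iff (c : ℕ → ℂ) (F : ℝ → ℂ) :
    IsCausalSeries c F ↔ MemLp F 2 nu ∧ (∀ n : ℕ, co F n = c n) ∧
      ∀ n : ℤ, n < 0 → co F n = 0 := by
  rw [isCausalSeries_iff']
  have hS : ∀ N : ℕ, (sum_causal_memLp c N).toLp _ = ∑ k ∈ Finset.range N, c k • trig (k : ℤ) := by
    intro N
    induction N with
    | zero => simp only [Finset.range_zero, Finset.sum_empty]; exact MemLp.toLp_zero _
    | succ N ih =>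
      rw [Finset.sum_range_succ, ← ih, trig, ← MemLp.toLp_const_smul, ← MemLp.toLp_add]
      congr 1
      ext t
      simp [Finset.sum_range_succ]
  constructor
  · rintro ⟨hF, h⟩
    have hc : ∀ n : ℤ, Tendsto (fun N : ℕ => ∑ k ∈ Finset.range N, c k *
        (if n = (k : ℤ) then (1 : ℂ) else 0)) atTop (𝓝 (co F n)) := fun n => by
      have := (tendsto_const_nhds (x := trig n)).inner (𝕜 := ℂ) h
      rw [inner_trig] at this
      refine this.congr fun N => ?_
      rw [hS, inner_sum]
      refine Finset.sum_congr rfl fun k _ => ?_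
      rw [inner_smul_right, orthonormal_iff_ite.1 orthonormal_trig]
    refine ⟨hF, fun n => ?_, fun n hn => ?_⟩
    · refine tendsto_nhds_unique (hc n) (tendsto_const_nhds.congr' ?_)
      filter_upwards [eventually_gt_atTop n] with N hN
      simp [hN]
    · refine tendsto_nhds_unique (hc n) (tendsto_const_nhds.congr fun N => ?_)
      rw [Finset.sum_eq_zero]
      intro k _
      rw [if_neg (by omega), mul_zero]
  · rintro ⟨hF, h1, h2⟩
    refine ⟨hF, ?_⟩
    have := trigBasis.hasSum_repr (hF.toLp F)
    simp_rw [trigBasis_repr, trigBasis_apply] at this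
    rw [← (Nat.cast_injective (R := ℤ)).hasSum_iff (fun n hn => by
      rw [h2 n (by
        by_contra! hn0
        exact hn ⟨n.toNat, by simp [hn0]⟩), zero_smul])] at this
    refine this.tendsto_sum_nat.congr fun N => ?_
    rw [hS]
    simp [h1]

/-- A sum over `ℤ` of a family vanishing on the negative half-line. -/
lemma hasSum_nat_of_int {E : Type*} [AddCommMonoid E] [TopologicalSpace E] {f : ℤ → E} {a : E}
    (h0 : ∀ n : ℤ, n < 0 → f n = 0) : HasSum (fun n : ℕ => f n) a ↔ HasSum f a :=
  (Nat.cast_injective (R := ℤ)).hasSum_iff (f := f) fun n hn => h0 n (by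
    by_contra! hn0
    exact hn ⟨n.toNat, by simp [hn0]⟩)

/-- Parseval's identity for `u` and `e^{imt} v`; causality of `u` removes the negative indices. This
is the source of all sums with a shifted index `l + m`. -/
lemma hasSum_co_star_mul {c : ℕ → ℂ} {u v : ℝ → ℂ} (hu : IsCausalSeries c u) (hv : MemLp v 2 nu)
    (m : ℤ) : HasSum (fun l : ℕ => star (c l) * co v (l + m)) (co (fun t => star (u t) * v t) m) := by
  obtain ⟨hu2, h1, h2⟩ := (isCausalSeries_iff c u).1 hu
  have := hasSum_parseval hu2 (memLp_ex_mul hv m)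
  simp_rw [co_ex_mul] at this
  rw [← hasSum_nat_of_int (fun n hn => by rw [h2 n hn, star_zero, zero_mul])] at this
  simp_rw [h1] at this
  convert this using 1
  simp only [co]
  congr 1; ext t; ring

/-! ### Absolutely convergent Fourier series as multipliers. -/

/-- The absolutely convergent Fourier series `∑ₖ α(k) e^{-ikt}`. -/
def fser (α : ℤ → ℂ) (t : ℝ) : ℂ := ∑' k : ℤ, α k * ex (-k) t

section fser

variable {α : ℤ → ℂ} (hα : Summable fun k => ‖α k‖)
include hα

lemma summable_fser (t : ℝ) : Summable fun k : ℤ => α k * ex (-k) t :=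
  Summable.of_norm (by simpa using hα)

lemma continuous_fser : Continuous (fser α) :=
  continuous_tsum (fun k => by fun_prop) hα fun k t => by simp

lemma norm_fser_le (t : ℝ) : ‖fser α t‖ ≤ ∑' k, ‖α k‖ := by
  refine (norm_tsum_le_tsum_norm (by simpa using hα)).trans (by simp)

lemma memLp_fser_mul {u : ℝ → ℂ} {p : ENNReal} (hu : MemLp u p nu) :
    MemLp (fun t => fser α t * u t) p nu := by
  refine MemLp.of_le_mul (c := ∑' k, ‖α k‖) hu
    ((continuous_fser hα).aestronglyMeasurable.mul hu.1) (ae_of_all _ fun t => ?_)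
  rw [norm_mul]
  exact mul_le_mul_of_nonneg_right (norm_fser_le hα t) (norm_nonneg _)

/-- Absolute summability of `α` allows termwise integration even when `u` is only integrable; the
result is a convolution. -/
lemma hasSum_co_fser_mul {u : ℝ → ℂ} (hu : Integrable u nu) (n : ℤ) :
    HasSum (fun k : ℤ => α k * co u (n - k)) (co (fun t => fser α t * u t) n) := by
  have hi : ∀ k : ℤ, Integrable (fun t => α k * (ex (n - k) t * u t)) nu := fun k =>
    (integrable_ex_mul hu _).const_mul _
  have := hasSum_integral_of_summable_integral_norm hi (by
    simp only [norm_mul, norm_ex, one_mul, integral_const_mul]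
    exact hα.mul_right _)
  convert! this using 1
  · ext k
    rw [integral_const_mul]; rfl
  · simp only [co]
    congr 1; ext t
    rw [fser, ← tsum_mul_right, ← tsum_mul_left]
    congr 1; ext k
    rw [sub_eq_add_neg, ex_add]; ring

end fser

/-! ### Szegő's extremal problem and a Smirnov type theorem. -/

lemma inner_eq_zero_of_mem_closure_span {ι H : Type*} [NormedAddCommGroup H]
    [InnerProductSpace ℂ H] {x : ι → H} {z y : H} (h : ∀ i, inner ℂ z (x i) = 0)
    (hy : y ∈ (Submodule.span ℂ (Set.range x)).topologicalClosure) : inner ℂ z y = 0 := by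
  have hle : (Submodule.span ℂ (Set.range x)).topologicalClosure ≤ (Submodule.span ℂ {z})ᗮ := by
    refine Submodule.topologicalClosure_minimal _ (Submodule.span_le.2 ?_)
      (Submodule.isClosed_orthogonal _)
    rintro _ ⟨i, rfl⟩
    exact Submodule.mem_orthogonal_singleton_iff_inner_right.2 (h i)
  exact Submodule.mem_orthogonal_singleton_iff_inner_right.1 (hle hy)

section Szego

variable {w : ℝ → ℝ} (hw : Integrable w nu) (h1 : ∀ t, 1 ≤ w t)
include hw h1

lemma memLp_sqrt_mul_ex (n : ℤ) : MemLp (fun t => (Real.sqrt (w t) : ℂ) * ex n t) 2 nu := by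
  have hm : AEStronglyMeasurable (fun t => (Real.sqrt (w t) : ℂ)) nu :=
    Complex.continuous_ofReal.comp_aestronglyMeasurable
      (Real.continuous_sqrt.comp_aestronglyMeasurable hw.1)
  refine (memLp_two_iff_integrable_sq_norm
    (hm.mul (continuous_ex n).aestronglyMeasurable)).2 ?_
  refine hw.congr (ae_of_all _ fun t => ?_)
  have := h1 t
  simp [abs_of_nonneg, Real.sq_sqrt (by linarith : 0 ≤ w t)]

/-- The extremal function of the Szegő problem with the weight `w`: a function of constant modulus
in the closed span of `√w e^{-ikt}`, `k ≥ 0`. -/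
lemma exists_szego : ∃ (K : ℝ → ℂ) (hK : MemLp K 2 nu) (c : ℝ), 0 ≤ c ∧ c ≤ ∫ t, w t ∂nu ∧
    (∀ᵐ t ∂nu, ‖K t‖ ^ 2 = c) ∧ ∫ t, K t / (Real.sqrt (w t) : ℂ) ∂nu = 1 ∧
    hK.toLp K ∈ (Submodule.span ℂ (Set.range fun k : ℕ =>
      (memLp_sqrt_mul_ex hw h1 (-(k : ℤ))).toLp _)).topologicalClosure := by
  set x : ℕ → Lp ℂ 2 nu := fun k => (memLp_sqrt_mul_ex hw h1 (-(k : ℤ))).toLp _ with hx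
  -- `K₀` is the prediction error of `√w` given the functions `√w e^{-ikt}`, `k ≥ 1`.
  set M := (Submodule.span ℂ (Set.range fun k : ℕ => x (k + 1))).topologicalClosure with hM
  set K₀ : Lp ℂ 2 nu := x 0 - M.starProjection (x 0) with hK₀
  have hKm : MemLp K₀ 2 nu := Lp.memLp K₀
  have hKe : hKm.toLp K₀ = K₀ := Lp.toLp_coeFn _ _
  have hort : ∀ y ∈ M, inner ℂ K₀ y = 0 := fun y hy =>
    Submodule.inner_left_of_mem_orthogonal hy (M.sub_starProjection_mem_orthogonal (x 0))
  have hxM : ∀ k, x (k + 1) ∈ M := fun k =>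
    Submodule.le_topologicalClosure _ (Submodule.subset_span ⟨k, rfl⟩)
  have hMle : M ≤ (Submodule.span ℂ (Set.range x)).topologicalClosure :=
    Submodule.topologicalClosure_mono (Submodule.span_mono (by
      rintro _ ⟨k, rfl⟩; exact ⟨k + 1, rfl⟩))
  have hPM : M.starProjection (x 0) ∈ M := Submodule.starProjection_apply_mem _ _
  have hcl : K₀ ∈ (Submodule.span ℂ (Set.range x)).topologicalClosure :=
    Submodule.sub_mem _ (Submodule.le_topologicalClosure _ (Submodule.subset_span ⟨0, rfl⟩))
      (hMle hPM)
  have hKx0 : inner ℂ K₀ (x 0) = inner ℂ K₀ K₀ := by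
    conv_rhs => rw [hK₀, inner_sub_right, ← hK₀, hort _ hPM, sub_zero]
  have hx0 : ‖x 0‖ ^ 2 = ∫ t, w t ∂nu := by
    have e : inner ℂ (x 0) (x 0) = ((∫ t, w t ∂nu : ℝ) : ℂ) := by
      rw [hx, inner_toLp, ← integral_complex_ofReal]
      congr 1; ext t
      have := h1 t
      have e2 : (w t : ℂ) = (Real.sqrt (w t) : ℂ) * Real.sqrt (w t) := by
        rw [← Complex.ofReal_mul, Real.mul_self_sqrt (by linarith)]
      simp [e2]
    rw [@norm_sq_eq_re_inner ℂ, e]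
    exact Complex.ofReal_re _
  have hle : ‖K₀‖ ^ 2 ≤ ‖x 0‖ ^ 2 := by
    have h2 : ‖K₀‖ ^ 2 ≤ ‖K₀‖ * ‖x 0‖ := by
      have := norm_inner_le_norm (𝕜 := ℂ) K₀ (x 0)
      rw [hKx0, inner_self_eq_norm_sq_to_K] at this
      simpa using this
    nlinarith [sq_nonneg (‖K₀‖ - ‖x 0‖), norm_nonneg K₀, norm_nonneg (x 0)]
  refine ⟨K₀, hKm, ‖K₀‖ ^ 2, by positivity, hx0 ▸ hle, ?_, ?_, by rwa [hKe]⟩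
  -- For `k ≥ 1` the function `e^{ikt} K₀` is orthogonal to each `x j`, because `K₀` is orthogonal
  -- to `x (j + k)`; hence it is orthogonal to `K₀` itself. So `|K₀|²` has no coefficients of one
  -- sign, being real none of the other, and is therefore constant.
  · have hin : ∀ k : ℕ, 0 < k → co (fun t => star (K₀ t) * K₀ t) (-(k : ℤ)) = 0 := by
      intro k hk
      have hz : inner ℂ ((memLp_ex_mul hKm k).toLp _) (hKm.toLp K₀) = 0 := by
        rw [hKe]
        refine inner_eq_zero_of_mem_closure_span (x := x) (fun j => ?_) hcl
        have h3 := hort _ (hxM (j + k - 1))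
        rw [Nat.sub_add_cancel (by omega), ← hKe, hx, inner_toLp] at h3
        rw [hx, inner_toLp, ← h3]
        congr 1; ext t
        rw [star_mul, star_ex]
        push_cast
        rw [neg_add, ex_add]; ring
      rw [inner_toLp] at hz
      rw [← hz, co]
      congr 1; ext t
      rw [star_mul, star_ex]; ring
    have hint := integrable_star_mul hKm hKm
    have hneg : ∀ n : ℤ, co (fun t => star (K₀ t) * K₀ t) n
        = star (co (fun t => star (K₀ t) * K₀ t) (-n)) := fun n => by
      rw [← co_star]; congr 1; ext t; simp [mul_comm]
    have h0 : co (fun t => star (K₀ t) * K₀ t) 0 = ((‖K₀‖ ^ 2 : ℝ) : ℂ) := by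
      have := inner_self_eq_norm_sq_to_K (𝕜 := ℂ) (hKm.toLp K₀)
      rw [inner_toLp, hKe] at this
      simp only [co, ex_zero, one_mul, this]
      push_cast; rfl
    have hae := ae_eq_of_co (v := fun _ => ((‖K₀‖ ^ 2 : ℝ) : ℂ)) hint (integrable_const _)
      fun n => by
        have hr : co (fun _ => ((‖K₀‖ ^ 2 : ℝ) : ℂ)) n
            = (if n = 0 then 1 else 0) * ((‖K₀‖ ^ 2 : ℝ) : ℂ) := by
          rw [co, integral_mul_const, integral_ex]
        rw [hr]
        rcases lt_trichotomy n 0 with hn | rfl | hn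
        · obtain ⟨k, rfl⟩ := Int.exists_eq_neg_ofNat hn.le
          rw [hin k (by omega)]
          rw [if_neg (by omega), zero_mul]
        · rw [h0, if_pos rfl, one_mul]
        · obtain ⟨k, rfl⟩ := Int.eq_ofNat_of_zero_le hn.le
          rw [hneg, hin k (by omega), if_neg (by omega)]; simp
    filter_upwards [hae] with t ht
    have e : star (K₀ t) * K₀ t = ((‖K₀ t‖ ^ 2 : ℝ) : ℂ) := by
      push_cast; exact Complex.conj_mul' _
    rw [e] at ht
    exact_mod_cast ht
  · have hs : ∀ t, 1 ≤ Real.sqrt (w t) := fun t => by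
      rw [← Real.sqrt_one]; exact Real.sqrt_le_sqrt (h1 t)
    -- Pairing with `1 / √w` gives `1` on `x 0` and `0` on every other generator, hence `0` on `M`;
    -- this fixes the mean of `K₀ / √w`.
    have hzm : MemLp (fun t => ((Real.sqrt (w t))⁻¹ : ℂ)) 2 nu := by
      refine MemLp.of_bound ?_ 1 (ae_of_all _ fun t => ?_)
      · have := (Complex.measurable_ofReal.comp_aemeasurable
          (Real.continuous_sqrt.measurable.comp_aemeasurable hw.1.aemeasurable)).inv
        exact this.aestronglyMeasurable
      · rw [norm_inv, Complex.norm_real, Real.norm_of_nonneg (Real.sqrt_nonneg _)]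
        exact inv_le_one_of_one_le₀ (hs t)
    have hzx : ∀ k : ℕ, inner ℂ (hzm.toLp _) (x k) = if k = 0 then 1 else 0 := fun k => by
      rw [hx, inner_toLp]
      have : ∀ t, star ((Real.sqrt (w t))⁻¹ : ℂ) * ((Real.sqrt (w t) : ℂ) * ex (-(k : ℤ)) t)
          = ex (-(k : ℤ)) t := fun t => by
        have h0 : (Real.sqrt (w t) : ℂ) ≠ 0 := by
          have := hs t
          exact_mod_cast (by linarith : Real.sqrt (w t) ≠ 0)
        rw [star_inv₀]
        simp only [RCLike.star_def, Complex.conj_ofReal]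
        rw [inv_mul_cancel_left₀ h0]
      simp_rw [this, integral_ex]
      simp
    have hzK : inner ℂ (hzm.toLp _) K₀ = 1 := by
      rw [hK₀, inner_sub_right, hzx, if_pos rfl,
        inner_eq_zero_of_mem_closure_span (fun k => by rw [hzx]; simp) hPM, sub_zero]
    rw [← hKe, inner_toLp] at hzK
    rw [← hzK]
    congr 1; ext t
    simp [div_eq_inv_mul]

end Szego

/-- Expanding `|1 - κ|²` and using that the mean of `κ` is `1` leaves `∫ |κ|² - 1`. It forces the
Szegő multipliers to tend to `1` as `c` tends to `1`. -/
lemma one_sub_norm_le {κ : ℝ → ℂ} (hκ : MemLp κ 2 nu) {c : ℝ} (hb : ∀ᵐ t ∂nu, ‖κ t‖ ^ 2 ≤ c)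
    (hm : ∫ t, κ t ∂nu = 1) (h1 : MemLp (fun t => 1 - κ t) 2 nu) :
    ‖h1.toLp _‖ ^ 2 ≤ c - 1 := by
  have hi := hκ.integrable (by norm_num : (1 : ENNReal) ≤ 2)
  have hsq : Integrable (fun t => ‖κ t‖ ^ 2) nu := (memLp_two_iff_integrable_sq_norm hκ.1).1 hκ
  have e1 : ‖h1.toLp _‖ ^ 2 = ∫ t, ‖1 - κ t‖ ^ 2 ∂nu := by
    have e : ∀ z : ℂ, star z * z = ((‖z‖ ^ 2 : ℝ) : ℂ) := fun z => by
      push_cast; exact Complex.conj_mul' z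
    rw [@norm_sq_eq_re_inner ℂ, inner_toLp]
    simp_rw [e]
    rw [integral_complex_ofReal]
    exact Complex.ofReal_re _
  have e2 : ∫ t, ‖1 - κ t‖ ^ 2 ∂nu = 1 - 2 * (∫ t, κ t ∂nu).re + ∫ t, ‖κ t‖ ^ 2 ∂nu := by
    have e : ∀ t, ‖1 - κ t‖ ^ 2 = (1 - 2 * (κ t).re) + ‖κ t‖ ^ 2 := fun t => by
      simp only [← Complex.normSq_eq_norm_sq, Complex.normSq_apply, Complex.sub_re,
        Complex.sub_im, Complex.one_re, Complex.one_im]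
      ring
    have hre : Integrable (fun t => (κ t).re) nu := hi.re
    simp_rw [e]
    have hre2 : Integrable (fun t => 1 - 2 * (κ t).re) nu :=
      (integrable_const _).sub (hre.const_mul 2)
    rw [integral_add hre2 hsq, integral_sub (integrable_const _) (hre.const_mul 2), integral_const_mul]
    have : ∫ t, (κ t).re ∂nu = (∫ t, κ t ∂nu).re := integral_re hi
    rw [this]; simp
  have e3 : ∫ t, ‖κ t‖ ^ 2 ∂nu ≤ c := by
    have := integral_mono_ae hsq (integrable_const c) hb
    simpa using this
  rw [e1, e2, hm]
  simp only [Complex.one_re]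
  linarith

/-- A Smirnov type theorem: if `u ∈ L²` is a combination `∑ Ψ_l F_l` of causal `Ψ_l ∈ L²` with
integrable `F_l` having only strictly anticausal terms, then the mean of `u` vanishes. -/
lemma integral_eq_zero_of_smirnov {T : ℕ} {Ψ F : Fin T → ℝ → ℂ} {u : ℝ → ℂ}
    (hΨ : ∀ l, MemLp (Ψ l) 2 nu) (hΨ0 : ∀ l, ∀ n : ℤ, n < 0 → co (Ψ l) n = 0)
    (hF : ∀ l, Integrable (F l) nu) (hF0 : ∀ l, ∀ k : ℕ, co (F l) (-(k : ℤ)) = 0)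
    (hu : MemLp u 2 nu) (h : ∀ᵐ t ∂nu, u t = ∑ l, Ψ l t * F l t) : ∫ t, u t ∂nu = 0 := by
  set I : ℝ := ∫ t, ∑ l, ‖F l t‖ ∂nu with hI
  have hSint : Integrable (fun t => ∑ l, ‖F l t‖) nu :=
    integrable_finsetSum _ fun l _ => (hF l).norm
  have main : ∀ ε : ℝ, 0 < ε →
      ‖∫ t, u t ∂nu‖ ^ 2 ≤ ε * I * (2 * (2 + ε * I)) * ‖hu.toLp u‖ ^ 2 := by
    intro ε hε
    -- This weight dominates `ε ‖F l t‖`, so `F l / w` is bounded by `ε⁻¹`, while its mean `1 + ε I`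
    -- tends to `1` with `ε`.
    set w : ℝ → ℝ := fun t => 1 + ε * ∑ l, ‖F l t‖ with hwdef
    have hw : Integrable w nu := (integrable_const _).add (hSint.const_mul ε)
    have h1 : ∀ t, 1 ≤ w t := fun t => by
      have : 0 ≤ ε * ∑ l, ‖F l t‖ := by positivity
      simp only [hwdef]; linarith
    have hwI : ∫ t, w t ∂nu = 1 + ε * I := by
      rw [hwdef, integral_add (integrable_const _) (hSint.const_mul ε), integral_const_mul]
      simp [hI]
    obtain ⟨K, hK, c, hc0, hcw, hKc, hmean, hcl⟩ := exists_szego hw h1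
    rw [hwI] at hcw
    have hs1 : ∀ t, 1 ≤ Real.sqrt (w t) := fun t => by
      rw [← Real.sqrt_one]; exact Real.sqrt_le_sqrt (h1 t)
    have hsw : ∀ t, (Real.sqrt (w t) : ℂ) * Real.sqrt (w t) = w t := fun t => by
      rw [← Complex.ofReal_mul, Real.mul_self_sqrt (by linarith [h1 t])]
    have hs0 : ∀ t, (Real.sqrt (w t) : ℂ) ≠ 0 := fun t => by
      have := hs1 t
      exact_mod_cast (by linarith : Real.sqrt (w t) ≠ 0)
    have hw0 : ∀ t, (w t : ℂ) ≠ 0 := fun t => by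
      have := h1 t
      exact_mod_cast (by linarith : w t ≠ 0)
    have hwm : AEStronglyMeasurable (fun t => ((w t)⁻¹ : ℂ)) nu :=
      (Complex.measurable_ofReal.comp_aemeasurable hw.1.aemeasurable).inv.aestronglyMeasurable
    have hswm : AEStronglyMeasurable (fun t => ((Real.sqrt (w t))⁻¹ : ℂ)) nu :=
      (Complex.measurable_ofReal.comp_aemeasurable (Real.continuous_sqrt.measurable.comp_aemeasurable
        hw.1.aemeasurable)).inv.aestronglyMeasurable
    set b : Fin T → ℝ → ℂ := fun l t => F l t * (w t : ℂ)⁻¹ with hb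
    have hbm : ∀ l, AEStronglyMeasurable (b l) nu := fun l => (hF l).1.mul hwm
    have hbb : ∀ l t, ‖b l t‖ ≤ ε⁻¹ := fun l t => by
      have h2 : ‖F l t‖ ≤ ∑ l, ‖F l t‖ :=
        Finset.single_le_sum (f := fun l => ‖F l t‖) (fun _ _ => norm_nonneg _)
          (Finset.mem_univ l)
      rw [hb, norm_mul, norm_inv, Complex.norm_real, Real.norm_of_nonneg (by linarith [h1 t]),
        ← div_eq_mul_inv, div_le_iff₀ (by linarith [h1 t]), ← div_eq_inv_mul, le_div_iff₀ hε]
      simp only [hwdef]; nlinarith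
    have hbK : ∀ l (n : ℤ) {x : ℝ → ℂ}, MemLp x 2 nu →
        MemLp (fun t => star (ex n t * x t * b l t)) 2 nu := fun l n x hx => by
      refine memLp_star (MemLp.of_le_mul (c := ε⁻¹) hx
        (((continuous_ex n).aestronglyMeasurable.mul hx.1).mul (hbm l)) (ae_of_all _ fun t => ?_))
      rw [norm_mul, norm_mul, norm_ex, one_mul, mul_comm]
      exact mul_le_mul_of_nonneg_right (hbb l t) (norm_nonneg _)
    -- The two factors `K` are replaced one after the other by generators `√w e^{-ijt}`. Then `√w ·
    -- √w · b l = F l`, and the hypothesis on the coefficients of `F l` applies. Multiplication by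
    -- the bounded `b l` keeps the pairing continuous.
    have hKb0 : ∀ l (k : ℕ), ∫ t, ex (-(k : ℤ)) t * K t * b l t * K t ∂nu = 0 := by
      intro l k
      have step1 : ∀ a : ℕ, ∫ t, ex (-(k : ℤ)) t * ((Real.sqrt (w t) : ℂ) * ex (-(a : ℤ)) t)
          * b l t * K t ∂nu = 0 := fun a => by
        have hz := inner_eq_zero_of_mem_closure_span
          (z := (hbK l (-(k : ℤ)) (memLp_sqrt_mul_ex hw h1 (-(a : ℤ)))).toLp _) (fun j => ?_) hcl
        · rw [inner_toLp] at hz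
          simpa only [star_star] using hz
        · rw [inner_toLp, ← hF0 l (k + a + j), co]
          congr 1; ext t
          simp only [star_star, hb]
          push_cast
          rw [neg_add, neg_add, ex_add, ex_add]
          have := hsw t
          have h3 := hw0 t
          field_simp
          linear_combination ex (-(k : ℤ)) t * ex (-(a : ℤ)) t * ex (-(j : ℤ)) t * F l t * this
      have hz := inner_eq_zero_of_mem_closure_span
          (z := (hbK l (-(k : ℤ)) hK).toLp _) (fun j => ?_) hcl
      · rw [inner_toLp] at hz
        simpa only [star_star] using hz
      · rw [inner_toLp, ← step1 j]
        congr 1; ext t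
        simp only [star_star]
        ring
    -- `κ` is the regularizing multiplier: `|κ|² = c / w`, so `κ² F l` is bounded by `c ε⁻¹`.
    set κ : ℝ → ℂ := fun t => K t / (Real.sqrt (w t) : ℂ) with hκdef
    have hκsq : ∀ t, κ t * κ t = K t * K t * (w t : ℂ)⁻¹ := fun t => by
      rw [hκdef, ← hsw t]
      have := hs0 t
      field_simp
    have hκm : AEStronglyMeasurable κ nu := by
      simp only [hκdef, div_eq_mul_inv]; exact hK.1.mul hswm
    have hκb : ∀ᵐ t ∂nu, ‖κ t‖ ^ 2 ≤ c := by
      filter_upwards [hKc] with t ht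
      rw [hκdef, norm_div, div_pow, ht, Complex.norm_real, Real.norm_of_nonneg (by
        linarith [hs1 t]), Real.sq_sqrt (by linarith [h1 t])]
      exact div_le_self hc0 (h1 t)
    have hκb' : ∀ᵐ t ∂nu, ‖κ t‖ ≤ Real.sqrt c := by
      filter_upwards [hκb] with t ht
      exact Real.le_sqrt_of_sq_le ht
    have hκ2 : MemLp κ 2 nu := MemLp.of_bound hκm _ hκb'
    have h1κ : MemLp (fun t => 1 - κ t) 2 nu := (memLp_const 1).sub hκ2
    have hn := one_sub_norm_le hκ2 hκb hmean h1κ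
    -- Each `κ² F l` is bounded, so Parseval with `Ψ l` is legitimate. The coefficients of `Ψ l`
    -- vanish for `n < 0` and those of the conjugate of `κ² F l` for `n ≥ 0`, so every term of the
    -- sum is zero.
    have hzero : ∫ t, κ t * κ t * u t ∂nu = 0 := by
      have hv : ∀ l, MemLp (fun t => κ t * κ t * F l t) 2 nu := fun l => by
        refine MemLp.of_bound ((hκm.mul hκm).mul (hF l).1) (c * ε⁻¹) ?_
        filter_upwards [hKc] with t ht
        rw [hκsq, mul_assoc, mul_comm _ (F l t), norm_mul, norm_mul, ← sq, ht]
        exact mul_le_mul_of_nonneg_left (hbb l t) hc0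
      have hl : ∀ l, ∫ t, star (star (κ t * κ t * F l t)) * Ψ l t ∂nu = 0 := fun l => by
        have hp := hasSum_parseval (memLp_star (hv l)) (hΨ l)
        refine hp.unique ?_
        convert! hasSum_zero using 1
        ext n
        rcases lt_or_ge n 0 with hn | hn
        · rw [hΨ0 l n hn, mul_zero]
        · obtain ⟨k, rfl⟩ := Int.eq_ofNat_of_zero_le hn
          rw [co_star, star_star]
          have : co (fun t => κ t * κ t * F l t) (-(k : ℤ)) = 0 := by
            rw [← hKb0 l k, co]
            congr 1; ext t
            rw [hκsq, hb]; ring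
          rw [this, zero_mul]
      have : ∫ t, κ t * κ t * u t ∂nu
          = ∑ l, ∫ t, star (star (κ t * κ t * F l t)) * Ψ l t ∂nu := by
        rw [← integral_finsetSum _ fun l _ => integrable_star_mul (memLp_star (hv l)) (hΨ l)]
        refine integral_congr_ae ?_
        filter_upwards [h] with t ht
        rw [ht, Finset.mul_sum]
        refine Finset.sum_congr rfl fun l _ => ?_
        rw [star_star]; ring
      rw [this, Finset.sum_eq_zero fun l _ => hl l]
    have hv2 : MemLp (fun t => (1 + κ t) * u t) 2 nu := by
      refine MemLp.of_le_mul (c := 1 + Real.sqrt c) hu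
        ((aestronglyMeasurable_const.add hκm).mul hu.1) ?_
      filter_upwards [hκb'] with t ht
      rw [norm_mul]
      refine mul_le_mul_of_nonneg_right ((norm_add_le _ _).trans ?_) (norm_nonneg _)
      simpa using ht
    have hv2n : ‖hv2.toLp _‖ ≤ (1 + Real.sqrt c) * ‖hu.toLp u‖ := by
      refine Lp.norm_le_mul_norm_of_ae_le_mul ?_
      filter_upwards [hκb', hv2.coeFn_toLp, hu.coeFn_toLp] with t ht e1 e2
      rw [e1, e2, norm_mul]
      refine mul_le_mul_of_nonneg_right ((norm_add_le _ _).trans ?_) (norm_nonneg _)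
      simpa using ht
    have huint := hu.integrable (by norm_num : (1 : ENNReal) ≤ 2)
    have hκu : Integrable (fun t => κ t * κ t * u t) nu := by
      refine huint.bdd_mul (c := c) (hκm.mul hκm) ?_
      filter_upwards [hκb] with t ht
      rwa [norm_mul, ← sq]
    have hstar : MemLp (fun t => star (1 - κ t)) 2 nu := memLp_star h1κ
    have hnstar : ‖hstar.toLp _‖ = ‖h1κ.toLp _‖ := by
      rw [Lp.norm_toLp, Lp.norm_toLp]
      congr 1
      exact eLpNorm_congr_norm_ae (ae_of_all _ fun t => norm_star _)
    -- The factorization `1 - κ² = (1 - κ)(1 + κ)` separates a factor small in `L²` from one that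
    -- stays bounded.
    have heq : ∫ t, u t ∂nu = inner ℂ (hstar.toLp _) (hv2.toLp _) := by
      rw [inner_toLp, ← sub_zero (∫ t, u t ∂nu), ← hzero, ← integral_sub huint hκu]
      congr 1; ext t
      rw [star_star]; ring
    have hcs := norm_inner_le_norm (𝕜 := ℂ) (hstar.toLp _) (hv2.toLp _)
    rw [← heq, hnstar] at hcs
    have hU := norm_nonneg (hu.toLp u)
    have hc1 : 0 ≤ c - 1 := le_trans (sq_nonneg _) hn
    have hsc : Real.sqrt c ^ 2 = c := Real.sq_sqrt hc0
    have hsc0 := Real.sqrt_nonneg c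
    calc ‖∫ t, u t ∂nu‖ ^ 2 ≤ (‖h1κ.toLp _‖ * ((1 + Real.sqrt c) * ‖hu.toLp u‖)) ^ 2 := by
          refine pow_le_pow_left₀ (norm_nonneg _) (hcs.trans ?_) 2
          exact mul_le_mul_of_nonneg_left hv2n (norm_nonneg _)
      _ = ‖h1κ.toLp _‖ ^ 2 * (1 + Real.sqrt c) ^ 2 * ‖hu.toLp u‖ ^ 2 := by ring
      _ ≤ (ε * I) * (2 * (2 + ε * I)) * ‖hu.toLp u‖ ^ 2 := by
          refine mul_le_mul_of_nonneg_right ?_ (sq_nonneg _)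
          refine mul_le_mul (hn.trans (by linarith)) ?_ (sq_nonneg _) (by linarith)
          -- `(1 + √c)² ≤ 2 (1 + c)` and `c ≤ 1 + ε I`.
          nlinarith [sq_nonneg (1 - Real.sqrt c)]
  have hlim : Tendsto (fun ε : ℝ => ε * I * (2 * (2 + ε * I)) * ‖hu.toLp u‖ ^ 2) (𝓝[>] 0)
      (𝓝 0) := by
    have : Continuous fun ε : ℝ => ε * I * (2 * (2 + ε * I)) * ‖hu.toLp u‖ ^ 2 := by fun_prop
    have h2 := this.tendsto 0
    simp only [zero_mul] at h2
    exact h2.mono_left nhdsWithin_le_nhds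
  have hfin : ‖∫ t, u t ∂nu‖ ^ 2 ≤ 0 :=
    ge_of_tendsto hlim (by filter_upwards [self_mem_nhdsWithin] with ε hε using main ε hε)
  have : ‖∫ t, u t ∂nu‖ = 0 := by
    have := sq_nonneg ‖∫ t, u t ∂nu‖
    exact pow_eq_zero_iff (n := 2) (by norm_num) |>.1 (le_antisymm hfin this)
  exact norm_eq_zero.1 this

/-! ### Isometries determined by Gram matrices. -/

lemma map_mem_closure_span {ι E F : Type*} [NormedAddCommGroup E] [InnerProductSpace ℂ E]
    [NormedAddCommGroup F] [InnerProductSpace ℂ F] (V : E →L[ℂ] F) (x : ι → E) {a : E}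
    (ha : a ∈ (Submodule.span ℂ (Set.range x)).topologicalClosure) :
    V a ∈ (Submodule.span ℂ (Set.range fun i => V (x i))).topologicalClosure := by
  have hle : (Submodule.span ℂ (Set.range x)).topologicalClosure ≤
      (Submodule.span ℂ (Set.range fun i => V (x i))).topologicalClosure.comap V.toLinearMap := by
    refine Submodule.topologicalClosure_minimal _ (Submodule.span_le.2 ?_) ?_
    · rintro _ ⟨i, rfl⟩
      exact Submodule.le_topologicalClosure _ (Submodule.subset_span ⟨i, rfl⟩)
    · exact (Submodule.isClosed_topologicalClosure _).preimage V.continuous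
  exact hle ha

/-- Families with the same Gram matrix are intertwined by a partial isometry. -/
lemma exists_isometry_of_gram {ι E F : Type*} [NormedAddCommGroup E] [InnerProductSpace ℂ E]
    [CompleteSpace E] [NormedAddCommGroup F] [InnerProductSpace ℂ F] [CompleteSpace F]
    (x : ι → E) (y : ι → F) (h : ∀ i j, inner ℂ (y i) (y j) = inner ℂ (x i) (x j)) :
    ∃ V : E →L[ℂ] F, (∀ i, V (x i) = y i) ∧
      ∀ a ∈ (Submodule.span ℂ (Set.range x)).topologicalClosure,
      ∀ b ∈ (Submodule.span ℂ (Set.range x)).topologicalClosure,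
        inner ℂ (V a) (V b) = inner ℂ a b := by
  set S := (Submodule.span ℂ (Set.range x)).topologicalClosure with hS
  have hxS : ∀ i, x i ∈ S := fun i =>
    Submodule.le_topologicalClosure _ (Submodule.subset_span ⟨i, rfl⟩)
  let lx : (ι →₀ ℂ) →ₗ[ℂ] S := Finsupp.linearCombination ℂ fun i => (⟨x i, hxS i⟩ : S)
  let ly : (ι →₀ ℂ) →ₗ[ℂ] F := Finsupp.linearCombination ℂ y
  have hlx : ∀ c, ((lx c : S) : E) = Finsupp.linearCombination ℂ x c := fun c => by
    simp [lx, Finsupp.linearCombination_apply, Finsupp.sum]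
  have hin : ∀ c c', inner ℂ (ly c) (ly c') = inner ℂ (lx c) (lx c') := fun c c' => by
    rw [Submodule.coe_inner, hlx, hlx]
    simp only [ly, Finsupp.linearCombination_apply, Finsupp.sum, sum_inner, inner_sum,
      inner_smul_left, inner_smul_right, h]
  have hnorm : ∀ c, ‖ly c‖ = ‖lx c‖ := fun c => by
    rw [@norm_eq_sqrt_re_inner ℂ, @norm_eq_sqrt_re_inner ℂ _ _ _ _ (lx c), hin]
  have hdense : DenseRange lx := by
    intro z
    rw [Topology.IsInducing.subtypeVal.closure_eq_preimage_closure_image]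
    have hz : (z : E) ∈ closure ((Submodule.span ℂ (Set.range x) : Submodule ℂ E) : Set E) := by
      rw [← Submodule.topologicalClosure_coe]; exact z.2
    refine closure_mono ?_ hz
    intro e he
    obtain ⟨c, rfl⟩ := Finsupp.mem_span_range_iff_exists_finsupp.1 he
    exact ⟨lx c, ⟨c, rfl⟩, by rw [hlx, Finsupp.linearCombination_apply]⟩
  -- Equal Gram matrices give equal norms of finite combinations. This makes the extension well
  -- defined even if the family `x` is linearly dependent.
  let V₀ : S →L[ℂ] F := ly.extendOfNorm lx
  have hV₀ : ∀ c, V₀ (lx c) = ly c := fun c =>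
    LinearMap.extendOfNorm_eq hdense ⟨1, fun c => by rw [hnorm, one_mul]⟩ c
  have hinS : ∀ a b : S, inner ℂ (V₀ a) (V₀ b) = inner ℂ a b := by
    intro a b
    refine hdense.induction_on₂ (p := fun a b : S => inner ℂ (V₀ a) (V₀ b) = inner ℂ a b)
      ?_ ?_ a b
    · exact isClosed_eq (by fun_prop) (by fun_prop)
    · intro c c'
      rw [hV₀, hV₀, hin]
  -- The map is extended by zero on the orthogonal complement of the closed span.
  refine ⟨V₀.comp S.orthogonalProjectionOnto, fun i => ?_, fun a ha b hb => ?_⟩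
  · have h1 : S.orthogonalProjectionOnto (x i) = lx (Finsupp.single i 1) := by
      apply Subtype.ext
      rw [hlx, Finsupp.linearCombination_single, one_smul]
      exact Submodule.starProjection_eq_self_iff.2 (hxS i)
    rw [ContinuousLinearMap.comp_apply, h1, hV₀]
    simp [ly]
  · have e : ∀ a (ha : a ∈ S), S.orthogonalProjectionOnto a = ⟨a, ha⟩ := fun a ha =>
      Subtype.ext (Submodule.starProjection_eq_self_iff.2 ha)
    rw [ContinuousLinearMap.comp_apply, ContinuousLinearMap.comp_apply, hinS, e a ha, e b hb]
    rfl

/-! ### Vector valued square integrable functions -/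

/-- The space `L²([-π, π), dλ / 2π; ℂ^q)`. -/
abbrev LL (q : ℕ) := Lp (EuclideanSpace ℂ (Fin q)) 2 nu

/-- All components are square integrable. -/
def V2 {q : ℕ} (u : ℝ → Fin q → ℂ) : Prop := ∀ j, MemLp (fun t => u t j) 2 nu

lemma V2.memLp {q : ℕ} {u : ℝ → Fin q → ℂ} (hu : V2 u) :
    MemLp (fun t => (WithLp.toLp 2 (u t) : EuclideanSpace ℂ (Fin q))) 2 nu :=
  memLp_piLp_iff.2 hu

open Classical in
/-- The element of `L²` defined by a vector function (zero if it is not square integrable). -/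
def vec {q : ℕ} (u : ℝ → Fin q → ℂ) : LL q :=
  if h : V2 u then h.memLp.toLp _ else 0

/-- The components of a representative of an element of `L²`. -/
def comps {q : ℕ} (G : LL q) (t : ℝ) (j : Fin q) : ℂ := G t j

section vec

variable {q : ℕ} {u v : ℝ → Fin q → ℂ}

lemma vec_eq (hu : V2 u) : vec u = hu.memLp.toLp _ := dif_pos hu

lemma comps_vec (hu : V2 u) : ∀ᵐ t ∂nu, comps (vec u) t = u t := by
  rw [vec_eq hu]
  filter_upwards [hu.memLp.coeFn_toLp] with t ht
  ext j
  rw [comps, ht]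

lemma v2_comps (G : LL q) : V2 (comps G) := memLp_piLp_iff.1 (Lp.memLp G)

lemma vec_comps (G : LL q) : vec (comps G) = G := by
  rw [vec_eq (v2_comps G)]
  exact Lp.toLp_coeFn G _

lemma V2.congr (hu : V2 u) (h : ∀ᵐ t ∂nu, u t = v t) : V2 v := fun j =>
  (hu j).ae_eq (by filter_upwards [h] with t ht; rw [ht])

lemma vec_congr (hu : V2 u) (h : ∀ᵐ t ∂nu, u t = v t) : vec u = vec v := by
  rw [vec_eq hu, vec_eq (hu.congr h)]
  exact MemLp.toLp_congr _ _ (by filter_upwards [h] with t ht; rw [ht])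

lemma ae_eq_of_vec_eq (hu : V2 u) (hv : V2 v) (h : vec u = vec v) : ∀ᵐ t ∂nu, u t = v t := by
  filter_upwards [comps_vec hu, comps_vec hv] with t h1 h2
  rw [← h1, ← h2, h]

lemma V2.add (hu : V2 u) (hv : V2 v) : V2 (u + v) := fun j => (hu j).add (hv j)

lemma V2.sub (hu : V2 u) (hv : V2 v) : V2 (u - v) := fun j => (hu j).sub (hv j)

lemma V2.smul (c : ℂ) (hu : V2 u) : V2 (c • u) := fun j => (hu j).const_smul c

lemma V2.zero : V2 (0 : ℝ → Fin q → ℂ) := fun _ => MemLp.zero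

lemma V2.sum {ι : Type*} (s : Finset ι) {f : ι → ℝ → Fin q → ℂ} (h : ∀ i ∈ s, V2 (f i)) :
    V2 (∑ i ∈ s, f i) := fun j => by
  simp only [Finset.sum_apply]
  exact memLp_finsetSum _ fun i hi => h i hi j

lemma vec_add (hu : V2 u) (hv : V2 v) : vec (u + v) = vec u + vec v := by
  rw [vec_eq hu, vec_eq hv, vec_eq (hu.add hv), ← MemLp.toLp_add]; rfl

lemma vec_sub (hu : V2 u) (hv : V2 v) : vec (u - v) = vec u - vec v := by
  rw [vec_eq hu, vec_eq hv, vec_eq (hu.sub hv), ← MemLp.toLp_sub]; rfl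

lemma vec_smul (c : ℂ) (hu : V2 u) : vec (c • u) = c • vec u := by
  rw [vec_eq hu, vec_eq (hu.smul c), ← MemLp.toLp_const_smul]; rfl

lemma vec_zero : vec (0 : ℝ → Fin q → ℂ) = 0 := by
  rw [vec_eq V2.zero]; exact MemLp.toLp_zero _

lemma vec_sum {ι : Type*} (s : Finset ι) {f : ι → ℝ → Fin q → ℂ} (h : ∀ i ∈ s, V2 (f i)) :
    vec (∑ i ∈ s, f i) = ∑ i ∈ s, vec (f i) := by
  classical
  induction s using Finset.induction_on with
  | empty => simpa using vec_zero
  | insert a s ha ih =>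
    rw [Finset.sum_insert ha, Finset.sum_insert ha, vec_add (h _ (Finset.mem_insert_self _ _))
      (V2.sum _ fun i hi => h _ (Finset.mem_insert_of_mem hi)),
      ih fun i hi => h _ (Finset.mem_insert_of_mem hi)]

lemma integrable_inner_vec (hu : V2 u) (hv : V2 v) :
    Integrable (fun t => ∑ j, star (u t j) * v t j) nu :=
  integrable_finsetSum _ fun j _ => integrable_star_mul (hu j) (hv j)

lemma inner_vec (hu : V2 u) (hv : V2 v) :
    inner ℂ (vec u) (vec v) = ∫ t, ∑ j, star (u t j) * v t j ∂nu := by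
  rw [vec_eq hu, vec_eq hv, L2.inner_def]
  refine integral_congr_ae ?_
  filter_upwards [hu.memLp.coeFn_toLp, hv.memLp.coeFn_toLp] with t h1 h2
  rw [h1, h2, PiLp.inner_apply]
  refine Finset.sum_congr rfl fun j _ => ?_
  rw [RCLike.inner_apply, mul_comm]; rfl

lemma norm_sq_vec (hu : V2 u) : ‖vec u‖ ^ 2 = ∑ j, ∫ t, ‖u t j‖ ^ 2 ∂nu := by
  rw [@norm_sq_eq_re_inner ℂ, inner_vec hu hu, integral_finsetSum _ fun j _ =>
    integrable_star_mul (hu j) (hu j), map_sum]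
  refine Finset.sum_congr rfl fun j _ => ?_
  have e : ∀ z : ℂ, star z * z = ((‖z‖ ^ 2 : ℝ) : ℂ) := fun z => by
    push_cast; exact Complex.conj_mul' z
  simp_rw [e]
  rw [integral_complex_ofReal]
  exact Complex.ofReal_re _

lemma enorm_sq_vec (hu : V2 u) :
    ‖vec u‖ₑ ^ 2 = ∫⁻ t, ENNReal.ofReal (∑ j, ‖u t j‖ ^ 2) ∂nu := by
  rw [vec_eq hu, enorm_toLp_sq]
  congr 1; ext t
  rw [← ofReal_norm, ← ENNReal.ofReal_pow (norm_nonneg _), EuclideanSpace.norm_sq_eq]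

lemma v2_of_lintegral (hm : ∀ j, AEStronglyMeasurable (fun t => u t j) nu)
    (h : ∫⁻ t, ENNReal.ofReal (∑ j, ‖u t j‖ ^ 2) ∂nu < ⊤) : V2 u := by
  intro j
  refine memLp_two_of_lintegral (hm j) (lt_of_le_of_lt (lintegral_mono fun t => ?_) h)
  rw [← ofReal_norm, ← ENNReal.ofReal_pow (norm_nonneg _)]
  exact ENNReal.ofReal_le_ofReal
    (Finset.single_le_sum (f := fun j => ‖u t j‖ ^ 2) (fun _ _ => by positivity) (Finset.mem_univ j))

end vec

/-- The vector function `χ(t) δⱼ`. -/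
def unitF {q : ℕ} (χ : ℝ → ℂ) (j : Fin q) (t : ℝ) (i : Fin q) : ℂ := if i = j then χ t else 0

/-- The vector function `χ(t) M(t)_{l ·}`. -/
def rowF {T q : ℕ} (M : ℝ → Matrix (Fin T) (Fin q) ℂ) (χ : ℝ → ℂ) (l : Fin T) (t : ℝ)
    (j : Fin q) : ℂ := χ t * M t l j

lemma v2_unitF_ex {q : ℕ} (n : ℤ) (j : Fin q) : V2 (unitF (ex n) j) := fun i => by
  by_cases h : i = j
  · simpa only [unitF, if_pos h] using memLp_ex n 2
  · simp only [unitF, if_neg h]; exact MemLp.zero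

lemma inner_unitF_ex {q : ℕ} (n : ℤ) (j : Fin q) (G : LL q) :
    inner ℂ (vec (unitF (ex (-n)) j)) G = co (fun t => comps G t j) n := by
  conv_lhs => rw [← vec_comps G]
  rw [inner_vec (v2_unitF_ex _ _) (v2_comps G), co]
  congr 1; ext t
  rw [Finset.sum_eq_single j]
  · simp [unitF, conj_ex]
  · intro i _ hi; simp [unitF, hi]
  · simp

lemma dense_of_inner_eq_zero {ι : Type*} {q : ℕ} {x : ι → LL q}
    (h : ∀ G : LL q, (∀ i, inner ℂ (x i) G = 0) → G = 0) :
    (Submodule.span ℂ (Set.range x)).topologicalClosure = ⊤ := by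
  rw [Submodule.topologicalClosure_eq_top_iff, Submodule.eq_bot_iff]
  intro G hG
  exact h G fun i => Submodule.inner_right_of_mem_orthogonal
    (K := Submodule.span ℂ (Set.range x)) (Submodule.subset_span (Set.mem_range_self i)) hG

/-! ### Totality and outerness of the spectral factor. -/

section Factor

variable {T q : ℕ} {Θ : ℝ → Matrix (Fin T) (Fin q) ℂ} {Ψ : ℝ → Matrix (Fin q) (Fin T) ℂ}
  (hinv : ∀ᵐ t ∂nu, Ψ t * Θ t = 1)
include hinv

/-- The entrywise conjugate of `Ψ Θ = 1` applied to `G`. Orthogonality relations only give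
information on `conj Θ · G`; this recovers `G` from it. -/
lemma comps_eq_conj_mul (G : ℝ → Fin q → ℂ) : ∀ᵐ t ∂nu, ∀ j, G t j
    = ∑ l, star (Ψ t j l) * ∑ j', star (Θ t l j') * G t j' := by
  filter_upwards [hinv] with t ht j
  have : ∀ j', ∑ l, star (Ψ t j l) * star (Θ t l j') = if j = j' then 1 else 0 := fun j' => by
    have h1 := congrFun (congrFun ht j) j'
    rw [Matrix.mul_apply, Matrix.one_apply] at h1
    have h2 := congrArg star h1
    simp only [star_sum, star_mul'] at h2
    rw [h2]
    split_ifs <;> simp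
  simp_rw [Finset.mul_sum]
  rw [Finset.sum_comm]
  simp_rw [← mul_assoc, ← Finset.sum_mul, this]
  simp

lemma eq_zero_of_conj_mul_eq_zero (G : LL q)
    (h : ∀ l, ∀ᵐ t ∂nu, ∑ j, star (Θ t l j) * comps G t j = 0) : G = 0 := by
  rw [← vec_comps G, ← vec_zero]
  refine vec_congr (v2_comps G) ?_
  filter_upwards [comps_eq_conj_mul hinv (comps G), ae_all_iff.2 h] with t h1 h2
  ext j
  rw [h1, Finset.sum_eq_zero fun l _ => by rw [h2, mul_zero]]
  rfl

/-- The family `e^{imt} Θ_l`, `m ∈ ℤ`, is total. -/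
lemma dense_rowF_ex (hΘ : ∀ l j, MemLp (fun t => Θ t l j) 2 nu) :
    (Submodule.span ℂ (Set.range fun i : ℤ × Fin T =>
      vec (rowF Θ (ex i.1) i.2))).topologicalClosure = ⊤ := by
  refine dense_of_inner_eq_zero fun G hG => eq_zero_of_conj_mul_eq_zero hinv G fun l => ?_
  refine ae_eq_zero_of_co (integrable_inner_vec (hΘ l) (v2_comps G)) fun n => ?_
  have hr : V2 (rowF Θ (ex (-n)) l) := fun j => memLp_ex_mul (hΘ l j) _
  rw [← hG (-n, l), ← vec_comps G, inner_vec hr (v2_comps G), co, vec_comps]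
  congr 1; ext t
  rw [Finset.mul_sum]
  refine Finset.sum_congr rfl fun j _ => ?_
  rw [rowF, star_mul', star_ex, neg_neg]; ring

/-- The family of the step functions times the rows of `γ Θ` is total. -/
lemma dense_rowF_step {γ : ℝ → ℂ} (hγ : ∀ᵐ t ∂nu, γ t ≠ 0)
    (hΘ : ∀ l j, MemLp (fun t => γ t * Θ t l j) 2 nu) :
    (Submodule.span ℂ (Set.range fun i : {p : ℝ × ℝ // -Real.pi ≤ p.1 ∧ p.1 ≤ p.2 ∧
        p.2 ≤ Real.pi} × Fin T =>
      vec (rowF Θ ((Set.Ico i.1.1.1 i.1.1.2).indicator γ) i.2))).topologicalClosure = ⊤ := by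
  refine dense_of_inner_eq_zero fun G hG => eq_zero_of_conj_mul_eq_zero hinv G fun l => ?_
  have key : ∀ᵐ t ∂nu, ∑ j, star (γ t * Θ t l j) * comps G t j = 0 := by
    refine ae_eq_zero_of_setIntegral_Ico (integrable_inner_vec (hΘ l) (v2_comps G))
      fun a b h1 h2 h3 => ?_
    have hr : V2 (rowF Θ ((Set.Ico a b).indicator γ) l) := fun j => by
      have := (hΘ l j).indicator (measurableSet_Ico (a := a) (b := b))
      refine this.ae_eq (ae_of_all _ fun t => ?_)
      by_cases ht : t ∈ Set.Ico a b <;> simp [rowF, ht]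
    rw [← hG (⟨(a, b), h1, h2, h3⟩, l), ← vec_comps G, inner_vec hr (v2_comps G), vec_comps]
    congr 1; ext t
    rw [Finset.mul_sum]
    refine Finset.sum_congr rfl fun j _ => ?_
    by_cases ht : t ∈ Set.Ico a b <;> simp [rowF, ht]
  filter_upwards [key, hγ] with t ht hg
  simp_rw [star_mul', mul_assoc, ← Finset.mul_sum] at ht
  exact (mul_eq_zero.1 ht).resolve_left (star_ne_zero.2 hg)

/-- The outer property: the constant vectors times `e^{-ikt}`, `k ≥ 0`, belong to the closed span
of `e^{-imt} Θ_l`, `m ≥ 0`. -/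
lemma unitF_mem_closure (hΘ : ∀ l j, MemLp (fun t => Θ t l j) 2 nu)
    (hΨ : ∀ j l, MemLp (fun t => Ψ t j l) 2 nu)
    (hΨ0 : ∀ j l, ∀ n : ℤ, n < 0 → co (fun t => Ψ t j l) n = 0) (k : ℕ) (j : Fin q) :
    vec (unitF (ex (-(k : ℤ))) j) ∈ (Submodule.span ℂ (Set.range fun i : ℕ × Fin T =>
      vec (rowF Θ (ex (-(i.1 : ℤ))) i.2))).topologicalClosure := by
  rw [← Submodule.orthogonal_orthogonal_eq_closure, Submodule.mem_orthogonal]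
  intro G hG
  have hG' : ∀ (m : ℕ) (l : Fin T), inner ℂ (vec (rowF Θ (ex (-(m : ℤ))) l)) G = 0 := fun m l =>
    Submodule.inner_right_of_mem_orthogonal
      (K := Submodule.span ℂ (Set.range fun i : ℕ × Fin T => vec (rowF Θ (ex (-(i.1 : ℤ))) i.2)))
      (Submodule.subset_span (Set.mem_range_self (m, l))) hG
  rw [← inner_conj_symm, inner_unitF_ex]
  -- Here `conj G_j = ∑ Ψ_{jl} F_l` with `F_l = ∑ Θ_{lj'} conj G_{j'}`. Orthogonality to the span
  -- removes from `F_l` all terms `e^{imt}`, `m ≥ 0`. As `F_l` is merely integrable, Parseval cannot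
  -- be applied to the products, and the Smirnov type theorem replaces it.
  have hz : ∫ t, ex (-(k : ℤ)) t * star (comps G t j) ∂nu = 0 := by
    have hFi : ∀ l, Integrable (fun t => ∑ j', star (star (Θ t l j')) * star (comps G t j')) nu :=
      fun l => integrable_finsetSum _ fun j' _ =>
        integrable_star_mul (memLp_star (hΘ l j')) (memLp_star (v2_comps G j'))
    refine integral_eq_zero_of_smirnov (Ψ := fun l t => Ψ t j l)
      (F := fun l t => ex (-(k : ℤ)) t * ∑ j', star (star (Θ t l j')) * star (comps G t j'))
      (hΨ j) (hΨ0 j) (fun l => integrable_ex_mul (hFi l) _) (fun l m => ?_)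
      (memLp_ex_mul (memLp_star (v2_comps G j)) _) ?_
    · rw [co_ex_mul, ← neg_add]
      have h1 := hG' (m + k) l
      have hr : V2 (rowF Θ (ex (-((m + k : ℕ) : ℤ))) l) := fun j => memLp_ex_mul (hΘ l j) _
      rw [← vec_comps G, inner_vec hr (v2_comps G)] at h1
      have h2 := congrArg star h1
      rw [star_zero, RCLike.star_def, ← integral_conj] at h2
      rw [co, ← h2]
      congr 1; ext t
      rw [map_sum, Finset.mul_sum]
      refine Finset.sum_congr rfl fun j' _ => ?_
      simp only [rowF, map_mul, RCLike.star_def, Complex.conj_conj]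
      push_cast
      ring
    · filter_upwards [comps_eq_conj_mul hinv (comps G)] with t ht
      rw [ht j, star_sum, Finset.mul_sum]
      refine Finset.sum_congr rfl fun l _ => ?_
      rw [star_mul', star_sum, star_star]
      simp only [star_mul']
      ring
  have : co (fun t => comps G t j) k = star (∫ t, ex (-(k : ℤ)) t * star (comps G t j) ∂nu) := by
    rw [co, RCLike.star_def, ← integral_conj]
    congr 1; ext t
    simp [conj_ex]
  rw [this, hz]
  simp

end Factor

/-! ### Increments in the frequency domain. -/

section Increments

variable {r : ℕ} (d s : Fin r → ℕ) (μ : Fin r → ℤ)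

lemma gmIncrement_map {E F : Type*} [AddCommGroup E] [AddCommGroup F] (L : E →+ F)
    (x : ℤ → E) (m : ℤ) :
    gmIncrement d s μ (fun n => L (x n)) m = L (gmIncrement d s μ x m) := by
  simp only [gmIncrement, map_sum, map_zsmul]

lemma gmIncrement_add {E : Type*} [AddCommGroup E] (x y : ℤ → E) (m : ℤ) :
    gmIncrement d s μ (fun n => x n + y n) m = gmIncrement d s μ x m + gmIncrement d s μ y m := by
  simp only [gmIncrement, smul_add, Finset.sum_add_distrib]

/-- Exponentials are eigenfunctions of the backward shift; expanding the powers in `chi` binomially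
and multiplying out gives exactly the sum that defines the increment. -/
lemma gmIncrement_ex (m : ℤ) (t : ℝ) :
    gmIncrement d s μ (fun n => ex n t) m = ex m t * chi d s μ t := by
  have hpow : ∀ j, (1 - Complex.exp (-(Complex.I * (t : ℂ) * (μ j : ℂ) * (s j : ℂ)))) ^ (d j)
      = ∑ l ∈ Finset.range (d j + 1), ((-1 : ℂ) ^ l * ((d j).choose l : ℂ))
        * ex (-(μ j * (s j : ℤ) * (l : ℤ))) t := by
    intro j
    rw [sub_eq_add_neg, add_comm, add_pow]
    refine Finset.sum_congr rfl fun l _ => ?_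
    rw [one_pow, mul_one, neg_pow, ← Complex.exp_nat_mul, ex]
    have : (l : ℂ) * -(Complex.I * t * (μ j : ℂ) * (s j : ℂ))
        = Complex.I * t * ((-(μ j * (s j : ℤ) * (l : ℤ)) : ℤ) : ℂ) := by push_cast; ring
    rw [this]; ring
  have hprod : ∀ l : Fin r → ℕ, ∏ i, ex (-(μ i * (s i : ℤ) * (l i : ℤ))) t
      = ex (-∑ i, μ i * (s i : ℤ) * (l i : ℤ)) t := by
    intro l
    simp only [ex, ← Complex.exp_sum]
    congr 1
    push_cast
    rw [← Finset.sum_neg_distrib, Finset.mul_sum]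
  rw [chi, Finset.prod_congr rfl fun j _ => hpow j, Finset.prod_univ_sum, Finset.mul_sum,
    gmIncrement]
  refine Finset.sum_congr rfl fun l _ => ?_
  have hm : ∏ i, (-1 : ℂ) ^ l i * ((d i).choose (l i) : ℂ)
        * ex (-(μ i * (s i : ℤ) * (l i : ℤ))) t
      = (∏ i, (-1 : ℂ) ^ l i * ((d i).choose (l i) : ℂ))
        * ∏ i, ex (-(μ i * (s i : ℤ) * (l i : ℤ))) t := Finset.prod_mul_distrib
  rw [hm, hprod, sub_eq_add_neg, ex_add, zsmul_eq_mul]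
  push_cast
  ring

lemma exists_norm_chi_le : ∃ C : ℝ, ∀ t, ‖chi d s μ t‖ ≤ C := by
  refine ⟨∏ j, 2 ^ d j, fun t => ?_⟩
  rw [chi, norm_prod]
  refine Finset.prod_le_prod (fun _ _ => norm_nonneg _) fun j _ => ?_
  rw [norm_pow]
  refine pow_le_pow_left₀ (norm_nonneg _) ((norm_sub_le _ _).trans ?_) _
  have : -(Complex.I * (t : ℂ) * (μ j : ℂ) * (s j : ℂ))
      = ((-(t * μ j * s j) : ℝ) : ℂ) * Complex.I := by push_cast; ring
  rw [this, Complex.norm_exp_ofReal_mul_I, norm_one]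
  norm_num

lemma continuous_chi : Continuous (chi d s μ) := by unfold chi; fun_prop

lemma continuous_beta : Continuous (beta d s) := by unfold beta; fun_prop

lemma memLp_chi_mul {u : ℝ → ℂ} {p : ENNReal} (hu : MemLp u p nu) :
    MemLp (fun t => chi d s μ t * u t) p nu := by
  obtain ⟨C, hC⟩ := exists_norm_chi_le d s μ
  refine MemLp.of_le_mul (c := C) hu
    ((continuous_chi d s μ).aestronglyMeasurable.mul hu.1) (ae_of_all _ fun t => ?_)
  rw [norm_mul]
  exact mul_le_mul_of_nonneg_right (hC t) (norm_nonneg _)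

lemma ae_of_countable {S : Set ℝ} (hS : S.Countable) : ∀ᵐ t ∂nu, t ∉ S := by
  rw [ae_nu]
  exact ae_restrict_of_ae (measure_eq_zero_iff_ae_notMem.1 (hS.measure_zero volume))

lemma chi_ne_zero (hs : ∀ i, 0 < s i) (hμ : ∀ i, μ i ≠ 0) : ∀ᵐ t ∂nu, chi d s μ t ≠ 0 := by
  have h : ∀ j, ∀ᵐ t ∂nu,
      t ∉ Set.range fun k : ℤ => -(k * (2 * Real.pi)) / ((μ j : ℝ) * (s j : ℝ)) :=
    fun j => ae_of_countable (Set.countable_range _)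
  filter_upwards [ae_all_iff.2 h] with t ht
  refine Finset.prod_ne_zero_iff.2 fun j _ => pow_ne_zero _ fun h0 => ht j ?_
  rw [sub_eq_zero, eq_comm, Complex.exp_eq_one_iff] at h0
  obtain ⟨k, hk⟩ := h0
  have h2 : ((μ j : ℝ) * (s j : ℝ)) ≠ 0 :=
    mul_ne_zero (by exact_mod_cast hμ j) (by exact_mod_cast (hs j).ne')
  refine ⟨k, ?_⟩
  have h3 : Complex.I * ((t * (μ j : ℝ) * (s j : ℝ) : ℝ) : ℂ)
      = Complex.I * ((-(k * (2 * Real.pi)) : ℝ) : ℂ) := by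
    push_cast
    linear_combination -hk
  have h4 := Complex.ofReal_injective (mul_left_cancel₀ Complex.I_ne_zero h3)
  simp only
  rw [← h4, mul_assoc, mul_div_assoc, div_self h2, mul_one]

lemma beta_ne_zero : ∀ᵐ t ∂nu, beta d s t ≠ 0 := by
  have h : ∀ j, ∀ᵐ t ∂nu, t ∉ Set.range fun k : ℤ => 2 * Real.pi * k / (s j : ℝ) :=
    fun j => ae_of_countable (Set.countable_range _)
  filter_upwards [ae_all_iff.2 h] with t ht
  refine Finset.prod_ne_zero_iff.2 fun j _ => Finset.prod_ne_zero_iff.2 fun k _ =>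
    pow_ne_zero _ fun h0 => ht j ⟨k, ?_⟩
  have h3 : Complex.I * (t : ℂ) = Complex.I * ((2 * Real.pi * k / (s j : ℝ) : ℝ) : ℂ) := by
    push_cast
    linear_combination h0
  exact (Complex.ofReal_injective (mul_left_cancel₀ Complex.I_ne_zero h3)).symm

section

variable {T q : ℕ} {M : ℝ → Matrix (Fin T) (Fin q) ℂ}
  (hM : ∀ l j, MemLp (fun t => M t l j) 2 nu)
include hM

lemma v2_rowF_ex (n : ℤ) (l : Fin T) : V2 (rowF M (ex n) l) := fun j => memLp_ex_mul (hM l j) n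

lemma gmIncrement_vec (l : Fin T) (m : ℤ) :
    gmIncrement d s μ (fun n => vec (rowF M (ex n) l)) m
      = vec (rowF M (fun t => ex m t * chi d s μ t) l) := by
  rw [gmIncrement]
  simp_rw [← Int.cast_smul_eq_zsmul ℂ, ← vec_smul _ (v2_rowF_ex hM _ l)]
  rw [← vec_sum _ fun i _ => (v2_rowF_ex hM _ l).smul _]
  congr 1
  ext t j
  rw [Finset.sum_apply, Finset.sum_apply, rowF, ← gmIncrement_ex, gmIncrement, Finset.sum_mul]
  refine Finset.sum_congr rfl fun i _ => ?_
  rw [Pi.smul_apply, Pi.smul_apply, rowF, zsmul_eq_mul, smul_eq_mul, mul_assoc]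

end

/-- Gram matrices of the rows of `M` depend only on `M M*`, that is, on a density and not on the
chosen factor. -/
lemma inner_rowF {T q : ℕ} {M : ℝ → Matrix (Fin T) (Fin q) ℂ} {a b : ℝ → ℂ} {i j : Fin T}
    (ha : V2 (rowF M a i)) (hb : V2 (rowF M b j)) :
    inner ℂ (vec (rowF M a i)) (vec (rowF M b j))
      = ∫ t, star (a t) * b t * (M t * (M t).conjTranspose) j i ∂nu := by
  rw [inner_vec ha hb]
  congr 1; ext t
  rw [Matrix.mul_apply, Finset.mul_sum]
  refine Finset.sum_congr rfl fun p _ => ?_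
  rw [rowF, rowF, star_mul', Matrix.conjTranspose_apply]; ring

end Increments

/-! ### Spectral isometries of the noise and of the observations. -/

section Stochastic

variable {Ω : Type*} [MeasurableSpace Ω] {P : Measure Ω}

lemma NoiseFactorization.memLp {T q : ℕ} {g : ℝ → Matrix (Fin T) (Fin T) ℂ}
    {φ : ℕ → Matrix (Fin T) (Fin q) ℂ} {Φ : ℝ → Matrix (Fin T) (Fin q) ℂ}
    (hΦ : NoiseFactorization g φ Φ) (i : Fin T) (j : Fin q) : MemLp (fun t => Φ t i j) 2 nu :=
  ((isCausalSeries_iff _ _).1 (hΦ.series i j)).1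

/-- The spectral isometry of the noise. -/
lemma exists_noise_isometry {T q : ℕ} {g : ℝ → Matrix (Fin T) (Fin T) ℂ}
    {φ : ℕ → Matrix (Fin T) (Fin q) ℂ} {Φ : ℝ → Matrix (Fin T) (Fin q) ℂ}
    (hΦ : NoiseFactorization g φ Φ) {y : ℤ → Fin T → Lp ℂ 2 P} (hg : HasSpectralDensity P y g) :
    ∃ J : LL q →L[ℂ] Lp ℂ 2 P, (∀ m p, J (vec (rowF Φ (ex m) p)) = y m p) ∧
      ∀ a ∈ (Submodule.span ℂ (Set.range fun i : ℤ × Fin T =>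
          vec (rowF Φ (ex i.1) i.2))).topologicalClosure,
      ∀ b ∈ (Submodule.span ℂ (Set.range fun i : ℤ × Fin T =>
          vec (rowF Φ (ex i.1) i.2))).topologicalClosure,
        inner ℂ (J a) (J b) = inner ℂ a b := by
  obtain ⟨J, h1, h2⟩ := exists_isometry_of_gram
    (fun i : ℤ × Fin T => vec (rowF Φ (ex i.1) i.2)) (fun i => y i.1 i.2) (by
    rintro ⟨k, j⟩ ⟨m, i⟩
    rw [inner_rowF (v2_rowF_ex hΦ.memLp _ _) (v2_rowF_ex hΦ.memLp _ _), hg.corr,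
      ← integral_nu_complex]
    refine integral_congr_ae ?_
    filter_upwards [ae_nu_iff.2 hΦ.factor] with t ht
    rw [← ht, star_ex, ← ex_add, neg_add_eq_sub]; rfl)
  exact ⟨J, fun m p => h1 (m, p), h2⟩

lemma gmIncrement_noise {r T q : ℕ} (d s : Fin r → ℕ) (μ : Fin r → ℤ)
    {Φ : ℝ → Matrix (Fin T) (Fin q) ℂ} (hΦ : ∀ i j, MemLp (fun t => Φ t i j) 2 nu)
    {y : ℤ → Fin T → Lp ℂ 2 P} {J : LL q →L[ℂ] Lp ℂ 2 P}
    (hJ : ∀ m p, J (vec (rowF Φ (ex m) p)) = y m p) (l : Fin T) (m : ℤ) :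
    gmIncrement d s μ (fun n => y n l) m
      = J (vec (rowF Φ (fun t => ex m t * chi d s μ t) l)) := by
  rw [← gmIncrement_vec d s μ hΦ]
  simp_rw [← hJ]
  exact gmIncrement_map d s μ (J : LL q →+ Lp ℂ 2 P) _ m

/-- Needed because the noise isometry preserves inner products only on the closed span of the
shifted rows of `Φ`, which need not be everything. -/
lemma rowF_chi_mem_closure {r T q : ℕ} (d s : Fin r → ℕ) (μ : Fin r → ℤ)
    {Φ : ℝ → Matrix (Fin T) (Fin q) ℂ} (hΦ : ∀ i j, MemLp (fun t => Φ t i j) 2 nu)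
    (l : Fin T) (m : ℤ) :
    vec (rowF Φ (fun t => ex m t * chi d s μ t) l) ∈ (Submodule.span ℂ
      (Set.range fun i : ℤ × Fin T => vec (rowF Φ (ex i.1) i.2))).topologicalClosure := by
  rw [← gmIncrement_vec d s μ hΦ]
  exact Submodule.sum_mem _ fun i _ => zsmul_mem (Submodule.le_topologicalClosure _
    (Submodule.subset_span (Set.mem_range_self
      (f := fun i : ℤ × Fin T => vec (rowF Φ (ex i.1) i.2)) (_, l)))) _

lemma ObsFactorization.memLp {r T q : ℕ} {d s : Fin r → ℕ} {μ : Fin r → ℤ}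
    {p : ℝ → Matrix (Fin T) (Fin T) ℂ}
    {θ : ℕ → Matrix (Fin T) (Fin q) ℂ} {Θ : ℝ → Matrix (Fin T) (Fin q) ℂ}
    {ψ : ℕ → Matrix (Fin q) (Fin T) ℂ} {Ψ : ℝ → Matrix (Fin q) (Fin T) ℂ}
    (h : ObsFactorization d s μ p θ Θ ψ Ψ) (i : Fin T) (j : Fin q) :
    MemLp (fun t => Θ t i j) 2 nu :=
  ((isCausalSeries_iff _ _).1 (h.seriesΘ i j)).1

/-- The increments of the observed sequence have the spectral factor `Θ`. -/
lemma inner_increment {r T q q' : ℕ} {d s : Fin r → ℕ} {μ : Fin r → ℤ}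
    (hadm : AdmissibleStep μ) {f g : ℝ → Matrix (Fin T) (Fin T) ℂ}
    {x y : ℤ → Fin T → Lp ℂ 2 P} (hf : HasGMSpectralDensity P d s x f)
    (hg : HasSpectralDensity P y g) (hxy : ∀ m k i j, inner ℂ (y k j) (x m i) = 0)
    {θ : ℕ → Matrix (Fin T) (Fin q) ℂ} {Θ : ℝ → Matrix (Fin T) (Fin q) ℂ}
    {ψ : ℕ → Matrix (Fin q) (Fin T) ℂ} {Ψ : ℝ → Matrix (Fin q) (Fin T) ℂ}
    {φ : ℕ → Matrix (Fin T) (Fin q') ℂ} {Φ : ℝ → Matrix (Fin T) (Fin q') ℂ}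
    (hΘ : ObsFactorization d s μ (obsDensity d s f g) θ Θ ψ Ψ) (hΦ : NoiseFactorization g φ Φ)
    (k m : ℤ) (j i : Fin T) :
    inner ℂ (gmIncrement d s μ (fun n => x n j + y n j) k)
        (gmIncrement d s μ (fun n => x n i + y n i) m)
      = inner ℂ (vec (rowF Θ (ex k) j)) (vec (rowF Θ (ex m) i)) := by
  obtain ⟨J, hJ, hJi⟩ := exists_noise_isometry hΦ hg
  have hcross : ∀ i j k m, inner ℂ (gmIncrement d s μ (fun n => y n j) k)
      (gmIncrement d s μ (fun n => x n i) m) = 0 := fun i j k m => by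
    simp only [gmIncrement, sum_inner, inner_sum, ← Int.cast_smul_eq_zsmul ℂ, inner_smul_left,
      inner_smul_right, hxy, mul_zero, Finset.sum_const_zero]
  have hcross' : ∀ i j k m, inner ℂ (gmIncrement d s μ (fun n => x n j) k)
      (gmIncrement d s μ (fun n => y n i) m) = 0 := fun i j k m => by
    rw [← inner_conj_symm, hcross, map_zero]
  have hchiv : ∀ m l, V2 (rowF Φ (fun t => ex m t * chi d s μ t) l) := fun m l p => by
    have := memLp_ex_mul (memLp_chi_mul d s μ (hΦ.memLp l p)) m
    simpa only [rowF, mul_assoc] using this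
  rw [gmIncrement_add, gmIncrement_add, inner_add_left, inner_add_right, inner_add_right, hcross,
    hcross', zero_add, add_zero, hf.corr μ μ hadm hadm, ← integral_nu_complex,
    gmIncrement_noise d s μ hΦ.memLp hJ, gmIncrement_noise d s μ hΦ.memLp hJ,
    hJi _ (rowF_chi_mem_closure d s μ hΦ.memLp _ _) _ (rowF_chi_mem_closure d s μ hΦ.memLp _ _),
    inner_rowF (hchiv _ _) (hchiv _ _),
    inner_rowF (v2_rowF_ex hΘ.memLp _ _) (v2_rowF_ex hΘ.memLp _ _)]
  have hΘΘ : Integrable (fun t => ex (m - k) t * (Θ t * (Θ t).conjTranspose) i j) nu := by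
    refine integrable_ex_mul ?_ _
    simp only [Matrix.mul_apply, Matrix.conjTranspose_apply]
    exact integrable_finsetSum _ fun p _ =>
      (hΘ.memLp i p).integrable_mul (memLp_star (hΘ.memLp j p))
  have hΦΦ : Integrable (fun t => star (ex k t * chi d s μ t) * (ex m t * chi d s μ t)
      * (Φ t * (Φ t).conjTranspose) i j) nu := by
    have : Integrable (fun t => ∑ p, star (rowF Φ (fun t => ex k t * chi d s μ t) j t p)
        * rowF Φ (fun t => ex m t * chi d s μ t) i t p) nu :=
      integrable_inner_vec (hchiv _ _) (hchiv _ _)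
    refine this.congr (ae_of_all _ fun t => ?_)
    simp only [rowF, Matrix.mul_apply, Matrix.conjTranspose_apply, Finset.mul_sum]
    refine Finset.sum_congr rfl fun p _ => ?_
    simp only [star_mul']
    ring
  -- The factorization is solved for the signal term: `|χ|² |β|⁻² f = Θ Θ* - |χ|² Φ Φ*`. The
  -- subtracted term is the contribution of the noise increments.
  have hpt : ∀ᵐ t : ℝ ∂nu, Complex.exp (Complex.I * (t : ℂ) * ((m - k : ℤ) : ℂ))
          * chi d s μ t * star (chi d s μ t) / ((‖beta d s t‖ ^ 2 : ℝ) : ℂ) * f t i j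
      = ex (m - k) t * (Θ t * (Θ t).conjTranspose) i j
        - star (ex k t * chi d s μ t) * (ex m t * chi d s μ t)
          * (Φ t * (Φ t).conjTranspose) i j := by
    filter_upwards [ae_nu_iff.2 hΘ.factorΘ, ae_nu_iff.2 hΦ.factor, beta_ne_zero d s]
      with t h1 h2 h3
    rw [← h1, ← h2]
    have h4 : ((‖beta d s t‖ : ℝ) : ℂ) ≠ 0 := by simpa using h3
    have h5 : chi d s μ t * star (chi d s μ t) = (‖chi d s μ t‖ : ℂ) ^ 2 :=
      Complex.mul_conj' _
    change ex (m - k) t * _ * _ / _ * _ = _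
    rw [Matrix.smul_apply, obsDensity, Matrix.add_apply, Matrix.smul_apply, star_mul', star_ex,
      mul_assoc (ex (m - k) t), h5, sub_eq_add_neg m k, ex_add]
    simp only [smul_eq_mul]
    push_cast
    have h6 : ex (-k) t * star (chi d s μ t) * (ex m t * chi d s μ t)
        = ex m t * ex (-k) t * (‖chi d s μ t‖ : ℂ) ^ 2 := by rw [← h5]; ring
    rw [h6]
    field_simp
    ring
  rw [integral_congr_ae hpt, integral_sub hΘΘ hΦΦ, sub_add_cancel]
  congr 1; ext t
  rw [star_ex, ← ex_add, neg_add_eq_sub]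

/-- The observation space in terms of the block increments. -/
lemma obsSpace_eq {r T : ℕ} (hT : 0 < T) (d s : Fin r → ℕ) (μ : Fin r → ℤ) (ζ : ℤ → Lp ℂ 2 P) :
    obsSpace T d s μ ζ = (Submodule.span ℂ (Set.range fun i : ℕ × Fin T =>
      gmIncrement d s μ (fun n => blockVec T ζ n i.2) (-(i.1 : ℤ)))).topologicalClosure := by
  -- A time step `μ T s` at `m T - l` stays in the component `l` and moves the block number by `μ
  -- s`.
  have key : ∀ (m : ℤ) (l : Fin T), gmIncrement d (fun i => T * s i) μ ζ (m * (T : ℤ) - (l : ℤ))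
      = gmIncrement d s μ (fun n => blockVec T ζ n l) m := fun m l => by
    simp only [gmIncrement, blockVec]
    refine Finset.sum_congr rfl fun k _ => ?_
    congr 2
    rw [sub_mul, Finset.sum_mul, sub_right_comm]
    congr 2
    refine Finset.sum_congr rfl fun i _ => ?_
    push_cast; ring
  rw [obsSpace]
  congr 3
  ext x
  simp only [Prod.exists]
  constructor
  · rintro ⟨m, hm, rfl⟩
    obtain ⟨n, rfl⟩ := Int.exists_eq_neg_ofNat hm
    -- The time `-n` lies in the block `-(n / T)`, in the component with index `n % T`.
    refine ⟨n / T, ⟨n % T, Nat.mod_lt _ hT⟩, ?_⟩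
    rw [← key]
    congr 1
    have : (n : ℤ) = (T : ℤ) * ((n / T : ℕ) : ℤ) + ((n % T : ℕ) : ℤ) := by
      exact_mod_cast (Nat.div_add_mod n T).symm
    rw [this]; ring
  · rintro ⟨k, l, rfl⟩
    refine ⟨-(k : ℤ) * (T : ℤ) - (l : ℤ), ?_, (key _ _).symm⟩
    have : 0 ≤ (k : ℤ) * (T : ℤ) := by positivity
    have : (0 : ℤ) ≤ ((l : ℕ) : ℤ) := by positivity
    linarith

end Stochastic

/-! ### The space `L₂(p)` and stochastic integrals. -/

/-- The function `γ(t) Θ(t)ᵀ h(t)`: the image of `h ∈ L₂(|γ|² Θ Θ*)` in `L²`. -/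
def imgF {T q : ℕ} (γ : ℝ → ℂ) (Θ : ℝ → Matrix (Fin T) (Fin q) ℂ) (h : ℝ → Fin T → ℂ) (t : ℝ)
    (j : Fin q) : ℂ := γ t * ∑ l, h t l * Θ t l j

/-- `Θ` and `γ` provide the factorization `p = |γ|² Θ Θ*` with the left inverse `Ψ` of `Θ`. -/
structure WeightedFactor {T q : ℕ} (p : ℝ → Matrix (Fin T) (Fin T) ℂ) (γ : ℝ → ℂ)
    (Θ : ℝ → Matrix (Fin T) (Fin q) ℂ) (Ψ : ℝ → Matrix (Fin q) (Fin T) ℂ) : Prop where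
  factor : ∀ᵐ t ∂nu, p t = ((‖γ t‖ ^ 2 : ℝ) : ℂ) • (Θ t * (Θ t).conjTranspose)
  ne_zero : ∀ᵐ t ∂nu, γ t ≠ 0
  meas : AEStronglyMeasurable γ nu
  memLp : ∀ l j, MemLp (fun t => Θ t l j) 2 nu
  memLp_mul : ∀ l j, MemLp (fun t => γ t * Θ t l j) 2 nu
  left_inv : ∀ᵐ t ∂nu, Ψ t * Θ t = 1
  right_inv : ∀ᵐ t ∂nu, Θ t * Ψ t = 1

lemma imgF_add {T q : ℕ} (γ : ℝ → ℂ) (Θ : ℝ → Matrix (Fin T) (Fin q) ℂ)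
    (h h' : ℝ → Fin T → ℂ) : imgF γ Θ (fun t => h t + h' t) = imgF γ Θ h + imgF γ Θ h' := by
  ext t j
  simp only [imgF, Pi.add_apply, add_mul, Finset.sum_add_distrib, mul_add]

lemma imgF_sub {T q : ℕ} (γ : ℝ → ℂ) (Θ : ℝ → Matrix (Fin T) (Fin q) ℂ)
    (h h' : ℝ → Fin T → ℂ) : imgF γ Θ (fun t => h t - h' t) = imgF γ Θ h - imgF γ Θ h' := by
  ext t j
  simp only [imgF, Pi.sub_apply, sub_mul, Finset.sum_sub_distrib, mul_sub]

lemma lt_ofReal_of_norm {x : ℝ} {ε : ℝ} (hε : 0 < ε) (hx0 : 0 ≤ x)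
    (hx : x < Real.sqrt (ε / (2 * Real.pi))) :
    ENNReal.ofReal (2 * Real.pi) * ENNReal.ofReal x ^ 2 < ENNReal.ofReal ε := by
  have hpi := Real.pi_pos
  rw [← ENNReal.ofReal_pow hx0, ← ENNReal.ofReal_mul (by positivity)]
  refine (ENNReal.ofReal_lt_ofReal_iff hε).2 ?_
  rw [Real.lt_sqrt hx0, lt_div_iff₀ (by positivity)] at hx
  linarith

lemma ae_mul_ae {T q : ℕ} {f g : ℝ → Fin T → ℂ} (γ : ℝ → ℂ) (Θ : ℝ → Matrix (Fin T) (Fin q) ℂ)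
    (h : ∀ᵐ t ∂nu, f t = g t) : ∀ᵐ t ∂nu, imgF γ Θ f t = imgF γ Θ g t := by
  filter_upwards [h] with t ht
  ext j
  simp only [imgF, ht]

section

variable {T q : ℕ} {p : ℝ → Matrix (Fin T) (Fin T) ℂ} {γ : ℝ → ℂ}
  {Θ : ℝ → Matrix (Fin T) (Fin q) ℂ} {Ψ : ℝ → Matrix (Fin q) (Fin T) ℂ}
  (W : WeightedFactor p γ Θ Ψ)
include W

/-- Pointwise `hᵀ p conj h = |γ Θᵀ h|²` because `p = |γ|² Θ Θ*`. So `imgF` embeds `L₂(p)`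
isometrically, up to the factor `2π`, into `L²`. -/
lemma sqNormL2_eq_lintegral (h : ℝ → Fin T → ℂ) :
    sqNormL2 p h = ∫⁻ t, ENNReal.ofReal (∑ j, ‖imgF γ Θ h t j‖ ^ 2) ∂circ := by
  rw [sqNormL2]
  refine lintegral_congr_ae ?_
  filter_upwards [ae_nu_iff.1 W.factor] with t ht
  congr 1
  have h1 : dotProduct (h t) ((p t).mulVec (star (h t)))
      = ∑ j, imgF γ Θ h t j * star (imgF γ Θ h t j) := by
    rw [ht]
    simp only [dotProduct, Matrix.mulVec, Matrix.smul_apply, Matrix.mul_apply,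
      Matrix.conjTranspose_apply, imgF, star_mul', star_sum, smul_eq_mul, Pi.star_apply]
    have h2 : ((‖γ t‖ ^ 2 : ℝ) : ℂ) = γ t * star (γ t) := by
      push_cast; exact (Complex.mul_conj' _).symm
    rw [h2]
    have h3 : ∀ j, γ t * (∑ l, h t l * Θ t l j) * (star (γ t) * ∑ l, star (h t l) * star (Θ t l j))
        = ∑ x, ∑ y, γ t * star (γ t) * (h t x * Θ t x j * (star (h t y) * star (Θ t y j))) :=
      fun j => by
        rw [mul_mul_mul_comm, Finset.sum_mul_sum, Finset.mul_sum]
        simp_rw [Finset.mul_sum]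
    simp_rw [h3]
    rw [Finset.sum_comm]
    refine Finset.sum_congr rfl fun x _ => ?_
    rw [Finset.mul_sum, Finset.sum_comm]
    refine Finset.sum_congr rfl fun y _ => ?_
    rw [Finset.mul_sum, Finset.sum_mul, Finset.mul_sum]
    refine Finset.sum_congr rfl fun j _ => ?_
    ring
  rw [h1, Complex.re_sum]
  refine Finset.sum_congr rfl fun j _ => ?_
  rw [RCLike.star_def, Complex.mul_conj']
  exact_mod_cast Complex.ofReal_re _

lemma sqNormL2_eq {h : ℝ → Fin T → ℂ} (hv : V2 (imgF γ Θ h)) :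
    sqNormL2 p h = ENNReal.ofReal (2 * Real.pi) * ENNReal.ofReal ‖vec (imgF γ Θ h)‖ ^ 2 := by
  rw [sqNormL2_eq_lintegral W, ofReal_norm, enorm_sq_vec hv, lintegral_nu, ← mul_assoc,
    ← ENNReal.ofReal_mul (by positivity), mul_one_div_cancel (by positivity), ENNReal.ofReal_one,
    one_mul]

lemma v2_imgF_of_lt_top {h : ℝ → Fin T → ℂ} (hm : AEMeasurable h circ)
    (hlt : sqNormL2 p h < ⊤) : V2 (imgF γ Θ h) := by
  refine v2_of_lintegral (fun j => ?_) ?_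
  · refine W.meas.mul ?_
    refine Finset.aestronglyMeasurable_fun_sum _ fun l _ => ?_
    refine AEStronglyMeasurable.mul ?_ (W.memLp l j).1
    exact aestronglyMeasurable_nu_iff.2
      ((measurable_pi_apply l).comp_aemeasurable hm).aestronglyMeasurable
  · rw [lintegral_nu, ← sqNormL2_eq_lintegral W]
    exact ENNReal.mul_lt_top ENNReal.ofReal_lt_top hlt

lemma v2_rowF_indicator (a b : ℝ) (l : Fin T) :
    V2 (rowF Θ ((Set.Ico a b).indicator γ) l) := fun j => by
  have := (W.memLp_mul l j).indicator (measurableSet_Ico (a := a) (b := b))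
  refine this.ae_eq (ae_of_all _ fun t => ?_)
  by_cases ht : t ∈ Set.Ico a b <;> simp [rowF, ht]

omit W in
lemma imgF_step {n : ℕ} (u v : Fin n → ℝ) (c : Fin n → Fin T → ℂ) :
    imgF γ Θ (fun t => ∑ i, (Set.Ico (u i) (v i)).indicator (fun _ => c i) t)
      = ∑ i, ∑ l, c i l • rowF Θ ((Set.Ico (u i) (v i)).indicator γ) l := by
  ext t j
  simp only [imgF, Finset.sum_apply, Pi.smul_apply, rowF, smul_eq_mul, Finset.sum_mul,
    Finset.mul_sum]
  rw [Finset.sum_comm]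
  refine Finset.sum_congr rfl fun i _ => Finset.sum_congr rfl fun l _ => ?_
  by_cases ht : t ∈ Set.Ico (u i) (v i)
  · simp only [Set.indicator_of_mem ht]; ring
  · simp only [Set.indicator_of_notMem ht]; simp

lemma v2_step {n : ℕ} (u v : Fin n → ℝ) (c : Fin n → Fin T → ℂ) :
    V2 (imgF γ Θ (fun t => ∑ i, (Set.Ico (u i) (v i)).indicator (fun _ => c i) t)) := by
  rw [imgF_step]
  exact V2.sum _ fun i _ => V2.sum _ fun l _ => (v2_rowF_indicator W _ _ l).smul _

lemma vec_step {n : ℕ} (u v : Fin n → ℝ) (c : Fin n → Fin T → ℂ) :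
    vec (imgF γ Θ (fun t => ∑ i, (Set.Ico (u i) (v i)).indicator (fun _ => c i) t))
      = ∑ i, ∑ l, c i l • vec (rowF Θ ((Set.Ico (u i) (v i)).indicator γ) l) := by
  rw [imgF_step, vec_sum _ fun i _ => V2.sum _ fun l _ => (v2_rowF_indicator W _ _ l).smul _]
  refine Finset.sum_congr rfl fun i _ => ?_
  rw [vec_sum _ fun l _ => (v2_rowF_indicator W _ _ l).smul _]
  exact Finset.sum_congr rfl fun l _ => vec_smul _ (v2_rowF_indicator W _ _ l)

lemma exists_step_near (x : LL q) {δ : ℝ} (hδ : 0 < δ) :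
    ∃ (n : ℕ) (u v : Fin n → ℝ) (c : Fin n → Fin T → ℂ),
      (∀ i, -Real.pi ≤ u i ∧ u i ≤ v i ∧ v i ≤ Real.pi) ∧
      ‖x - vec (imgF γ Θ (fun t => ∑ i, (Set.Ico (u i) (v i)).indicator (fun _ => c i) t))‖
        < δ := by
  have hd := dense_rowF_step W.left_inv W.ne_zero W.memLp_mul
  have hx : x ∈ (⊤ : Submodule ℂ (LL q)) := trivial
  rw [← hd, ← SetLike.mem_coe, Submodule.topologicalClosure_coe, Metric.mem_closure_iff] at hx
  obtain ⟨y, hy, hxy⟩ := hx δ hδ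
  obtain ⟨c, rfl⟩ := Finsupp.mem_span_range_iff_exists_finsupp.1 hy
  let e := c.support.equivFin
  refine ⟨c.support.card, fun i => (e.symm i).1.1.1.1, fun i => (e.symm i).1.1.1.2,
    fun i => Pi.single (e.symm i).1.2 (c (e.symm i).1), fun i => (e.symm i).1.1.2, ?_⟩
  have hsum : (c.sum fun i a => a • vec (rowF Θ ((Set.Ico i.1.1.1 i.1.1.2).indicator γ) i.2))
      = ∑ i, ∑ l, (Pi.single (e.symm i).1.2 (c (e.symm i).1) : Fin T → ℂ) l
        • vec (rowF Θ ((Set.Ico (e.symm i).1.1.1.1 (e.symm i).1.1.1.2).indicator γ) l) := by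
    rw [Finsupp.sum, ← Finset.sum_coe_sort c.support]
    refine (Fintype.sum_equiv e.symm _ _ fun i => ?_).symm
    rw [Finset.sum_eq_single (e.symm i).1.2]
    · simp
    · intro l _ hl; simp [hl]
    · simp
  rwa [vec_step W, ← hsum, ← dist_eq_norm]

lemma inner_step {u v u' v' : ℝ} (h1 : -Real.pi ≤ u) (h3 : v ≤ Real.pi) (i j : Fin T) :
    inner ℂ (vec (rowF Θ ((Set.Ico u' v').indicator γ) j))
        (vec (rowF Θ ((Set.Ico u v).indicator γ) i))
      = (1 / (2 * Real.pi) : ℂ) * ∫ t in Set.Ico u v ∩ Set.Ico u' v', p t i j := by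
  rw [inner_rowF (v2_rowF_indicator W _ _ _) (v2_rowF_indicator W _ _ _), integral_nu_complex]
  congr 1
  -- Bounding one of the two intervals suffices: the intersection lies in `[-π, π)`.
  have hsub : (Set.Ico u v ∩ Set.Ico u' v') ∩ Set.Ico (-Real.pi) Real.pi
      = Set.Ico u v ∩ Set.Ico u' v' :=
    Set.inter_eq_left.2 fun t ht => ⟨h1.trans ht.1.1, ht.1.2.trans_le h3⟩
  have hcirc : (volume : Measure ℝ).restrict (Set.Ico u v ∩ Set.Ico u' v')
      = circ.restrict (Set.Ico u v ∩ Set.Ico u' v') := by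
    rw [circ, Measure.restrict_restrict (measurableSet_Ico.inter measurableSet_Ico), hsub]
  rw [hcirc, ← integral_indicator (measurableSet_Ico.inter measurableSet_Ico)]
  refine integral_congr_ae ?_
  filter_upwards [ae_nu_iff.1 W.factor] with t ht
  by_cases hb : t ∈ Set.Ico u' v'
  · by_cases ha : t ∈ Set.Ico u v
    · have hab : t ∈ Set.Ico u v ∩ Set.Ico u' v' := ⟨ha, hb⟩
      rw [Set.indicator_of_mem ha, Set.indicator_of_mem hb, Set.indicator_of_mem hab, ht,
        Matrix.smul_apply, smul_eq_mul]
      congr 1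
      push_cast
      exact Complex.conj_mul' _
    · have hab : t ∉ Set.Ico u v ∩ Set.Ico u' v' := fun h => ha h.1
      rw [Set.indicator_of_notMem ha, Set.indicator_of_notMem hab, mul_zero, zero_mul]
  · have hab : t ∉ Set.Ico u v ∩ Set.Ico u' v' := fun h => hb h.2
    rw [Set.indicator_of_notMem hb, Set.indicator_of_notMem hab, star_zero, zero_mul, zero_mul]

variable {Ω : Type*} [MeasurableSpace Ω] {P : Measure Ω} {Z : ℝ → Fin T → Lp ℂ 2 P}
  {V : LL q →L[ℂ] Lp ℂ 2 P} (hV : ∀ a b, inner ℂ (V a) (V b) = inner ℂ a b)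
  (hZ : ∀ u v : ℝ, -Real.pi ≤ u → u ≤ v → v ≤ Real.pi → ∀ l,
    Z v l - Z u l = V (vec (rowF Θ ((Set.Ico u v).indicator γ) l)))

omit W in
include hV in
lemma norm_map_of_inner (a : LL q) : ‖V a‖ = ‖a‖ := by
  rw [@norm_eq_sqrt_re_inner ℂ, hV, ← @norm_eq_sqrt_re_inner ℂ]

include hV hZ

/-- The stochastic integral is the isometry `V` applied to the image of the integrand. -/
lemma isStochInt_iff (h : ℝ → Fin T → ℂ) (Y : Lp ℂ 2 P) : IsStochInt p Z h Y ↔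
    AEMeasurable h circ ∧ V2 (imgF γ Θ h) ∧ Y = V (vec (imgF γ Θ h)) := by
  have hstep : ∀ {n : ℕ} (u v : Fin n → ℝ) (c : Fin n → Fin T → ℂ),
      (∀ i, -Real.pi ≤ u i ∧ u i ≤ v i ∧ v i ≤ Real.pi) →
      ∑ i, ∑ l, c i l • (Z (v i) l - Z (u i) l)
      = V (vec (imgF γ Θ (fun t => ∑ i, (Set.Ico (u i) (v i)).indicator (fun _ => c i) t))) := by
    intro n u v c huv
    rw [vec_step W, map_sum]
    refine Finset.sum_congr rfl fun i _ => ?_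
    rw [map_sum]
    refine Finset.sum_congr rfl fun l _ => ?_
    rw [map_smul, hZ _ _ (huv i).1 (huv i).2.1 (huv i).2.2]
  have hsm : ∀ {n : ℕ} (u v : Fin n → ℝ) (c : Fin n → Fin T → ℂ), Measurable
      fun t => ∑ i, (Set.Ico (u i) (v i)).indicator (fun _ => c i) t := fun u v c =>
    Finset.measurable_fun_sum _ fun i _ => measurable_const.indicator measurableSet_Ico
  constructor
  · rintro ⟨hm, hε⟩
    have hv2 : V2 (imgF γ Θ h) := by
      obtain ⟨n, u, v, c, huv, h1, -⟩ := hε 1 one_pos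
      have h2 := v2_imgF_of_lt_top W (hm.sub (hsm u v c).aemeasurable)
        (h1.trans ENNReal.ofReal_lt_top)
      have h3 := h2.add (v2_step W u v c)
      rw [← imgF_add] at h3
      simpa using h3
    refine ⟨hm, hv2, ?_⟩
    rw [← sub_eq_zero, ← norm_eq_zero]
    refine le_antisymm (le_of_forall_pos_lt_add fun δ hδ => ?_) (norm_nonneg _)
    -- The first bound controls the distance of the integrals. The second, divided by the
    -- normalization `2π` and after taking a root, places the images in `L²` within `δ / 2`.
    obtain ⟨n, u, v, c, huv, h1, h2⟩ := hε (min (δ / 2) (2 * Real.pi * (δ / 2) ^ 2))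
      (lt_min (by positivity) (by positivity))
    rw [hstep u v c huv] at h2
    have h3 : V2 (imgF γ Θ (fun t => h t
        - ∑ i, (Set.Ico (u i) (v i)).indicator (fun _ => c i) t)) := by
      rw [imgF_sub]; exact hv2.sub (v2_step W u v c)
    rw [sqNormL2_eq W h3, imgF_sub, vec_sub hv2 (v2_step W u v c)] at h1
    set x := vec (imgF γ Θ h)
    set y := vec (imgF γ Θ (fun t => ∑ i, (Set.Ico (u i) (v i)).indicator (fun _ => c i) t))
    have h4 : ‖x - y‖ < δ / 2 := by
      rw [← ENNReal.ofReal_pow (norm_nonneg _), ← ENNReal.ofReal_mul (by positivity)] at h1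
      have h5 := (ENNReal.ofReal_lt_ofReal_iff_of_nonneg (by positivity)).1 h1
      have h6 := lt_of_lt_of_le h5 (min_le_right _ _)
      have h7 := lt_of_mul_lt_mul_left h6 (by positivity)
      exact lt_of_pow_lt_pow_left₀ 2 (by positivity) h7
    calc ‖Y - V x‖ = ‖(Y - V y) - V (x - y)‖ := by rw [map_sub]; congr 1; abel
      _ ≤ ‖Y - V y‖ + ‖V (x - y)‖ := norm_sub_le _ _
      _ < δ / 2 + δ / 2 := by
        rw [norm_map_of_inner hV]
        exact add_lt_add (h2.trans_le (min_le_left _ _)) h4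
      _ = 0 + δ := by ring
  · rintro ⟨hm, hv2, rfl⟩
    refine ⟨hm, fun ε hε => ?_⟩
    have hpi := Real.pi_pos
    obtain ⟨n, u, v, c, huv, h1⟩ := exists_step_near W (vec (imgF γ Θ h))
      (δ := min ε (Real.sqrt (ε / (2 * Real.pi)))) (lt_min hε (Real.sqrt_pos.2 (by positivity)))
    refine ⟨n, u, v, c, huv, ?_, ?_⟩
    · have h3 : V2 (imgF γ Θ (fun t => h t
          - ∑ i, (Set.Ico (u i) (v i)).indicator (fun _ => c i) t)) := by
        rw [imgF_sub]; exact hv2.sub (v2_step W u v c)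
      rw [sqNormL2_eq W h3, imgF_sub, vec_sub hv2 (v2_step W u v c)]
      exact lt_ofReal_of_norm hε (norm_nonneg _) (h1.trans_le (min_le_right _ _))
    · rw [hstep u v c huv, ← map_sub, norm_map_of_inner hV]
      exact h1.trans_le (min_le_left _ _)

end

/-! ### Spectral processes and isometries of `L²`. -/

section

variable {r T q : ℕ} {d s : Fin r → ℕ} {μ : Fin r → ℤ} {p : ℝ → Matrix (Fin T) (Fin T) ℂ}
  {Θ : ℝ → Matrix (Fin T) (Fin q) ℂ} {Ψ : ℝ → Matrix (Fin q) (Fin T) ℂ}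
  (W : WeightedFactor p (fun t => beta d s t / chi d s μ t) Θ Ψ)
  {Ω : Type*} [MeasurableSpace Ω] {P : Measure Ω} {X : ℤ → Fin T → Lp ℂ 2 P}

/-- The weight `γ = β / χ`. -/
abbrev gam {r : ℕ} (d s : Fin r → ℕ) (μ : Fin r → ℤ) (t : ℝ) : ℂ := beta d s t / chi d s μ t

lemma measurable_ratio : Measurable fun t => chi d s μ t / beta d s t :=
  (continuous_chi d s μ).measurable.div (continuous_beta d s).measurable

include W in
-- The weight `β / χ` cancels the factor `χ / β`. Thus the spectral representation of the increments
-- becomes `V (e^{imt} Θ_l) = X m l`.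
lemma imgF_repr (m : ℤ) (l : Fin T) : ∀ᵐ t ∂nu, rowF Θ (ex m) l t
    = imgF (gam d s μ) Θ (fun t => (Complex.exp (Complex.I * (t : ℂ) * (m : ℂ))
        * (chi d s μ t / beta d s t)) • (Pi.single l 1 : Fin T → ℂ)) t := by
  filter_upwards [W.ne_zero] with t ht
  ext j
  rw [imgF, rowF, Finset.sum_eq_single l]
  · have h1 : beta d s t ≠ 0 := fun h => ht (by rw [h, zero_div])
    have h2 : chi d s μ t ≠ 0 := fun h => ht (by rw [h, div_zero])
    simp only [gam, ex, Pi.smul_apply, Pi.single_eq_same, smul_eq_mul]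
    field_simp
  · intro i _ hi; simp [hi]
  · simp

lemma aemeasurable_repr (m : ℤ) (l : Fin T) :
    AEMeasurable (fun t : ℝ => (Complex.exp (Complex.I * (t : ℂ) * (m : ℂ))
        * (chi d s μ t / beta d s t)) • (Pi.single l 1 : Fin T → ℂ)) circ :=
  (((measurable_ex m).mul measurable_ratio).smul_const _).aemeasurable

include W in
/-- The spectral process constructed from an isometry. -/
lemma exists_spectralProcess {V : LL q →L[ℂ] Lp ℂ 2 P}
    (hV : ∀ a b, inner ℂ (V a) (V b) = inner ℂ a b)
    (hX : ∀ m l, V (vec (rowF Θ (ex m) l)) = X m l) :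
    ∃ Z : ℝ → Fin T → Lp ℂ 2 P, IsSpectralProcess d s μ p X Z := by
  set Z : ℝ → Fin T → Lp ℂ 2 P := fun u l =>
    V (vec (rowF Θ ((Set.Ico (-Real.pi) u).indicator (gam d s μ)) l)) with hZdef
  have hZ : ∀ u v : ℝ, -Real.pi ≤ u → u ≤ v → v ≤ Real.pi → ∀ l,
      Z v l - Z u l = V (vec (rowF Θ ((Set.Ico u v).indicator (gam d s μ)) l)) := by
    intro u v h1 h2 _ l
    rw [hZdef, ← map_sub, ← vec_sub (v2_rowF_indicator W _ _ l) (v2_rowF_indicator W _ _ l)]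
    congr 2
    ext t j
    simp only [Pi.sub_apply, rowF]
    rw [← sub_mul]
    congr 1
    by_cases ha : -Real.pi ≤ t <;> by_cases hb : t < u <;> by_cases hc : t < v <;>
      simp [Set.indicator, Set.mem_Ico, ha, hb, hc] <;> linarith
  refine ⟨Z, ⟨fun u v u' v' h1 h2 h3 h1' h2' h3' i j => ?_, fun m l => ?_⟩⟩
  · rw [hZ u v h1 h2 h3, hZ u' v' h1' h2' h3', hV, inner_step W h1 h3]
  · rw [isStochInt_iff W hV hZ]
    have hv := v2_rowF_ex W.memLp m l
    exact ⟨aemeasurable_repr m l, hv.congr (imgF_repr W m l), by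
      rw [← hX, vec_congr hv (imgF_repr W m l)]⟩

include W in
/-- Every spectral process comes from an isometry. -/
lemma IsSpectralProcess.exists_isometry {Z : ℝ → Fin T → Lp ℂ 2 P}
    (hZ : IsSpectralProcess d s μ p X Z) : ∃ V : LL q →L[ℂ] Lp ℂ 2 P,
      (∀ a b, inner ℂ (V a) (V b) = inner ℂ a b) ∧
      (∀ u v : ℝ, -Real.pi ≤ u → u ≤ v → v ≤ Real.pi → ∀ l,
        Z v l - Z u l = V (vec (rowF Θ ((Set.Ico u v).indicator (gam d s μ)) l))) ∧
      ∀ m l, V (vec (rowF Θ (ex m) l)) = X m l := by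
  obtain ⟨V, h1, h2⟩ := exists_isometry_of_gram
    (fun i : {p : ℝ × ℝ // -Real.pi ≤ p.1 ∧ p.1 ≤ p.2 ∧ p.2 ≤ Real.pi} × Fin T =>
      vec (rowF Θ ((Set.Ico i.1.1.1 i.1.1.2).indicator (gam d s μ)) i.2))
    (fun i => Z i.1.1.2 i.2 - Z i.1.1.1 i.2) (by
    rintro ⟨⟨⟨u', v'⟩, h1', h2', h3'⟩, j⟩ ⟨⟨⟨u, v⟩, h1, h2, h3⟩, i⟩
    simp only at *
    rw [hZ.increments u v u' v' h1 h2 h3 h1' h2' h3', inner_step W h1 h3])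
  -- The step functions times the rows of `γ Θ` are total, so the partial isometry is isometric on
  -- the whole space.
  have hV : ∀ a b, inner ℂ (V a) (V b) = inner ℂ a b := fun a b => by
    rw [dense_rowF_step W.left_inv W.ne_zero W.memLp_mul] at h2
    exact h2 a trivial b trivial
  have hZV : ∀ u v : ℝ, -Real.pi ≤ u → u ≤ v → v ≤ Real.pi → ∀ l,
      Z v l - Z u l = V (vec (rowF Θ ((Set.Ico u v).indicator (gam d s μ)) l)) :=
    fun u v a b c l => (h1 (⟨(u, v), a, b, c⟩, l)).symm
  refine ⟨V, hV, hZV, fun m l => ?_⟩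
  rw [((isStochInt_iff W hV hZV _ _).1 (hZ.repr m l)).2.2,
    vec_congr (v2_rowF_ex W.memLp m l) (imgF_repr W m l)]

include W in
lemma inL20_of_mem_closure {h : ℝ → Fin T → ℂ} (hm : AEMeasurable h circ)
    (hv : V2 (imgF (gam d s μ) Θ h))
    (hc : vec (imgF (gam d s μ) Θ h) ∈ (Submodule.span ℂ (Set.range fun i : ℕ × Fin T =>
      vec (rowF Θ (ex (-(i.1 : ℤ))) i.2))).topologicalClosure) : InL20 d s μ p h := by
  refine ⟨hm, fun ε hε => ?_⟩
  have hpi := Real.pi_pos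
  rw [← SetLike.mem_coe, Submodule.topologicalClosure_coe, Metric.mem_closure_iff] at hc
  obtain ⟨y, hy, hxy⟩ := hc (Real.sqrt (ε / (2 * Real.pi))) (Real.sqrt_pos.2 (by positivity))
  obtain ⟨c, rfl⟩ := Finsupp.mem_span_range_iff_exists_finsupp.1 hy
  -- One more than the largest time index in the finite combination, so that all its terms lie in
  -- the range of summation.
  set N := (c.support.sup fun i => i.1) + 1 with hN
  refine ⟨N, fun k l => c (k, l), ?_⟩
  have hsum : (c.sum fun i a => a • vec (rowF Θ (ex (-(i.1 : ℤ))) i.2))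
      = ∑ k ∈ Finset.range N, ∑ l, c (k, l) • vec (rowF Θ (ex (-(k : ℤ))) l) := by
    rw [← Finset.sum_product' (f := fun k l => c (k, l) • vec (rowF Θ (ex (-(k : ℤ))) l)),
      Finsupp.sum]
    refine Finset.sum_subset (fun i hi => ?_) fun i _ hi => ?_
    · simp only [Finset.mem_product, Finset.mem_range, Finset.mem_univ, and_true]
      have := Finset.le_sup (f := fun i : ℕ × Fin T => i.1) hi
      omega
    · rw [Finsupp.notMem_support_iff.1 hi, zero_smul]
  have hae : ∀ᵐ t ∂nu, (∑ k ∈ Finset.range N, ∑ l, c (k, l) • rowF Θ (ex (-(k : ℤ))) l) t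
      = imgF (gam d s μ) Θ (fun t => ∑ k ∈ Finset.range N,
        (Complex.exp (-(Complex.I * (t : ℂ) * (k : ℂ))) * (chi d s μ t / beta d s t))
          • fun l => c (k, l)) t := by
    filter_upwards [W.ne_zero] with t ht
    ext j
    have h1 : beta d s t ≠ 0 := fun h => ht (by rw [h, zero_div])
    have h2 : chi d s μ t ≠ 0 := fun h => ht (by rw [h, div_zero])
    simp only [imgF, Finset.sum_apply, Pi.smul_apply, smul_eq_mul, rowF, Finset.sum_mul,
      Finset.mul_sum]
    rw [Finset.sum_comm]
    refine Finset.sum_congr rfl fun l _ => Finset.sum_congr rfl fun k _ => ?_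
    rw [ex_neg_eq]
    simp only [gam]
    push_cast
    field_simp
  have hv1 : V2 (∑ k ∈ Finset.range N, ∑ l, c (k, l) • rowF Θ (ex (-(k : ℤ))) l) :=
    V2.sum _ fun k _ => V2.sum _ fun l _ => (v2_rowF_ex W.memLp _ l).smul _
  have hv2 := hv1.congr hae
  have hvec : vec (∑ k ∈ Finset.range N, ∑ l, c (k, l) • rowF Θ (ex (-(k : ℤ))) l)
      = ∑ k ∈ Finset.range N, ∑ l, c (k, l) • vec (rowF Θ (ex (-(k : ℤ))) l) := by
    rw [vec_sum _ fun k _ => V2.sum _ fun l _ => (v2_rowF_ex W.memLp _ l).smul _]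
    refine Finset.sum_congr rfl fun k _ => ?_
    rw [vec_sum _ fun l _ => (v2_rowF_ex W.memLp _ l).smul _]
    exact Finset.sum_congr rfl fun l _ => vec_smul _ (v2_rowF_ex W.memLp _ l)
  rw [hsum, ← hvec, vec_congr hv1 hae, dist_eq_norm, ← vec_sub hv hv2, ← imgF_sub] at hxy
  rw [sqNormL2_eq W (by rw [imgF_sub]; exact hv.sub hv2)]
  exact lt_ofReal_of_norm hε (norm_nonneg _) hxy

end

/-! ### The coefficients `a_{-μ}`. -/

/-- Extension of a one-sided sequence by zero. -/
def extZ {E : Type*} [Zero E] (a : ℕ → E) (k : ℤ) : E := if 0 ≤ k then a k.toNat else 0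

@[simp] lemma extZ_natCast {E : Type*} [Zero E] (a : ℕ → E) (k : ℕ) : extZ a (k : ℤ) = a k := by
  simp [extZ]

lemma extZ_neg {E : Type*} [Zero E] (a : ℕ → E) {k : ℤ} (hk : k < 0) : extZ a k = 0 :=
  if_neg (by omega)

lemma summable_extZ {a : ℕ → ℂ} (h : Summable fun k => ‖a k‖) :
    Summable fun k : ℤ => ‖extZ a k‖ := by
  obtain ⟨x, hx⟩ := h
  exact ⟨x, (hasSum_nat_of_int fun n hn => by rw [extZ_neg a hn, norm_zero]).1 (by simpa using hx)⟩

section Coefficients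

variable {r T : ℕ} (d s μ : Fin r → ℕ) (a : ℕ → Fin T → ℂ)

/-- Extending `a` by zero makes the truncation at `max m 0` superfluous; what remains is a
convolution over all integers. -/
lemma aMinus_eq (m : ℤ) : aMinus d s μ a m
    = ∑ j ∈ Finset.range (nGamma d s μ + 1), (eGamma d s μ j : ℂ) • extZ a (m + j) := by
  have h1 : aMinus d s μ a m = ∑ l ∈ Finset.Icc m (m + (nGamma d s μ : ℤ)),
      (eGamma d s μ (l - m).toNat : ℂ) • extZ a l := by
    rw [aMinus]
    refine Finset.sum_subset_zero_on_sdiff (fun l hl => ?_) (fun l hl => ?_) fun l hl => ?_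
    · simp only [Finset.mem_Icc, sup_le_iff] at hl ⊢; exact ⟨hl.1.1, hl.2⟩
    · simp only [Finset.mem_sdiff, Finset.mem_Icc, sup_le_iff] at hl
      rw [extZ_neg a (by by_contra! h; exact hl.2 ⟨⟨hl.1.1, h⟩, hl.1.2⟩), smul_zero]
    · simp only [Finset.mem_Icc, sup_le_iff] at hl
      rw [extZ, if_pos hl.1.2]
  rw [h1]
  refine Finset.sum_nbij' (fun l => (l - m).toNat) (fun j => m + (j : ℤ)) ?_ ?_ ?_ ?_ ?_
  · intro l hl; simp only [Finset.mem_Icc, Finset.mem_range] at *; omega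
  · intro j hj; simp only [Finset.mem_Icc, Finset.mem_range] at *; omega
  · intro l hl; simp only [Finset.mem_Icc] at *; omega
  · intro j hj; simp
  · intro l hl
    simp only [Finset.mem_Icc] at hl
    rw [Int.toNat_of_nonneg (by omega), add_sub_cancel]

lemma aMinus_eq_zero {m : ℤ} (hm : m + nGamma d s μ < 0) : aMinus d s μ a m = 0 := by
  rw [aMinus, Finset.Icc_eq_empty (by simp only [sup_le_iff]; omega), Finset.sum_empty]

lemma natDegree_gm_le :
    (∏ i, (1 - (Polynomial.X : Polynomial ℤ) ^ (μ i * s i)) ^ (d i)).natDegree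
      ≤ nGamma d s μ := by
  refine (Polynomial.natDegree_prod_le _ _).trans (Finset.sum_le_sum fun i _ => ?_)
  refine Polynomial.natDegree_pow_le.trans ?_
  rw [mul_comm]
  refine Nat.mul_le_mul_right _ ?_
  refine (Polynomial.natDegree_sub_le _ _).trans ?_
  simp

lemma chi_eq_sum (t : ℝ) : chi d s (fun i => (μ i : ℤ)) t
    = ∑ j ∈ Finset.range (nGamma d s μ + 1), (eGamma d s μ j : ℂ) * ex (-(j : ℤ)) t := by
  have h1 := Polynomial.aeval_eq_sum_range' (lt_of_le_of_lt (natDegree_gm_le d s μ)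
    (Nat.lt_succ_self _)) (Complex.exp (-(Complex.I * (t : ℂ))))
  have h2 : ∀ n : ℕ, Complex.exp (-(Complex.I * (t : ℂ))) ^ n = ex (-(n : ℤ)) t := fun n => by
    rw [← Complex.exp_nat_mul, ex_neg_eq]; congr 1; push_cast; ring
  have h3 : Polynomial.aeval (Complex.exp (-(Complex.I * (t : ℂ))))
      (∏ i, (1 - (Polynomial.X : Polynomial ℤ) ^ (μ i * s i)) ^ (d i))
      = chi d s (fun i => (μ i : ℤ)) t := by
    rw [map_prod, chi]
    refine Finset.prod_congr rfl fun i _ => ?_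
    rw [map_pow, map_sub, map_one, map_pow, Polynomial.aeval_X, h2, ex_neg_eq]
    congr 4
    push_cast; ring
  rw [← h3, h1]
  refine Finset.sum_congr rfl fun j _ => ?_
  rw [h2, zsmul_eq_mul]; rfl

lemma fser_add {α α' : ℤ → ℂ} (h : Summable fun k => ‖α k‖) (h' : Summable fun k => ‖α' k‖)
    (t : ℝ) : fser (fun k => α k + α' k) t = fser α t + fser α' t := by
  simp only [fser, add_mul]
  exact (summable_fser h t).tsum_add (summable_fser h' t)

variable {a} (ha : ∀ l, Summable fun k => ‖a k l‖)
include ha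

lemma summable_aMinus (l : Fin T) : Summable fun k : ℤ => ‖aMinus d s μ a k l‖ := by
  have hZ : Summable fun k : ℤ => ‖extZ a k l‖ := by
    refine (summable_extZ (ha l)).congr fun k => ?_
    simp only [extZ]; split_ifs <;> rfl
  have hsh : ∀ j : ℕ, Summable fun k : ℤ => ‖(eGamma d s μ j : ℂ) * extZ a (k + j) l‖ := fun j => by
    simp only [norm_mul]
    exact ((Equiv.addRight (j : ℤ)).summable_iff.2 hZ).mul_left _
  refine Summable.of_nonneg_of_le (fun _ => norm_nonneg _) (fun k => ?_)
    (summable_sum (s := Finset.range (nGamma d s μ + 1)) fun j _ => hsh j)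
  rw [aMinus_eq, Finset.sum_apply]
  exact norm_sum_le _ _

/-- Each term `e_γ(j) e^{ijt}` of `conj χ` lowers the index of `a` by `j`. The terms pushed below
zero are the ones collected in `bMinus`. -/
lemma star_chi_mul_fser (l : Fin T) (t : ℝ) :
    star (chi d s (fun i => (μ i : ℤ)) t) * fser (extZ fun k => a k l) t
      = fser (fun k => aMinus d s μ a k l) t := by
  have hZ := summable_fser (summable_extZ (ha l)) t
  have hsh : ∀ j : ℕ, HasSum
      (fun k : ℤ => (eGamma d s μ j : ℂ) * extZ (fun k => a k l) (k + j) * ex (-k) t)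
      ((eGamma d s μ j : ℂ) * ex j t * fser (extZ fun k => a k l) t) := fun j => by
    have h1 := ((Equiv.addRight (j : ℤ)).hasSum_iff.2 hZ.hasSum).mul_left
      ((eGamma d s μ j : ℂ) * ex j t)
    refine h1.congr_fun fun k => ?_
    simp only [Function.comp, Equiv.coe_addRight, neg_add, ex_add]
    have h2 : ex (j : ℤ) t * ex (-(j : ℤ)) t = 1 := by rw [← ex_add, add_neg_cancel, ex_zero]
    linear_combination -(eGamma d s μ j : ℂ) * extZ (fun k => a k l) (k + j) * ex (-k) t * h2
  have hs := hasSum_sum (s := Finset.range (nGamma d s μ + 1)) fun j _ => hsh j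
  rw [chi_eq_sum, star_sum, Finset.sum_mul]
  refine Eq.trans (Finset.sum_congr rfl fun j _ => ?_) (hs.tsum_eq.symm.trans ?_)
  · rw [star_mul', star_ex, neg_neg]; simp
  · rw [fser]
    congr 1; ext k
    rw [aMinus_eq, Finset.sum_apply, Finset.sum_mul]
    refine Finset.sum_congr rfl fun j _ => ?_
    simp only [Pi.smul_apply, smul_eq_mul, extZ]
    split_ifs <;> rfl

end Coefficients

/-! ### Fourier coefficients of `conj g · A`, `Φᵀ A` and `conj M · D`. -/

/-- The part of a two-sided sequence on the nonnegative half-line. -/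
def nonnegPart {T : ℕ} (α : ℤ → Fin T → ℂ) (k : ℤ) (l : Fin T) : ℂ := if 0 ≤ k then α k l else 0

/-- The part of a two-sided sequence on the negative half-line. -/
def negPart {T : ℕ} (α : ℤ → Fin T → ℂ) (k : ℤ) (l : Fin T) : ℂ := if 0 ≤ k then 0 else α k l

/-- The function `conj g · A` with `A = ∑ₖ α(k) e^{-ikt}`. -/
def densF {T : ℕ} (g : ℝ → Matrix (Fin T) (Fin T) ℂ) (α : ℤ → Fin T → ℂ) (t : ℝ) (i : Fin T) :
    ℂ := ∑ j, fser (fun k => α k j) t * star (g t i j)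

/-- The function `Φᵀ A` with `A = ∑ₖ α(k) e^{-ikt}`. -/
def factF {T q : ℕ} (Φ : ℝ → Matrix (Fin T) (Fin q) ℂ) (α : ℤ → Fin T → ℂ) (t : ℝ) (p : Fin q) :
    ℂ := ∑ j, fser (fun k => α k j) t * Φ t j p

/-- The function `conj M · D`. -/
def conjMul {a b : ℕ} (M : ℝ → Matrix (Fin a) (Fin b) ℂ) (D : ℝ → Fin b → ℂ) (t : ℝ)
    (i : Fin a) : ℂ := ∑ p, star (M t i p) * D t p

section Series

variable {T q : ℕ} {α : ℤ → Fin T → ℂ} (hα : ∀ l, Summable fun k => ‖α k l‖)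

include hα in
lemma summable_nonnegPart (l : Fin T) : Summable fun k => ‖nonnegPart α k l‖ :=
  Summable.of_nonneg_of_le (fun _ => norm_nonneg _) (fun k => by
    simp only [nonnegPart]; split_ifs <;> simp) (hα l)

include hα in
lemma summable_negPart (l : Fin T) : Summable fun k => ‖negPart α k l‖ :=
  Summable.of_nonneg_of_le (fun _ => norm_nonneg _) (fun k => by
    simp only [negPart]; split_ifs <;> simp) (hα l)

include hα in
lemma densF_add_parts (g : ℝ → Matrix (Fin T) (Fin T) ℂ) (t : ℝ) (i : Fin T) :
    densF g (nonnegPart α) t i + densF g (negPart α) t i = densF g α t i := by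
  simp only [densF, ← Finset.sum_add_distrib, ← add_mul]
  refine Finset.sum_congr rfl fun j _ => ?_
  rw [← fser_add (summable_nonnegPart hα j) (summable_negPart hα j)]
  congr 2; ext k
  simp only [nonnegPart, negPart]
  split_ifs <;> simp

lemma star_fourierMat (g : ℝ → Matrix (Fin T) (Fin T) ℂ) (n : ℤ) (i j : Fin T) :
    star (fourierMat g n i j) = co (fun t => star (g t i j)) n := by
  rw [co_star, fourierMat, ← integral_nu_complex, co]
  simp only [ex_neg_eq]

section

variable {g : ℝ → Matrix (Fin T) (Fin T) ℂ} (hg : ∀ i j, Integrable (fun t => g t i j) nu)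
include hα hg

lemma hasSum_densF (m : ℤ) : HasSum (fun k : ℤ => (conjMat (fourierMat g (m - k))).mulVec (α k))
    (fun i => co (fun t => densF g α t i) m) := by
  refine Pi.hasSum.2 fun i => ?_
  have hgs : ∀ i j, Integrable (fun t => star (g t i j)) nu := fun i j =>
    memLp_one_iff_integrable.1 (memLp_star (memLp_one_iff_integrable.2 (hg i j)))
  have h1 := hasSum_sum (s := Finset.univ) fun j _ => hasSum_co_fser_mul (hα j) (hgs i j) m
  rw [← co_sum _ fun j _ => memLp_one_iff_integrable.1
    (memLp_fser_mul (hα j) (memLp_one_iff_integrable.2 (hgs i j)))] at h1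
  refine h1.congr_fun fun k => ?_
  rw [Matrix.mulVec, dotProduct]
  refine Finset.sum_congr rfl fun j _ => ?_
  rw [conjMat, Matrix.map_apply, star_fourierMat, mul_comm]

lemma hasSum_densF_nonneg (h0 : ∀ k < 0, α k = 0) (m : ℤ) :
    HasSum (fun k : ℕ => (conjMat (fourierMat g (m - k))).mulVec (α k))
    (fun i => co (fun t => densF g α t i) m) :=
  (hasSum_nat_of_int (f := fun k : ℤ => (conjMat (fourierMat g (m - k))).mulVec (α k))
    fun n hn => by simp only [h0 n hn, Matrix.mulVec_zero]).2 (hasSum_densF hα hg m)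

lemma hasSum_densF_nonpos (h0 : ∀ k > 0, α k = 0) (m : ℤ) :
    HasSum (fun k : ℕ => (conjMat (fourierMat g (m + k))).mulVec (α (-(k : ℤ))))
    (fun i => co (fun t => densF g α t i) m) := by
  have h1 := (Equiv.neg ℤ).hasSum_iff.2 (hasSum_densF hα hg m)
  refine (hasSum_nat_of_int
    (f := fun k : ℤ => (conjMat (fourierMat g (m + k))).mulVec (α (-k))) fun n hn => by
      simp only [h0 (-n) (by omega), Matrix.mulVec_zero]).2 (h1.congr_fun fun k => ?_)
  simp

end

lemma v2_densF {g : ℝ → Matrix (Fin T) (Fin T) ℂ} (hg2 : ∀ i j, MemLp (fun t => g t i j) 2 nu)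
    (hα : ∀ l, Summable fun k => ‖α k l‖) : V2 (densF g α) := fun i =>
  memLp_finsetSum _ fun j _ => memLp_fser_mul (hα j) (memLp_star (hg2 i j))

include hα in
lemma v2_factF {Φ : ℝ → Matrix (Fin T) (Fin q) ℂ} (hΦ : ∀ i j, MemLp (fun t => Φ t i j) 2 nu) :
    V2 (factF Φ α) := fun p => memLp_finsetSum _ fun j _ => memLp_fser_mul (hα j) (hΦ j p)

lemma co_causal {c : ℕ → ℂ} {F : ℝ → ℂ} (h : IsCausalSeries c F) (n : ℤ) :
    co F n = extZ c n := by
  obtain ⟨-, h1, h2⟩ := (isCausalSeries_iff _ _).1 h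
  rcases lt_or_ge n 0 with hn | hn
  · rw [h2 n hn, extZ_neg c hn]
  · rw [extZ, if_pos hn, ← h1, Int.toNat_of_nonneg hn]

section

variable {Φ : ℝ → Matrix (Fin T) (Fin q) ℂ} {φ : ℕ → Matrix (Fin T) (Fin q) ℂ}
  (hΦ : ∀ i j, IsCausalSeries (fun k => φ k i j) (fun t => Φ t i j))
include hα hΦ

lemma hasSum_factF (n : ℤ) (p : Fin q) :
    HasSum (fun k : ℤ => ∑ j, extZ (fun k => φ k j p) (n - k) * α k j)
      (co (fun t => factF Φ α t p) n) := by
  have hm : ∀ j, MemLp (fun t => Φ t j p) 2 nu := fun j => ((isCausalSeries_iff _ _).1 (hΦ j p)).1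
  have h1 := hasSum_sum (s := Finset.univ) fun j _ =>
    hasSum_co_fser_mul (hα j) ((hm j).integrable (by norm_num)) n
  rw [← co_sum _ fun j _ => (memLp_fser_mul (hα j) (hm j)).integrable (by norm_num)] at h1
  refine h1.congr_fun fun k => Finset.sum_congr rfl fun j _ => ?_
  rw [co_causal (hΦ j p), mul_comm]

lemma co_factF_nat (h0 : ∀ k < 0, α k = 0) (n : ℕ) (p : Fin q) :
    co (fun t => factF Φ α t p) n = phiTilde φ (fun k => α k) n p := by
  have h1 := (hasSum_nat_of_int (fun k hk => by simp [h0 k hk])).2 (hasSum_factF hα hΦ n p)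
  refine h1.unique ?_
  have h2 : HasSum (fun k : ℕ => ∑ j, extZ (fun k => φ k j p) ((n : ℤ) - k) * α k j)
      (∑ k ∈ Finset.range (n + 1), ∑ j, extZ (fun k => φ k j p) ((n : ℤ) - k) * α k j) :=
    hasSum_sum_of_ne_finset_zero fun k hk => by
      refine Finset.sum_eq_zero fun j _ => ?_
      rw [extZ_neg _ (by simp only [Finset.mem_range] at hk; omega), zero_mul]
  convert! h2 using 1
  rw [phiTilde, Finset.sum_apply]
  refine Finset.sum_congr rfl fun k hk => ?_
  rw [Matrix.mulVec, dotProduct]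
  refine Finset.sum_congr rfl fun j _ => ?_
  have : ((n : ℤ) - k) = ((n - k : ℕ) : ℤ) := by
    simp only [Finset.mem_range] at hk; omega
  rw [this, extZ_natCast, Matrix.transpose_apply]

lemma co_factF_neg (h0 : ∀ k < 0, α k = 0) {n : ℤ} (hn : n < 0) (p : Fin q) :
    co (fun t => factF Φ α t p) n = 0 := by
  refine (hasSum_factF hα hΦ n p).unique ?_
  convert! hasSum_zero using 1
  ext k
  refine Finset.sum_eq_zero fun j _ => ?_
  rcases lt_or_ge k 0 with hk | hk
  · simp [h0 k hk]
  · rw [extZ_neg _ (by omega), zero_mul]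

lemma co_factF_nonpos (h0 : ∀ k > 0, α k = 0) (n : ℕ) (p : Fin q) :
    co (fun t => factF Φ α t p) n = phiTildePlus φ (fun k => α (-(k : ℤ))) n p := by
  have h1 : ∀ p, HasSum (fun k : ℕ => ((φ (n + k)).transpose.mulVec (α (-(k : ℤ)))) p)
      (co (fun t => factF Φ α t p) n) := fun p => by
    have h2 := (hasSum_nat_of_int fun k hk => by simp [h0 (-k) (by omega)]).2
      ((Equiv.neg ℤ).hasSum_iff.2 (hasSum_factF hα hΦ n p))
    refine h2.congr_fun fun k => ?_
    rw [Matrix.mulVec, dotProduct]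
    simp only [Function.comp, Equiv.neg_apply]
    refine Finset.sum_congr rfl fun j _ => ?_
    have : ((n : ℤ) - -(k : ℤ)) = ((n + k : ℕ) : ℤ) := by push_cast; ring
    rw [this, extZ_natCast, Matrix.transpose_apply]
  have h3 : HasSum (fun k : ℕ => (φ (n + k)).transpose.mulVec (α (-(k : ℤ))))
      (fun p => co (fun t => factF Φ α t p) n) := Pi.hasSum.2 h1
  rw [phiTildePlus, h3.tsum_eq]

end

/-- From `g = Φ Φ*` follows `conj g = conj Φ · Φᵀ`; this is what expresses `c⁻` and `c⁺` through
`Φ̃` and `Φ̃⁺`. -/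
lemma densF_eq_conjMul {Φ : ℝ → Matrix (Fin T) (Fin q) ℂ} {g : ℝ → Matrix (Fin T) (Fin T) ℂ}
    (h : ∀ᵐ t ∂nu, g t = Φ t * (Φ t).conjTranspose) :
    ∀ᵐ t ∂nu, densF g α t = conjMul Φ (factF Φ α) t := by
  filter_upwards [h] with t ht
  ext i
  simp only [densF, conjMul, factF, ht, Matrix.mul_apply, Matrix.conjTranspose_apply, star_sum,
    star_mul', star_star, Finset.mul_sum]
  rw [Finset.sum_comm]
  refine Finset.sum_congr rfl fun p _ => Finset.sum_congr rfl fun j _ => ?_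
  ring

lemma hasSum_conjMul {a b : ℕ} {M : ℝ → Matrix (Fin a) (Fin b) ℂ}
    {c : ℕ → Matrix (Fin a) (Fin b) ℂ}
    (hM : ∀ i j, IsCausalSeries (fun k => c k i j) (fun t => M t i j)) {D : ℝ → Fin b → ℂ}
    (hD : V2 D) (m : ℤ) :
    HasSum (fun l : ℕ => (conjMat (c l)).mulVec fun p => co (fun t => D t p) (l + m))
      (fun i => co (fun t => conjMul M D t i) m) := by
  refine Pi.hasSum.2 fun i => ?_
  have h1 := hasSum_sum (s := Finset.univ) fun p _ => hasSum_co_star_mul (hM i p) (hD p) m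
  rw [← co_sum _ fun p _ =>
    integrable_star_mul ((isCausalSeries_iff _ _).1 (hM i p)).1 (hD p)] at h1
  exact h1

end Series

lemma extZ_apply {T : ℕ} (a : ℕ → Fin T → ℂ) (k : ℤ) (l : Fin T) :
    extZ a k l = extZ (fun k => a k l) k := by
  simp only [extZ]; split_ifs <;> rfl

lemma summable_extZ_apply {T : ℕ} {a : ℕ → Fin T → ℂ} (ha : ∀ l, Summable fun k => ‖a k l‖)
    (l : Fin T) : Summable fun k : ℤ => ‖extZ a k l‖ := by
  simp only [extZ_apply]
  exact summable_extZ (ha l)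

/-- Block summation of a series. -/
lemma sum_block {E : Type*} [AddCommGroup E] [Module ℂ E] (T : ℕ) (a : ℕ → ℂ) (x : ℤ → E)
    (N : ℕ) : ∑ m ∈ Finset.range N, ∑ p : Fin T, blockCoeff T a m p • blockVec T x (-(m : ℤ)) p
      = ∑ k ∈ Finset.range (N * T), a k • x (-(k : ℤ)) := by
  induction N with
  | zero => simp
  | succ N ih =>
    rw [Finset.sum_range_succ, ih, Nat.succ_mul, Finset.sum_range_add, ← Fin.sum_univ_eq_sum_range
      (fun p => a (N * T + p) • x (-((N * T + p : ℕ) : ℤ)))]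
    congr 1
    refine Finset.sum_congr rfl fun p _ => ?_
    simp only [blockCoeff, blockVec]
    congr 2
    push_cast; ring

lemma summable_blockCoeff {T : ℕ} {a : ℕ → ℂ} (ha : Summable fun k : ℕ =>
      ‖(WithLp.toLp 2 (blockCoeff T a k) : EuclideanSpace ℂ (Fin T))‖) (l : Fin T) :
    Summable fun k => ‖blockCoeff T a k l‖ :=
  Summable.of_nonneg_of_le (fun _ => norm_nonneg _) (fun k =>
    PiLp.norm_apply_le (WithLp.toLp 2 (blockCoeff T a k) : EuclideanSpace ℂ (Fin T)) l) ha

/-- The energy of a causal vector series. -/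
lemma hasSum_sqNorm {q : ℕ} {c : ℕ → Fin q → ℂ} {u : ℝ → Fin q → ℂ}
    (h : ∀ j, IsCausalSeries (fun m => c m j) (fun t => u t j)) :
    HasSum (fun m => sqNorm (c m)) (‖vec u‖ ^ 2) := by
  have hu : V2 u := fun j => ((isCausalSeries_iff _ _).1 (h j)).1
  rw [norm_sq_vec hu]
  refine hasSum_sum fun j _ => ?_
  have h1 := hasSum_parseval_sq (hu j)
  rw [← hasSum_nat_of_int fun n hn => by
    rw [co_causal (h j), extZ_neg _ hn, norm_zero, sq, zero_mul]] at h1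
  simpa only [co_causal (h j), extZ_natCast] using h1

/-! ### The noise functional in the frequency domain. -/

section Noise

variable {T q : ℕ} {Φ : ℝ → Matrix (Fin T) (Fin q) ℂ} {φ : ℕ → Matrix (Fin T) (Fin q) ℂ}
  (hΦ : ∀ i j, IsCausalSeries (fun k => φ k i j) (fun t => Φ t i j))
  {a : ℕ → Fin T → ℂ} (ha : ∀ l, Summable fun k => ‖a k l‖)
include hΦ ha

/-- All functions `e^{-imt} Φ_p` have the same norm for fixed `p`, so the series converges
absolutely; its sum is then identified by its Fourier coefficients. -/
lemma hasSum_vec_factF : HasSum (fun m : ℕ => ∑ p, a m p • vec (rowF Φ (ex (-(m : ℤ))) p))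
    (vec (factF Φ (extZ a))) := by
  have hm : ∀ i j, MemLp (fun t => Φ t i j) 2 nu := fun i j =>
    ((isCausalSeries_iff _ _).1 (hΦ i j)).1
  have hconst : ∀ (m : ℕ) p, ‖vec (rowF Φ (ex (-(m : ℤ))) p)‖ = ‖vec (rowF Φ (ex 0) p)‖ :=
    fun m p => by
      rw [← sq_eq_sq₀ (norm_nonneg _) (norm_nonneg _), norm_sq_vec (v2_rowF_ex hm _ _),
        norm_sq_vec (v2_rowF_ex hm _ _)]
      simp [rowF]
  have hsum : Summable fun m : ℕ => ∑ p, a m p • vec (rowF Φ (ex (-(m : ℤ))) p) :=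
    summable_sum fun p _ => Summable.of_norm (by
      simp only [norm_smul, hconst]
      exact (ha p).mul_right _)
  obtain ⟨x, hx⟩ := hsum
  have hv := v2_factF (summable_extZ_apply ha) hm
  suffices h : x = vec (factF Φ (extZ a)) by rwa [← h]
  rw [← vec_comps x]
  refine vec_congr (v2_comps x) ?_
  have hj : ∀ j, ∀ᵐ t ∂nu, comps x t j = factF Φ (extZ a) t j := fun j => by
    refine ae_eq_of_co ((v2_comps x j).integrable (by norm_num)) ((hv j).integrable (by norm_num))
      fun n => ?_
    rw [← inner_unitF_ex]
    have h1 := hx.mapL (innerSL ℂ (vec (unitF (ex (-n)) j)))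
    simp only [innerSL_apply_apply] at h1
    refine h1.unique ?_
    refine ((hasSum_nat_of_int fun k hk => by simp [extZ_neg a hk]).2
      (hasSum_factF (summable_extZ_apply ha) hΦ n j)).congr_fun fun m => ?_
    rw [inner_sum]
    refine Finset.sum_congr rfl fun p _ => ?_
    rw [inner_smul_right, inner_unitF_ex, extZ_natCast, ← co_causal (hΦ p j), mul_comm]
    congr 1
    rw [co_congr (v := fun t => ex (-(m : ℤ)) t * Φ t p j) (by
      filter_upwards [comps_vec (v2_rowF_ex hm (-(m : ℤ)) p)] with t ht
      rw [ht, rowF]), co_ex_mul, sub_eq_add_neg]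
  filter_upwards [ae_all_iff.2 hj] with t ht
  ext j
  exact ht j

lemma vec_factF_mem_closure : vec (factF Φ (extZ a)) ∈ (Submodule.span ℂ
    (Set.range fun i : ℤ × Fin T => vec (rowF Φ (ex i.1) i.2))).topologicalClosure := by
  refine (Submodule.isClosed_topologicalClosure _).mem_of_tendsto (hasSum_vec_factF hΦ ha)
    (Eventually.of_forall fun s => ?_)
  exact Submodule.sum_mem _ fun m _ => Submodule.sum_mem _ fun p _ => Submodule.smul_mem _ _
    (Submodule.le_topologicalClosure _ (Submodule.subset_span (Set.mem_range_self
      (f := fun i : ℤ × Fin T => vec (rowF Φ (ex i.1) i.2)) (-(m : ℤ), p))))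

end Noise

/-- Pythagoras: `Aξ - B` is the difference of `Aξ + Aη - Y - B`, which lies in `H`, and of `Aη - Y`,
which is orthogonal to `H`. The squared error exceeds its minimum by the squared norm of the former,
so the minimizer is unique. -/
lemma isOptimalEstimate_iff {Ω : Type*} [MeasurableSpace Ω] {P : Measure Ω}
    {H : Submodule ℂ (Lp ℂ 2 P)} {Aξ Aη Y : Lp ℂ 2 P} (hY : Y ∈ H)
    (horth : ∀ y ∈ H, inner ℂ (Aη - Y) y = 0) (A' : Lp ℂ 2 P) :
    IsOptimalEstimate H Aξ (Aξ + Aη) A' ↔ A' = Aξ + Aη - Y := by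
  have key : ∀ B, Aξ + Aη - B ∈ H →
      ‖Aξ - B‖ ^ 2 = ‖Aη - Y‖ ^ 2 + ‖Aξ + Aη - Y - B‖ ^ 2 := fun B hB => by
    have hz : Aξ + Aη - Y - B ∈ H := by
      rw [sub_right_comm]; exact H.sub_mem hB hY
    have h1 := norm_sub_sq (𝕜 := ℂ) (Aη - Y) (Aξ + Aη - Y - B)
    rw [horth _ hz] at h1
    have h2 : (Aη - Y) - (Aξ + Aη - Y - B) = -(Aξ - B) := by abel
    rw [h2, norm_neg] at h1
    simpa using h1
  constructor
  · rintro ⟨h1, h2⟩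
    have h3 := h2 (Aξ + Aη - Y) (by simpa using hY)
    have h4 := key _ h1
    have h5 : Aξ - (Aξ + Aη - Y) = -(Aη - Y) := by abel
    rw [h5, norm_neg] at h3
    have h6 : ‖Aξ + Aη - Y - A'‖ ^ 2 ≤ 0 := by
      nlinarith [norm_nonneg (Aξ - A'), norm_nonneg (Aη - Y)]
    have h7 := pow_eq_zero_iff (n := 2) (by norm_num) |>.1 (le_antisymm h6 (sq_nonneg _))
    exact (sub_eq_zero.1 (norm_eq_zero.1 h7)).symm
  · rintro rfl
    refine ⟨by simpa using hY, fun B hB => ?_⟩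
    have h4 := key _ hB
    have h5 : Aξ - (Aξ + Aη - Y) = -(Aη - Y) := by abel
    rw [h5, norm_neg]
    refine le_of_sq_le_sq ?_ (norm_nonneg _)
    nlinarith [sq_nonneg ‖Aξ + Aη - Y - B‖]

/-! ### The weighted factorization, the spectral characteristic and the projection. -/

section Weighted

variable {r T q : ℕ} {d s : Fin r → ℕ} {μ : Fin r → ℤ}
  {Θ : ℝ → Matrix (Fin T) (Fin q) ℂ} {Ψ : ℝ → Matrix (Fin q) (Fin T) ℂ}

lemma exists_norm_beta_le (d s : Fin r → ℕ) : ∃ C : ℝ, ∀ᵐ t ∂nu, ‖beta d s t‖ ≤ C := by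
  obtain ⟨C, hC⟩ := (isCompact_Icc (a := -Real.pi) (b := Real.pi)).exists_bound_of_continuousOn
    (continuous_beta d s).continuousOn
  refine ⟨C, ?_⟩
  rw [ae_nu]
  filter_upwards [ae_restrict_mem measurableSet_Ico] with t ht
  exact hC t ⟨ht.1, ht.2.le⟩

lemma integrable_obsDensity {f g : ℝ → Matrix (Fin T) (Fin T) ℂ}
    (hf : ∀ i j, Integrable (fun t => f t i j) circ)
    (hg : ∀ i j, Integrable (fun t => g t i j) circ) (i j : Fin T) :
    Integrable (fun t => obsDensity d s f g t i j) nu := by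
  obtain ⟨C, hC⟩ := exists_norm_beta_le d s
  have h1 : Integrable (fun t => ((‖beta d s t‖ ^ 2 : ℝ) : ℂ) * g t i j) nu := by
    refine (integrable_nu_iff.2 (hg i j)).bdd_mul (c := C ^ 2) ?_ ?_
    · have := continuous_beta d s
      exact (by fun_prop : Continuous fun t => ((‖beta d s t‖ ^ 2 : ℝ) : ℂ)).aestronglyMeasurable
    · filter_upwards [hC] with t ht
      rw [Complex.norm_real, Real.norm_of_nonneg (by positivity)]
      exact pow_le_pow_left₀ (norm_nonneg _) ht 2
  exact (integrable_nu_iff.2 (hf i j)).add h1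

/-- The factorization of the observed density in weighted form. -/
lemma ObsFactorization.weightedFactor {p : ℝ → Matrix (Fin T) (Fin T) ℂ}
    {θ : ℕ → Matrix (Fin T) (Fin q) ℂ} {ψ : ℕ → Matrix (Fin q) (Fin T) ℂ}
    (hs : ∀ i, 0 < s i) (hμ : ∀ i, μ i ≠ 0) (hp : ∀ i j, Integrable (fun t => p t i j) nu)
    (h : ObsFactorization d s μ p θ Θ ψ Ψ) : WeightedFactor p (gam d s μ) Θ Ψ := by
  have hχ := chi_ne_zero d s μ hs hμ
  have hβ := beta_ne_zero d s
  have hmeas : AEStronglyMeasurable (gam d s μ) nu :=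
    ((continuous_beta d s).measurable.div
      (continuous_chi d s μ).measurable).aestronglyMeasurable
  have hfac : ∀ᵐ t ∂nu, p t
      = ((‖gam d s μ t‖ ^ 2 : ℝ) : ℂ) • (Θ t * (Θ t).conjTranspose) := by
    filter_upwards [hχ, hβ, ae_nu_iff.2 h.factorΘ] with t h1 h2 h3
    rw [← h3, smul_smul]
    have h1' : (‖chi d s μ t‖ : ℂ) ≠ 0 := by simpa using h1
    have h2' : (‖beta d s t‖ : ℂ) ≠ 0 := by simpa using h2
    have : ((‖gam d s μ t‖ ^ 2 : ℝ) : ℂ) * ((‖chi d s μ t‖ ^ 2 / ‖beta d s t‖ ^ 2 : ℝ) : ℂ)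
        = 1 := by
      rw [gam, norm_div]
      push_cast
      field_simp
    rw [this, one_smul]
  refine ⟨hfac, ?_, hmeas, h.memLp, fun l j => ?_, ae_nu_iff.2 h.inverse, ?_⟩
  · filter_upwards [hχ, hβ] with t h1 h2 using div_ne_zero h2 h1
  -- The weight `γ` is unbounded in general. Square integrability comes from the diagonal of `p`:
  -- `p_{ll} = |γ|² ∑ |Θ_{lj}|²` is integrable.
  · have hm : AEStronglyMeasurable (fun t => gam d s μ t * Θ t l j) nu :=
      hmeas.mul (h.memLp l j).1
    refine (memLp_two_iff_integrable_sq_norm hm).2 ((hp l l).norm.mono' (hm.norm.pow 2) ?_)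
    filter_upwards [hfac] with t ht
    have h1 : p t l l = ((‖gam d s μ t‖ ^ 2 * ∑ j, ‖Θ t l j‖ ^ 2 : ℝ) : ℂ) := by
      rw [ht, Matrix.smul_apply, Matrix.mul_apply, smul_eq_mul]
      push_cast
      congr 1
      exact Finset.sum_congr rfl fun j _ => Complex.mul_conj' _
    rw [h1, Complex.norm_real, Real.norm_of_nonneg (by positivity),
      Real.norm_of_nonneg (by positivity), norm_mul, mul_pow]
    exact mul_le_mul_of_nonneg_left (Finset.single_le_sum (f := fun j => ‖Θ t l j‖ ^ 2)
      (fun _ _ => by positivity) (Finset.mem_univ j)) (by positivity)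
  -- `Θ Ψ (Θ Θ*) = Θ (Ψ Θ) Θ* = Θ Θ*`, and `Θ Θ*`, a nonzero multiple of `p`, is invertible and can
  -- be cancelled.
  · filter_upwards [hχ, hβ, ae_nu_iff.2 h.factorΘ, ae_nu_iff.2 h.inverse,
      ae_nu_iff.2 h.invertible] with t h1 h2 h3 h4 h5
    have hN : IsUnit (Θ t * (Θ t).conjTranspose) := by
      rw [← h3, Matrix.isUnit_iff_isUnit_det, Matrix.det_smul]
      refine IsUnit.mul (IsUnit.pow _ (isUnit_iff_ne_zero.2 ?_)) h5
      have h1' : ‖chi d s μ t‖ ≠ 0 := by simpa using h1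
      have h2' : ‖beta d s t‖ ≠ 0 := by simpa using h2
      exact_mod_cast div_ne_zero (pow_ne_zero 2 h1') (pow_ne_zero 2 h2')
    refine hN.mul_right_cancel ?_
    rw [one_mul, Matrix.mul_assoc, ← Matrix.mul_assoc (Ψ t), h4, Matrix.one_mul]

variable {p : ℝ → Matrix (Fin T) (Fin T) ℂ} (W : WeightedFactor p (gam d s μ) Θ Ψ)
include W

/-- `Θᵀ Ψᵀ = (Ψ Θ)ᵀ = 1` and `γ · χ / β = 1`: the spectral characteristic is the preimage of `w` in
`L₂(p)`. -/
lemma imgF_specChar (w : ℝ → Fin q → ℂ) :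
    ∀ᵐ t ∂nu, w t = imgF (gam d s μ) Θ (specChar d s μ Ψ w) t := by
  filter_upwards [W.ne_zero, W.left_inv] with t ht hi
  have h1 : beta d s t ≠ 0 := fun h => ht (by rw [gam, h, zero_div])
  have h2 : chi d s μ t ≠ 0 := fun h => ht (by rw [gam, h, div_zero])
  ext j
  have h3 : ∀ l, specChar d s μ Ψ w t l * Θ t l j
      = (chi d s μ t / beta d s t) * ∑ i, w t i * (Ψ t i l * Θ t l j) := fun l => by
    rw [specChar, Pi.smul_apply, Matrix.mulVec, dotProduct, smul_eq_mul, mul_assoc,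
      Finset.sum_mul]
    congr 1
    refine Finset.sum_congr rfl fun i _ => ?_
    rw [Matrix.transpose_apply]; ring
  rw [imgF, Finset.sum_congr rfl fun l _ => h3 l, ← Finset.mul_sum, Finset.sum_comm, ← mul_assoc]
  have h4 : ∀ i, ∑ l, w t i * (Ψ t i l * Θ t l j) = w t i * (if i = j then 1 else 0) := fun i => by
    rw [← Finset.mul_sum, ← Matrix.mul_apply, hi, Matrix.one_apply]
  simp_rw [h4]
  have h5 : gam d s μ t * (chi d s μ t / beta d s t) = 1 := by rw [gam]; field_simp
  rw [h5]
  simp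

/-- The right inverse `Θ Ψ = 1` recovers `γ h` from its image. This gives the almost everywhere
uniqueness of the spectral characteristic. -/
lemma ae_eq_of_imgF_eq {h h' : ℝ → Fin T → ℂ}
    (heq : ∀ᵐ t ∂nu, imgF (gam d s μ) Θ h t = imgF (gam d s μ) Θ h' t) :
    ∀ᵐ t ∂nu, h t = h' t := by
  filter_upwards [W.ne_zero, W.right_inv, heq] with t ht hi he
  have key : ∀ h : ℝ → Fin T → ℂ, ∀ l, ∑ j, imgF (gam d s μ) Θ h t j * Ψ t j l
      = gam d s μ t * h t l := fun h l => by
    simp only [imgF, mul_assoc, ← Finset.mul_sum, Finset.sum_mul]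
    congr 1
    rw [Finset.sum_comm]
    have h4 : ∀ i, ∑ j, h t i * (Θ t i j * Ψ t j l) = h t i * (if i = l then 1 else 0) :=
      fun i => by rw [← Finset.mul_sum, ← Matrix.mul_apply, hi, Matrix.one_apply]
    simp_rw [h4]
    simp
  ext l
  have h1 := key h l
  rw [he, key h' l] at h1
  exact (mul_left_cancel₀ ht h1).symm

omit W in
lemma aemeasurable_specChar (hΨ : ∀ j l, MemLp (fun t => Ψ t j l) 2 nu) {w : ℝ → Fin q → ℂ}
    (hw : V2 w) : AEMeasurable (specChar d s μ Ψ w) circ := by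
  refine aemeasurable_pi_iff.2 fun l => ?_
  have h : AEStronglyMeasurable (fun t => specChar d s μ Ψ w t l) nu := by
    simp only [specChar, Pi.smul_apply, Matrix.mulVec, dotProduct, smul_eq_mul,
      Matrix.transpose_apply]
    refine AEStronglyMeasurable.mul measurable_ratio.aestronglyMeasurable ?_
    exact Finset.aestronglyMeasurable_fun_sum _ fun j _ => (hΨ j l).1.mul (hw j).1
  exact (aestronglyMeasurable_nu_iff.1 h).aemeasurable

/-- The coefficients of the projection on the closed span of `e^{-ikt} Θ_l`, `k ≥ 0`. -/
lemma co_projection {θ : ℕ → Matrix (Fin T) (Fin q) ℂ} {ψ : ℕ → Matrix (Fin q) (Fin T) ℂ}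
    (hΘ : ∀ i j, IsCausalSeries (fun k => θ k i j) (fun t => Θ t i j))
    (hΨ : ∀ i j, IsCausalSeries (fun k => ψ k i j) (fun t => Ψ t i j)) (G : LL q) {w : LL q}
    (hw : w ∈ (Submodule.span ℂ (Set.range fun i : ℕ × Fin T =>
      vec (rowF Θ (ex (-(i.1 : ℤ))) i.2))).topologicalClosure)
    (hort : ∀ y ∈ (Submodule.span ℂ (Set.range fun i : ℕ × Fin T =>
      vec (rowF Θ (ex (-(i.1 : ℤ))) i.2))).topologicalClosure, inner ℂ y (G - w) = 0)
    (j : Fin q) : IsCausalSeries (fun m : ℕ => co (fun t => comps G t j) m)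
      (fun t => comps w t j) := by
  rw [isCausalSeries_iff]
  refine ⟨v2_comps w j, fun n => ?_, fun n hn => ?_⟩
  -- For `n ≥ 0` the function `e^{-int} δ_j` belongs to the span by outerness, so `G` and `w` have
  -- the same coefficient.
  · rw [← inner_unitF_ex, ← inner_unitF_ex, eq_comm, ← sub_eq_zero, ← inner_sub_right]
    exact hort _ (unitF_mem_closure W.left_inv W.memLp
      (fun j l => ((isCausalSeries_iff _ _).1 (hΨ j l)).1)
      (fun j l => ((isCausalSeries_iff _ _).1 (hΨ j l)).2.2) n j)
  -- For `n < 0` the generators have no such coefficient, as `Θ` is causal, and the closure inherits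
  -- this.
  · rw [← inner_unitF_ex]
    refine inner_eq_zero_of_mem_closure_span (fun i => ?_) hw
    rw [inner_unitF_ex, co_congr (v := fun t => ex (-(i.1 : ℤ)) t * Θ t i.2 j) (by
      filter_upwards [comps_vec (v2_rowF_ex W.memLp (-(i.1 : ℤ)) i.2)] with t ht
      rw [ht, rowF]), co_ex_mul, co_causal (hΘ _ _), extZ_neg _ (by omega)]

end Weighted

/-! ### Identification of the series in the answer. -/

section Formulas

variable {r T q q' : ℕ} {d s μ : Fin r → ℕ} {a : ℕ → Fin T → ℂ}
  (ha : ∀ l, Summable fun k => ‖a k l‖)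

/-- Beyond `n(γ)` the sequence `aMinus` vanishes by itself, so the cutoff in `bMinus` loses nothing.
-/
lemma bMinus_eq (k : ℕ) : bMinus d s μ a k = negPart (aMinus d s μ a) (-(k : ℤ)) := by
  ext l
  rw [bMinus, negPart]
  by_cases h0 : k = 0
  · simp [h0]
  · rw [if_neg (by omega : ¬ (0 : ℤ) ≤ -(k : ℤ))]
    by_cases hn : k ≤ nGamma d s μ
    · rw [if_pos ⟨by omega, hn⟩]
    · rw [if_neg (by tauto), aMinus_eq_zero d s μ a (by omega)]

lemma nonnegPart_nat (α : ℤ → Fin T → ℂ) (k : ℕ) : nonnegPart α (k : ℤ) = α k := by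
  ext l; simp [nonnegPart]

lemma nonnegPart_of_neg (α : ℤ → Fin T → ℂ) : ∀ k < 0, nonnegPart α k = 0 := fun k hk => by
  ext l; simp [nonnegPart, not_le.2 hk]

lemma negPart_of_pos (α : ℤ → Fin T → ℂ) : ∀ k > 0, negPart α k = 0 := fun k hk => by
  ext l; simp [negPart, hk.le]

section

variable {g : ℝ → Matrix (Fin T) (Fin T) ℂ} (hg : ∀ i j, Integrable (fun t => g t i j) nu)
include ha hg

lemma hasSum_cMinus (m : ℤ) : HasSum
    (fun k : ℕ => (conjMat (fourierMat g (m - k))).mulVec (aMinus d s μ a k))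
    (fun i => co (fun t => densF g (nonnegPart (aMinus d s μ a)) t i) m) := by
  have h := hasSum_densF_nonneg (summable_nonnegPart (summable_aMinus d s μ ha)) hg
    (nonnegPart_of_neg _) m
  simpa only [nonnegPart_nat] using h

lemma cMinus_eq (m : ℕ) : cMinus d s μ g a m
    = fun i => co (fun t => densF g (nonnegPart (aMinus d s μ a)) t i) m :=
  (hasSum_cMinus ha hg m).tsum_eq

lemma cPlus_eq (m : ℕ) : cPlus d s μ g a m
    = fun i => co (fun t => densF g (negPart (aMinus d s μ a)) t i) m := by
  have h := hasSum_densF_nonpos (summable_negPart (summable_aMinus d s μ ha)) hg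
    (negPart_of_pos _) m
  simp only [← bMinus_eq] at h
  exact h.tsum_eq

end

section

variable {g : ℝ → Matrix (Fin T) (Fin T) ℂ} {φ : ℕ → Matrix (Fin T) (Fin q') ℂ}
  {Φ : ℝ → Matrix (Fin T) (Fin q') ℂ} (hΦ : NoiseFactorization g φ Φ)
include ha hΦ

/-- Parseval against the causal `Φ` in `conj g = conj Φ · Φᵀ`; the sums `phiTilde` are the
coefficients of `Φᵀ` times the nonnegative part of the series. -/
lemma hasSum_phiTilde (m : ℕ) : HasSum (fun l : ℕ => (conjMat (φ l)).mulVec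
      (phiTilde φ (fun k => aMinus d s μ a (k : ℤ)) (l + m)))
    (fun i => co (fun t => densF g (nonnegPart (aMinus d s μ a)) t i) m) := by
  have hα := summable_nonnegPart (summable_aMinus d s μ ha)
  have h := hasSum_conjMul hΦ.series (v2_factF hα hΦ.memLp) m
  have e : ∀ i, co (fun t => conjMul Φ (factF Φ (nonnegPart (aMinus d s μ a))) t i) m
      = co (fun t => densF g (nonnegPart (aMinus d s μ a)) t i) m := fun i => by
    refine co_congr ?_ _
    filter_upwards [densF_eq_conjMul (α := nonnegPart (aMinus d s μ a))
      (ae_nu_iff.2 hΦ.factor)] with t ht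
    rw [ht]
  simp only [e] at h
  refine h.congr_fun fun l => ?_
  congr 1
  ext p
  rw [← Nat.cast_add, co_factF_nat hα hΦ.series (nonnegPart_of_neg _)]
  simp only [nonnegPart_nat]

lemma hasSum_phiTildePlus (m : ℕ) : HasSum (fun l : ℕ => (conjMat (φ l)).mulVec
      (phiTildePlus φ (bMinus d s μ a) (l + m)))
    (fun i => co (fun t => densF g (negPart (aMinus d s μ a)) t i) m) := by
  have hα := summable_negPart (summable_aMinus d s μ ha)
  have h := hasSum_conjMul hΦ.series (v2_factF hα hΦ.memLp) m
  have e : ∀ i, co (fun t => conjMul Φ (factF Φ (negPart (aMinus d s μ a))) t i) m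
      = co (fun t => densF g (negPart (aMinus d s μ a)) t i) m := fun i => by
    refine co_congr ?_ _
    filter_upwards [densF_eq_conjMul (α := negPart (aMinus d s μ a))
      (ae_nu_iff.2 hΦ.factor)] with t ht
    rw [ht]
  simp only [e] at h
  refine h.congr_fun fun l => ?_
  congr 1
  ext p
  rw [← Nat.cast_add, co_factF_nonpos hα hΦ.series (negPart_of_pos _)]
  have : bMinus d s μ a = fun k : ℕ => negPart (aMinus d s μ a) (-(k : ℤ)) := funext bMinus_eq
  rw [this]

/-- By Parseval the coefficients of this function carry the variance of the noise functional, the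
first sum in the error formula. -/
lemma isCausalSeries_factF (p : Fin q') :
    IsCausalSeries (fun m => phiTilde φ a m p) (fun t => factF Φ (extZ a) t p) := by
  have hα := summable_extZ_apply ha
  refine (isCausalSeries_iff _ _).2 ⟨v2_factF hα hΦ.memLp p, fun n => ?_, fun n hn =>
    co_factF_neg hα hΦ.series (fun k hk => extZ_neg a hk) hn p⟩
  rw [co_factF_nat hα hΦ.series fun k hk => extZ_neg a hk]
  simp only [extZ_natCast]

end

section

variable {g : ℝ → Matrix (Fin T) (Fin T) ℂ} (hg : ∀ i j, MemLp (fun t => g t i j) 2 nu)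
  {ψ : ℕ → Matrix (Fin q) (Fin T) ℂ} {Ψ : ℝ → Matrix (Fin q) (Fin T) ℂ}
  (hΨ : ∀ i j, IsCausalSeries (fun k => ψ k i j) (fun t => Ψ t i j))
include ha hg hΨ

lemma hasSum_psiC_cMinus (m : ℕ) : HasSum
    (fun k : ℕ => (conjMat (ψ k)).mulVec (cMinus d s μ g a (k + m)))
    (fun j => co (fun t => conjMul Ψ (densF g (nonnegPart (aMinus d s μ a))) t j) m) := by
  have h := hasSum_conjMul hΨ
    (v2_densF hg (summable_nonnegPart (summable_aMinus d s μ ha))) m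
  simpa only [cMinus_eq ha fun i j => (hg i j).integrable (by norm_num), Nat.cast_add] using h

lemma hasSum_psiC_cPlus (m : ℕ) : HasSum
    (fun k : ℕ => (conjMat (ψ k)).mulVec (cPlus d s μ g a (k + m)))
    (fun j => co (fun t => conjMul Ψ (densF g (negPart (aMinus d s μ a))) t j) m) := by
  have h := hasSum_conjMul hΨ
    (v2_densF hg (summable_negPart (summable_aMinus d s μ ha))) m
  simpa only [cPlus_eq ha fun i j => (hg i j).integrable (by norm_num), Nat.cast_add] using h

/-- The minus and plus sequences come from the two halves of `a_{-μ}`, and the coefficients are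
additive. The splitting is only notational: the answer depends on `conj Ψ · conj g · A_{-μ}` as a
whole. -/
lemma psiC_add (m : ℕ) (j : Fin q) :
    (psiC ψ (cMinus d s μ g a) m + psiC ψ (cPlus d s μ g a) m) j
      = co (fun t => conjMul Ψ (densF g (aMinus d s μ a)) t j) m := by
  have hα := summable_aMinus d s μ ha
  rw [psiC, psiC, (hasSum_psiC_cMinus ha hg hΨ m).tsum_eq, (hasSum_psiC_cPlus ha hg hΨ m).tsum_eq,
    Pi.add_apply]
  have hi : ∀ D : ℝ → Fin T → ℂ, V2 D → Integrable (fun t => conjMul Ψ D t j) nu := fun D hD =>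
    integrable_finsetSum _ fun p _ =>
      integrable_star_mul ((isCausalSeries_iff _ _).1 (hΨ j p)).1 (hD p)
  rw [← co_add (hi _ (v2_densF hg (summable_nonnegPart hα)))
    (hi _ (v2_densF hg (summable_negPart hα)))]
  congr 1; ext t
  simp only [conjMul, ← Finset.sum_add_distrib, ← mul_add, densF_add_parts hα]

end

end Formulas

/-! ### The adjoint image of the noise functional. -/

section Core

variable {Ω : Type*} [MeasurableSpace Ω] {P : Measure Ω}

/-- The adjoint image of the noise functional: `G = conj Ψ · conj g · A_{-μ}`. -/
lemma comps_adjoint_eq {r T q q' : ℕ} {d s μ : Fin r → ℕ}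
    {a : ℕ → Fin T → ℂ} (ha : ∀ l, Summable fun k => ‖a k l‖)
    {g : ℝ → Matrix (Fin T) (Fin T) ℂ} {φ : ℕ → Matrix (Fin T) (Fin q') ℂ}
    {Φ : ℝ → Matrix (Fin T) (Fin q') ℂ} (hΦ : NoiseFactorization g φ Φ)
    (hg2 : ∀ i j, MemLp (fun t => g t i j) 2 nu)
    {Θ : ℝ → Matrix (Fin T) (Fin q) ℂ} {Ψ : ℝ → Matrix (Fin q) (Fin T) ℂ}
    (hΘ : ∀ i j, MemLp (fun t => Θ t i j) 2 nu) (hinv : ∀ᵐ t ∂nu, Ψ t * Θ t = 1)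
    {J : LL q' →L[ℂ] Lp ℂ 2 P}
    (hJi : ∀ a ∈ (Submodule.span ℂ (Set.range fun i : ℤ × Fin T =>
          vec (rowF Φ (ex i.1) i.2))).topologicalClosure,
      ∀ b ∈ (Submodule.span ℂ (Set.range fun i : ℤ × Fin T =>
          vec (rowF Φ (ex i.1) i.2))).topologicalClosure,
        inner ℂ (J a) (J b) = inner ℂ a b)
    {V : LL q →L[ℂ] Lp ℂ 2 P} {X₀ : ℤ → Fin T → Lp ℂ 2 P}
    (hX : ∀ m l, V (vec (rowF Θ (ex m) l))
      = X₀ m l + J (vec (rowF Φ (fun t => ex m t * chi d s (fun i => (μ i : ℤ)) t) l)))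
    (h0 : ∀ m l, inner ℂ (X₀ m l) (J (vec (factF Φ (extZ a)))) = 0) {G : LL q}
    (hG : ∀ y, inner ℂ y G = inner ℂ (V y) (J (vec (factF Φ (extZ a))))) :
    ∀ᵐ t ∂nu, comps G t = conjMul Ψ (densF g (aMinus d s μ a)) t := by
  have hαZ := summable_extZ_apply ha
  have hα := summable_aMinus d s μ ha
  have hv := v2_factF hαZ hΦ.memLp
  -- Testing `G` against `e^{-int} Θ_l`: the signal part of the increment is orthogonal to the noise
  -- functional, and the noise part contributes the coefficient of `conj χ · conj g · A`.
  have hl : ∀ l, ∀ᵐ t ∂nu, ∑ j, star (Θ t l j) * comps G t j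
      = densF g (aMinus d s μ a) t l := fun l => by
    refine ae_eq_of_co (integrable_inner_vec (hΘ l) (v2_comps G))
      ((v2_densF hg2 hα l).integrable (by norm_num)) fun n => ?_
    have h1 := hG (vec (rowF Θ (ex (-n)) l))
    have hchiv : V2 (rowF Φ (fun t => ex (-n) t * chi d s (fun i => (μ i : ℤ)) t) l) := fun p => by
      have := memLp_ex_mul (memLp_chi_mul d s (fun i => (μ i : ℤ)) (hΦ.memLp l p)) (-n)
      simpa only [rowF, mul_assoc] using this
    rw [hX, inner_add_left, h0, zero_add, hJi _ (rowF_chi_mem_closure d s _ hΦ.memLp _ _) _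
      (vec_factF_mem_closure hΦ.series ha), inner_vec hchiv hv, ← vec_comps G,
      inner_vec (v2_rowF_ex hΘ _ _) (v2_comps G)] at h1
    have e1 : co (fun t => ∑ j, star (Θ t l j) * comps G t j) n
        = ∫ t, ∑ j, star (rowF Θ (ex (-n)) l t j) * comps G t j ∂nu := by
      rw [co]
      congr 1; ext t
      rw [Finset.mul_sum]
      refine Finset.sum_congr rfl fun j _ => ?_
      rw [rowF, star_mul', star_ex, neg_neg, mul_assoc]
    rw [e1, h1, co]
    refine integral_congr_ae ?_
    filter_upwards [densF_eq_conjMul (α := extZ a) (ae_nu_iff.2 hΦ.factor)] with t ht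
    have e2 : densF g (aMinus d s μ a) t l
        = star (chi d s (fun i => (μ i : ℤ)) t) * densF g (extZ a) t l := by
      rw [densF, densF, Finset.mul_sum]
      refine Finset.sum_congr rfl fun j _ => ?_
      have : (fun k => extZ a k j) = extZ fun k => a k j := funext fun k => extZ_apply a k j
      rw [this, ← mul_assoc, star_chi_mul_fser d s μ ha]
    rw [e2, ht, conjMul, Finset.mul_sum, Finset.mul_sum]
    refine Finset.sum_congr rfl fun p _ => ?_
    rw [rowF, star_mul', star_mul', star_ex, neg_neg]; ring
  filter_upwards [comps_eq_conj_mul hinv (comps G), ae_all_iff.2 hl] with t h1 h2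
  ext j
  rw [h1, conjMul]
  exact Finset.sum_congr rfl fun l _ => by rw [h2]

end Core

end

end GMFilter

/-! ### Assembly of the theorem. -/

theorem mainTheorem2 {Ω : Type*} [MeasurableSpace Ω] (P : Measure Ω) [IsProbabilityMeasure P]
    (r T q q' : ℕ) (hT : 0 < T)
    (d s μ : Fin r → ℕ) (hd : ∀ i, 0 < d i) (hs : ∀ i, 0 < s i) (hμ : ∀ i, 0 < μ i)
    -- the signal and the noise
    (ξ η : ℤ → Lp ℂ 2 P)
    (hξ : HasPeriodicGMIncrements P T d s ξ)
    (hη : IsPeriodicallyStationary P T η)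
    (hξ_mean : ∀ μ' : Fin r → ℤ, AdmissibleStep μ' → ∀ m : ℤ,
      ∫ ω, (gmIncrement d (fun i => T * s i) μ' ξ m : Lp ℂ 2 P) ω ∂P = 0)
    (hη_mean : ∀ m : ℤ, ∫ ω, (η m) ω ∂P = 0)
    (h_uncorr : ∀ m k : ℤ, inner ℂ (η k) (ξ m) = 0)
    -- spectral densities of the block sequences and their factorizations
    (f g : ℝ → Matrix (Fin T) (Fin T) ℂ)
    (hf : HasGMSpectralDensity P d s (blockVec T ξ) f)
    (hg : HasSpectralDensity P (blockVec T η) g)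
    (θ : ℕ → Matrix (Fin T) (Fin q) ℂ) (Θ : ℝ → Matrix (Fin T) (Fin q) ℂ)
    (ψ : ℕ → Matrix (Fin q) (Fin T) ℂ) (Ψ : ℝ → Matrix (Fin q) (Fin T) ℂ)
    (φ : ℕ → Matrix (Fin T) (Fin q') ℂ) (Φ : ℝ → Matrix (Fin T) (Fin q') ℂ)
    (hΘΨ : ObsFactorization d s (fun i => (μ i : ℤ)) (obsDensity d s f g) θ Θ ψ Ψ)
    (hΦ : NoiseFactorization g φ Φ)
    (hg_sq : ∀ i j, Summable fun k : ℤ => ‖fourierMat g k i j‖ ^ 2)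
    -- the functional
    (a : ℕ → ℂ)
    (ha₁ : Summable fun k : ℕ =>
      ‖(WithLp.toLp 2 (blockCoeff T a k) : EuclideanSpace ℂ (Fin T))‖)
    (ha₂ : Summable fun k : ℕ => ((k : ℝ) + 1) *
      ‖(WithLp.toLp 2 (blockCoeff T a k) : EuclideanSpace ℂ (Fin T))‖ ^ 2)
    (Aξ : Lp ℂ 2 P)
    (hAξ : Tendsto (fun N : ℕ => ∑ k ∈ Finset.range N, a k • ξ (-(k : ℤ))) atTop (𝓝 Aξ)) :
    -- the functional in block form
    Tendsto (fun N : ℕ => ∑ m ∈ Finset.range N, ∑ p : Fin T,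
        blockCoeff T a m p • blockVec T ξ (-(m : ℤ)) p) atTop (𝓝 Aξ) ∧
    -- the series and operators in the formulas
    (∀ m : ℕ, Summable fun k : ℕ => (conjMat (fourierMat g ((m : ℤ) - k))).mulVec
        (aMinus d s μ (blockCoeff T a) k)) ∧
    (∀ m : ℕ, Summable fun l : ℕ => (conjMat (φ l)).mulVec
        (phiTilde φ (fun k => aMinus d s μ (blockCoeff T a) (k : ℤ)) (l + m))) ∧
    (∀ m : ℕ, cMinus d s μ g (blockCoeff T a) m = ∑' l : ℕ, (conjMat (φ l)).mulVec
        (phiTilde φ (fun k => aMinus d s μ (blockCoeff T a) (k : ℤ)) (l + m))) ∧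
    (∀ m : ℕ, Summable fun l : ℕ => (conjMat (φ l)).mulVec
        (phiTildePlus φ (bMinus d s μ (blockCoeff T a)) (l + m))) ∧
    (∀ m : ℕ, cPlus d s μ g (blockCoeff T a) m = ∑' l : ℕ, (conjMat (φ l)).mulVec
        (phiTildePlus φ (bMinus d s μ (blockCoeff T a)) (l + m))) ∧
    (∀ m : ℕ, Summable fun k : ℕ =>
        (conjMat (ψ k)).mulVec (cMinus d s μ g (blockCoeff T a) (k + m))) ∧
    (∀ m : ℕ, Summable fun k : ℕ =>
        (conjMat (ψ k)).mulVec (cPlus d s μ g (blockCoeff T a) (k + m))) ∧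
    (Summable fun m : ℕ => sqNorm (phiTilde φ (blockCoeff T a) m)) ∧
    (Summable fun m : ℕ => sqNorm (psiC ψ (cMinus d s μ g (blockCoeff T a)) m
        + psiC ψ (cPlus d s μ g (blockCoeff T a)) m)) ∧
    -- the spectral process of the observed increments exists
    (∃ Z : ℝ → Fin T → Lp ℂ 2 P, IsSpectralProcess d s (fun i => (μ i : ℤ)) (obsDensity d s f g)
        (fun m l => gmIncrement d s (fun i => (μ i : ℤ))
          (fun n => blockVec T (ξ + η) n l) m) Z) ∧
    -- the optimal estimate, its spectral characteristic and its mean square error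
    ∃ (Aζ : Lp ℂ 2 P) (W : ℝ → Fin q → ℂ),
      Tendsto (fun N : ℕ => ∑ m ∈ Finset.range N, ∑ p : Fin T, blockCoeff T a m p •
          (blockVec T ξ (-(m : ℤ)) p + blockVec T η (-(m : ℤ)) p)) atTop (𝓝 Aζ) ∧
      (∀ i, IsCausalSeries (fun m => (psiC ψ (cMinus d s μ g (blockCoeff T a)) m
          + psiC ψ (cPlus d s μ g (blockCoeff T a)) m) i) (fun t => W t i)) ∧
      InL20 d s (fun i => (μ i : ℤ)) (obsDensity d s f g)
          (specChar d s (fun i => (μ i : ℤ)) Ψ W) ∧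
      ∀ Z : ℝ → Fin T → Lp ℂ 2 P,
        IsSpectralProcess d s (fun i => (μ i : ℤ)) (obsDensity d s f g)
          (fun m l => gmIncrement d s (fun i => (μ i : ℤ))
            (fun n => blockVec T (ξ + η) n l) m) Z →
        ∃ Y : Lp ℂ 2 P,
          IsStochInt (obsDensity d s f g) Z (specChar d s (fun i => (μ i : ℤ)) Ψ W) Y ∧
          (∀ A' : Lp ℂ 2 P,
            IsOptimalEstimate (obsSpace T d s (fun i => (μ i : ℤ)) (ξ + η)) Aξ Aζ A'
              ↔ A' = Aζ - Y) ∧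
          (∀ h : ℝ → Fin T → ℂ, IsStochInt (obsDensity d s f g) Z h Y
              ↔ h =ᵐ[circ] specChar d s (fun i => (μ i : ℤ)) Ψ W) ∧
          ‖Aξ - (Aζ - Y)‖ ^ 2 = (∑' m : ℕ, sqNorm (phiTilde φ (blockCoeff T a) m))
            - ∑' m : ℕ, sqNorm (psiC ψ (cMinus d s μ g (blockCoeff T a)) m
                + psiC ψ (cPlus d s μ g (blockCoeff T a)) m) := by

  set μ' : Fin r → ℤ := fun i => (μ i : ℤ) with hμ'
  set A : ℕ → Fin T → ℂ := blockCoeff T a with hA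
  have hμ0 : ∀ i, μ' i ≠ 0 := fun i => by simpa [hμ'] using (hμ i).ne'
  have hadm : AdmissibleStep μ' := Or.inl fun i => by simpa [hμ'] using hμ i
  have ha : ∀ l, Summable fun k => ‖A k l‖ := summable_blockCoeff ha₁
  have hgi : ∀ i j, Integrable (fun t => g t i j) nu := fun i j =>
    integrable_nu_iff.2 (hg.integrable i j)
  -- Riesz–Fischer: square summable `g(k)` put `g` into `L²`, as needed to pair `conj g · A_{-μ}`
  -- with `Ψ ∈ L²` by Parseval.
  have hg2 : ∀ i j, MemLp (fun t => g t i j) 2 nu := fun i j => by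
    refine memLp_two_of_summable_co (hgi i j) ?_
    refine ((Equiv.neg ℤ).summable_iff.2 (hg_sq i j)).congr fun n => ?_
    rw [Function.comp, fourierMat, ← integral_nu_complex, co]
    simp only [← ex_neg_eq, Equiv.neg_apply, neg_neg]
  have hxy : ∀ m k i j, inner ℂ (blockVec T η k j) (blockVec T ξ m i) = 0 :=
    fun m k i j => h_uncorr _ _
  have W := hΘΨ.weightedFactor hs hμ0 (integrable_obsDensity hf.integrable hg.integrable)
  obtain ⟨J, hJ, hJi⟩ := exists_noise_isometry hΦ hg
  -- the noise functional
  set Aη : Lp ℂ 2 P := J (vec (factF Φ (extZ A))) with hAη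
  have hAηsum : HasSum (fun m : ℕ => ∑ p, A m p • blockVec T η (-(m : ℤ)) p) Aη := by
    have h1 := (hasSum_vec_factF hΦ.series ha).mapL J
    refine h1.congr_fun fun m => ?_
    rw [map_sum]
    exact Finset.sum_congr rfl fun p _ => by rw [map_smul, hJ]
  have hξblock : Tendsto (fun N : ℕ => ∑ m ∈ Finset.range N, ∑ p : Fin T,
      A m p • blockVec T ξ (-(m : ℤ)) p) atTop (𝓝 Aξ) := by
    simp only [hA, sum_block]
    -- Sums over whole blocks are the partial sums at the multiples of `T`, a subsequence of a
    -- convergent sequence.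
    exact hAξ.comp (tendsto_id.atTop_mul_const' hT)
  have hX₀ : ∀ m l, inner ℂ (gmIncrement d s μ' (fun n => blockVec T ξ n l) m) Aη = 0 := by
    intro m l
    have h1 := hAηsum.mapL (innerSL ℂ (gmIncrement d s μ' (fun n => blockVec T ξ n l) m))
    simp only [innerSL_apply_apply] at h1
    refine h1.unique ?_
    convert! hasSum_zero using 1
    ext k
    have h2 : ∀ m k i j, inner ℂ (blockVec T ξ m i) (blockVec T η k j) = 0 := fun m k i j => by
      rw [← inner_conj_symm, hxy, map_zero]
    simp only [gmIncrement, sum_inner, inner_sum, ← Int.cast_smul_eq_zsmul ℂ, inner_smul_left,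
      inner_smul_right, h2, mul_zero, Finset.sum_const_zero]
  -- the isometry of the observed increments
  set X : ℤ → Fin T → Lp ℂ 2 P := fun m l =>
    gmIncrement d s μ' (fun n => blockVec T (ξ + η) n l) m with hXdef
  obtain ⟨V, hVX, hV⟩ := exists_isometry_of_gram
    (fun i : ℤ × Fin T => vec (rowF Θ (ex i.1) i.2)) (fun i => X i.1 i.2)
    (fun i j => inner_increment hadm hf hg hxy hΘΨ hΦ i.1 j.1 i.2 j.2)
  have hdense := dense_rowF_ex W.left_inv W.memLp
  rw [hdense] at hV
  replace hV : ∀ x y, inner ℂ (V x) (V y) = inner ℂ x y := fun x y => hV x trivial y trivial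
  replace hVX : ∀ m l, V (vec (rowF Θ (ex m) l)) = X m l := fun m l => hVX (m, l)
  -- the projection
  set N := (Submodule.span ℂ (Set.range fun i : ℕ × Fin T =>
    vec (rowF Θ (ex (-(i.1 : ℤ))) i.2))).topologicalClosure with hN
  -- As `V` is isometric and `H = V(N)`, projecting `Aη` on `H` amounts to projecting `V* Aη` on `N`
  -- and applying `V`.
  set G : LL q := ContinuousLinearMap.adjoint V Aη with hGdef
  have hG : ∀ y, inner ℂ y G = inner ℂ (V y) Aη := fun y =>
    ContinuousLinearMap.adjoint_inner_right V y Aη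
  set w : LL q := N.starProjection G with hwdef
  have hwN : w ∈ N := Submodule.starProjection_apply_mem _ _
  have hort : ∀ y ∈ N, inner ℂ y (G - w) = 0 := fun y hy =>
    Submodule.inner_right_of_mem_orthogonal hy (N.sub_starProjection_mem_orthogonal G)
  have hGc := comps_adjoint_eq (d := d) (s := s) (μ := μ) ha hΦ hg2 W.memLp W.left_inv hJi
    (fun m l => by
      rw [hVX, ← gmIncrement_noise d s μ' hΦ.memLp hJ, ← gmIncrement_add]; rfl) hX₀ hG
  have hWc : ∀ j, IsCausalSeries (fun m => (psiC ψ (cMinus d s μ g A) m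
      + psiC ψ (cPlus d s μ g A) m) j) (fun t => comps w t j) := fun j => by
    have h1 := co_projection W hΘΨ.seriesΘ hΘΨ.seriesΨ G hwN hort j
    convert! h1 using 2 with m
    rw [psiC_add ha hg2 hΘΨ.seriesΨ]
    refine co_congr ?_ _
    filter_upwards [hGc] with t ht
    rw [ht]
  have himg := imgF_specChar W (comps w)
  have hv2 : V2 (imgF (gam d s μ') Θ (specChar d s μ' Ψ (comps w))) := (v2_comps w).congr himg
  have hvec : vec (imgF (gam d s μ') Θ (specChar d s μ' Ψ (comps w))) = w := by
    rw [← vec_congr (v2_comps w) himg, vec_comps]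
  have hsm : AEMeasurable (specChar d s μ' Ψ (comps w)) circ := aemeasurable_specChar
    (fun j l => ((isCausalSeries_iff _ _).1 (hΘΨ.seriesΨ j l)).1) (v2_comps w)
  have hEn1 := hasSum_sqNorm (isCausalSeries_factF ha hΦ)
  have hEn2 := hasSum_sqNorm hWc
  rw [vec_comps] at hEn2
  refine ⟨hξblock, fun m => (hasSum_cMinus ha hgi m).summable,
    fun m => (hasSum_phiTilde ha hΦ m).summable,
    fun m => by rw [cMinus_eq ha hgi, (hasSum_phiTilde ha hΦ m).tsum_eq],
    fun m => (hasSum_phiTildePlus ha hΦ m).summable,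
    fun m => by rw [cPlus_eq ha hgi, (hasSum_phiTildePlus ha hΦ m).tsum_eq],
    fun m => (hasSum_psiC_cMinus ha hg2 hΘΨ.seriesΨ m).summable,
    fun m => (hasSum_psiC_cPlus ha hg2 hΘΨ.seriesΨ m).summable,
    hEn1.summable, hEn2.summable, exists_spectralProcess W hV hVX,
    Aξ + Aη, comps w, ?_, hWc, inL20_of_mem_closure W hsm hv2 (by rw [hvec]; exact hwN), ?_⟩
  · refine (hξblock.add hAηsum.tendsto_sum_nat).congr fun n => ?_
    simp only [smul_add, Finset.sum_add_distrib]
  · intro Z hZ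
    obtain ⟨V', hV', hZV, hVX'⟩ := hZ.exists_isometry W
    -- The isometry attached to an arbitrary spectral process agrees with `V` on a total family.
    -- Hence the integral of the spectral characteristic is the same variable for every `Z`.
    have hVV : V' = V := by
      refine ContinuousLinearMap.ext_on (s := Set.range fun i : ℤ × Fin T =>
        vec (rowF Θ (ex i.1) i.2)) (Submodule.dense_iff_topologicalClosure_eq_top.2 hdense) ?_
      rintro _ ⟨i, rfl⟩
      exact (hVX' i.1 i.2).trans (hVX i.1 i.2).symm
    subst hVV
    have hY : IsStochInt (obsDensity d s f g) Z (specChar d s μ' Ψ (comps w)) (V' w) :=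
      (isStochInt_iff W hV' hZV _ _).2 ⟨hsm, hv2, by rw [hvec]⟩
    have hobs := obsSpace_eq hT d s μ' (ξ + η)
    have hYH : V' w ∈ obsSpace T d s μ' (ξ + η) := by
      rw [hobs]
      have := map_mem_closure_span V' _ hwN
      simpa only [hVX] using this
    have horthH : ∀ y ∈ obsSpace T d s μ' (ξ + η), inner ℂ (Aη - V' w) y = 0 := fun y hy => by
      rw [hobs] at hy
      refine inner_eq_zero_of_mem_closure_span (fun i => ?_) hy
      have h1 : gmIncrement d s μ' (fun n => blockVec T (ξ + η) n i.2) (-(i.1 : ℤ))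
          = V' (vec (rowF Θ (ex (-(i.1 : ℤ))) i.2)) := (hVX _ _).symm
      rw [h1, ← inner_conj_symm, inner_sub_right, hV', ← hG, ← inner_sub_right,
        hort _ (Submodule.le_topologicalClosure _ (Submodule.subset_span
          (Set.mem_range_self (f := fun i : ℕ × Fin T => vec (rowF Θ (ex (-(i.1 : ℤ))) i.2)) i))),
        map_zero]
    refine ⟨V' w, hY, isOptimalEstimate_iff hYH horthH, fun h => ⟨fun hh => ?_, fun hh => ?_⟩, ?_⟩
    · obtain ⟨hm, hv, he⟩ := (isStochInt_iff W hV' hZV _ _).1 hh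
      have h1 : vec (imgF (gam d s μ') Θ h)
          = vec (imgF (gam d s μ') Θ (specChar d s μ' Ψ (comps w))) := by
        rw [hvec, ← sub_eq_zero, ← norm_eq_zero, ← norm_map_of_inner hV', map_sub, ← he, sub_self,
          norm_zero]
      exact ae_nu_iff.1 (ae_eq_of_imgF_eq W (ae_eq_of_vec_eq hv hv2 h1))
    · have h1 : ∀ᵐ t ∂nu, specChar d s μ' Ψ (comps w) t = h t :=
        ae_nu_iff.2 (by filter_upwards [hh] with t ht using ht.symm)
      have h2 := ae_mul_ae (gam d s μ') Θ h1
      exact (isStochInt_iff W hV' hZV _ _).2 ⟨hsm.congr hh.symm, hv2.congr h2, by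
        rw [← vec_congr hv2 h2, hvec]⟩
    · rw [hEn1.tsum_eq, hEn2.tsum_eq]
      have hmem := vec_factF_mem_closure hΦ.series ha
      have e1 : ‖Aη‖ ^ 2 = ‖vec (factF Φ (extZ A))‖ ^ 2 := by
        rw [@norm_sq_eq_re_inner ℂ, hAη, hJi _ hmem _ hmem, ← @norm_sq_eq_re_inner ℂ]
      have e2 : inner ℂ (V' w) (Aη - V' w) = 0 := by
        rw [← inner_conj_symm, horthH _ hYH, map_zero]
      have e3 : Aξ - (Aξ + Aη - V' w) = -(Aη - V' w) := by abel
      -- `Aη` is the sum of its projection `V' w` and an orthogonal remainder, which up to sign is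
      -- the estimation error.
      have e4 := norm_add_sq (𝕜 := ℂ) (V' w) (Aη - V' w)
      rw [e2, add_sub_cancel, norm_map_of_inner hV'] at e4
      rw [e3, norm_neg, ← e1, e4]
      simp
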